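/- For $r\in\mathbb{Q}\setminus\{0,1,\tfrac19\}$ let $E_r$ be the elliptic curve over $\mathbb{Q}$ given by the plane cubic $xy-r(x+y+1)(xy+x+y)=0$. Let $g(\tau)=\eta(2\tau)^3\eta(6\tau)^3=\sum_{n\ge1}a_nq^n$, where $q=e^{2\pi i\tau}$ and $\eta(\tau)=q^{1/24}\prod_{n\ge1}(1-q^n)$, and let $\chi_{-3}$ be the Dirichlet character of $\mathbb{Q}(\sqrt{-3})$, i.e. the nontrivial character modulo $3$. For an elliptic curve $E/\mathbb{Q}$ the symmetric square $L$-function is the Euler product $L(\mathrm{Sym}^2E,s)=\prod_pP_p(p^{-s})^{-1}$, $\operatorname{Re}s>2$, together with its analytic continuation. Here $P_p(X)=(1-\alpha_p^2X)(1-\alpha_p\beta_pX)(1-\beta_p^2X)$ with $\alpha_p+\beta_p=p+1-\#\tilde E(\mathbb{F}_p)$ and $\alpha_p\beta_p=p$ if $E$ has good reduction $\tilde E$ at $p$. If $E$ has bad reduction at $p$, then $P_p(X)=\det\bigl(1-\mathrm{Frob}_p^{-1}X\mid(\mathrm{Sym}^2H^1_\ell(E))^{I_p}\bigr)$, where $\ell\ne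 p$ is a prime, $H^1_\ell(E)=\mathrm{Hom}_{\mathbb{Z}_\ell}(T_\ell E,\mathbb{Q}_\ell)$ is the dual of the $\ell$-adic Tate module of $E$ over $\overline{\mathbb{Q}}_p$, $I_p\subset\mathrm{Gal}(\overline{\mathbb{Q}}_p/\mathbb{Q}_p)$ is the inertia group, and $\mathrm{Frob}_p$ is an arithmetic Frobenius element (take $\ell=3$ if $p=2$ and $\ell=2$ otherwise). Let $L(g,s)=\sum_{n\ge 1}a_nn^{-s}$ for $\operatorname{Re}s>2$, together with its analytic continuation. **Theorem.** The curve $E_{1/3}$ is isomorphic over $\mathbb{Q}$ to $y^2=x^3+1$. For $\operatorname{Re}s>2$ the Euler products of $L(\mathrm{Sym}^2E_{-1/3},s)$ and $L(\mathrm{Sym}^2E_{1/3},s)$ and the Dirichlet series of $L(g,s)$ converge absolutely; all three functions extend to entire functions of $s$, and for all $s\in\mathbb{C}$ $$L(\mathrm{Sym}^2E_{-1/3},s)=L(\mathrm{Sym}^2E_{1/3},s)=L(\chi_{-3},s-1)\,L(g,s).$$ -/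

import Mathlib

set_option maxSynthPendingDepth 3

open Polynomial

noncomputable section

/-! ### The Tate module of an abelian group -/

/-- The `ℓ`-adic Tate module `T_ℓ A = lim A[ℓ^n]`: sequences `(x 0, x 1, x 2, …)` in `A` with
`x 0 = 0` and `ℓ • x (n + 1) = x n` (so that `x n` is killed by `ℓ ^ n`). -/
def TateModule (ℓ : ℕ) (A : Type*) [AddCommGroup A] : AddSubgroup (ℕ → A) where
  carrier := {x | x 0 = 0 ∧ ∀ n, ℓ • x (n + 1) = x n}
  zero_mem' := by simp
  add_mem' := by
    rintro x y ⟨hx, hx'⟩ ⟨hy, hy'⟩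
    exact ⟨by simp [hx, hy], fun n => by simp [smul_add, hx', hy']⟩
  neg_mem' := by
    rintro x ⟨hx, hx'⟩
    exact ⟨by simp [hx], fun n => by simp [hx']⟩

namespace TateModule

section

variable {ℓ : ℕ} {A : Type*} [AddCommGroup A]

theorem pow_smul_apply (x : TateModule ℓ A) (n : ℕ) : (ℓ ^ n) • x.1 n = 0 := by
  induction n with
  | zero => simp [x.2.1]
  | succ k ih => rw [pow_succ, mul_smul, x.2.2 k, ih]

theorem smul_congr (x : TateModule ℓ A) {n k k' : ℕ}
    (h : (k : ZMod (ℓ ^ n)) = (k' : ZMod (ℓ ^ n))) : k • x.1 n = k' • x.1 n := by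
  rw [ZMod.natCast_eq_natCast_iff] at h
  have key : ∀ m : ℕ, m • x.1 n = (m % ℓ ^ n) • x.1 n := fun m => by
    conv_lhs => rw [← Nat.div_add_mod m (ℓ ^ n)]
    rw [add_smul, mul_comm, mul_smul, pow_smul_apply, smul_zero, zero_add]
  rw [key k, key k', show k % ℓ ^ n = k' % ℓ ^ n from h]

end

section

variable {ℓ : ℕ} [Fact ℓ.Prime] {A B : Type*} [AddCommGroup A] [AddCommGroup B]

/-- `a : ℤ_ℓ` acts on the `n`-th component, which is killed by `ℓ ^ n`, through `a mod ℓ ^ n`. -/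
instance : SMul ℤ_[ℓ] (TateModule ℓ A) where
  smul a x := ⟨fun n => (PadicInt.toZModPow n a).val • x.1 n, by
    refine ⟨by simp [x.2.1], fun n => ?_⟩
    rw [smul_comm, x.2.2 n]
    refine smul_congr x ?_
    rw [ZMod.natCast_zmod_val, ZMod.natCast_val, PadicInt.cast_toZModPow n (n + 1) n.le_succ]⟩

theorem smul_apply (a : ℤ_[ℓ]) (x : TateModule ℓ A) (n : ℕ) :
    (a • x).1 n = (PadicInt.toZModPow n a).val • x.1 n := rfl

instance : Module ℤ_[ℓ] (TateModule ℓ A) where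
  one_smul x := Subtype.ext <| funext fun n => by
    rw [smul_apply, smul_congr x (k' := 1) (by simp), one_smul]
  mul_smul a b x := Subtype.ext <| funext fun n => by
    rw [smul_apply, smul_apply, smul_apply, ← mul_smul]
    exact smul_congr x (by simp)
  smul_zero a := Subtype.ext <| funext fun n => by simp [smul_apply]
  smul_add a x y := Subtype.ext <| funext fun n => by simp [smul_apply]
  add_smul a b x := Subtype.ext <| funext fun n => by
    rw [AddSubgroup.coe_add, Pi.add_apply, smul_apply, smul_apply, smul_apply, ← add_smul]
    exact smul_congr x (by simp)
  zero_smul x := Subtype.ext <| funext fun n => by simp [smul_apply]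

/-- The map `T_ℓ A → T_ℓ B` induced by a homomorphism `A → B`. -/
def map (f : A →+ B) : TateModule ℓ A →ₗ[ℤ_[ℓ]] TateModule ℓ B where
  toFun x := ⟨fun n => f (x.1 n), by
    simp [x.2.1], fun n => by rw [← map_nsmul, x.2.2 n]⟩
  map_add' x y := Subtype.ext <| funext fun n => by simp
  map_smul' a x := Subtype.ext <| funext fun n => by simp [smul_apply]

end

end TateModule

/-! ### Invariants in the symmetric square of the dual of a representation -/

section SymForms

variable {R : Type*} (K : Type*) {M G : Type*} [CommRing R] [Field K] [Algebra R K]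
  [AddCommGroup M] [Module R M] [Group G]

/-- For a representation `ρ` of `G` on an `R`-module `M` and `V* = Hom_R(M, K)`, the invariants
`(Sym² V*)^I` of a subgroup `I`; here `Sym² V*` is realized as the `K`-vector space of
symmetric bilinear forms `M × M → K`. -/
def symSqInvariants (ρ : G →* Module.End R M) (I : Subgroup G) :
    Submodule K (M →ₗ[R] M →ₗ[R] K) where
  carrier := {B | (∀ x y, B x y = B y x) ∧ ∀ σ ∈ I, ∀ x y, B (ρ σ x) (ρ σ y) = B x y}
  zero_mem' := by simp
  add_mem' := by
    rintro B C ⟨hB, hB'⟩ ⟨hC, hC'⟩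
    refine ⟨fun x y => ?_, fun σ hσ x y => ?_⟩
    · simp [hB x y, hC x y]
    · simp [hB' σ hσ x y, hC' σ hσ x y]
  smul_mem' := by
    rintro c B ⟨hB, hB'⟩
    refine ⟨fun x y => ?_, fun σ hσ x y => ?_⟩
    · simp [hB x y]
    · simp [hB' σ hσ x y]

/-- The action of `φ⁻¹` on `(Sym² V*)^I` for a normal subgroup `I`: it sends the form `B` to
`(x, y) ↦ B (φ x) (φ y)`. -/
def symSqPullback (ρ : G →* Module.End R M) (I : Subgroup G) [hI : I.Normal] (φ : G) :
    Module.End K (symSqInvariants K ρ I) where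
  toFun B := ⟨B.1.compl₁₂ (ρ φ) (ρ φ), by
    refine ⟨fun x y => B.2.1 _ _, fun σ hσ x y => ?_⟩
    have h := B.2.2 _ (hI.conj_mem σ hσ φ) (ρ φ x) (ρ φ y)
    simp only [← Module.End.mul_apply, ← map_mul, inv_mul_cancel_right] at h
    simp only [LinearMap.compl₁₂_apply, ← Module.End.mul_apply, ← map_mul]
    exact h⟩
  map_add' B C := rfl
  map_smul' c B := rfl

/-- The value at `t` of the polynomial `det(1 - φ⁻¹ X | (Sym² V*)^I)`. -/
def symSqDet (ρ : G →* Module.End R M) (I : Subgroup G) [I.Normal] (φ : G) (t : K) : K :=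
  LinearMap.det (LinearMap.id - t • symSqPullback K ρ I φ)

/-- Only the class of `φ` modulo `I` matters. -/
theorem symSqPullback_congr (ρ : G →* Module.End R M) (I : Subgroup G) [hI : I.Normal] {φ ψ : G}
    (h : φ⁻¹ * ψ ∈ I) : symSqPullback K ρ I φ = symSqPullback K ρ I ψ := by
  ext B x y
  have h := B.2.2 _ (hI.conj_mem _ h φ) (ρ φ x) (ρ φ y)
  simp only [← Module.End.mul_apply, ← map_mul, inv_mul_cancel_right, mul_inv_cancel_left] at h
  exact h.symm

end SymForms

/-! ### Inertia and Frobenius in the absolute Galois group of `ℚ_p` -/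

section Galois

variable (p : ℕ) [Fact p.Prime]

/-- The absolute Galois group of `ℚ_p`. -/
abbrev PadicGal : Type := PadicAlgCl p ≃ₐ[ℚ_[p]] PadicAlgCl p

variable {p}

theorem PadicGal.norm_apply (σ : PadicGal p) (x : PadicAlgCl p) : ‖σ x‖ = ‖x‖ :=
  (spectralNorm_eq_of_equiv (K := ℚ_[p]) (L := PadicAlgCl p) σ x).symm

variable (p)

/-- The inertia group: the elements that act trivially on the residue field of the algebraic
closure of `ℚ_p`. -/
def inertiaGroup : Subgroup (PadicGal p) where
  carrier := {σ | ∀ x : PadicAlgCl p, ‖x‖ ≤ 1 → ‖σ x - x‖ < 1}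
  one_mem' := by intro x _; simp
  mul_mem' := by
    intro σ τ hσ hτ x hx
    have h : (σ * τ) x - x = σ (τ x - x) + (σ x - x) := by
      rw [map_sub, sub_add_sub_cancel]; rfl
    rw [h]
    refine (IsUltrametricDist.norm_add_le_max _ _).trans_lt (max_lt ?_ (hσ x hx))
    rw [PadicGal.norm_apply]
    exact hτ x hx
  inv_mem' := by
    intro σ hσ x hx
    have h : σ⁻¹ x - x = -(σ⁻¹ (σ x - x)) := by
      rw [map_sub, neg_sub]
      congr 1
      exact (AlgEquiv.symm_apply_apply σ x).symm
    rw [h, norm_neg, PadicGal.norm_apply]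
    exact hσ x hx

instance : (inertiaGroup p).Normal where
  conj_mem := by
    intro σ hσ φ x hx
    have h : (φ * σ * φ⁻¹) x - x = φ (σ (φ⁻¹ x) - φ⁻¹ x) := by
      rw [map_sub]
      congr 1
      exact (AlgEquiv.apply_symm_apply φ x).symm
    rw [h, PadicGal.norm_apply]
    exact hσ _ (by rwa [PadicGal.norm_apply])

variable {p}

/-- `σ` is an (arithmetic) Frobenius element: it acts as `x ↦ x ^ p` on the residue field of the
algebraic closure of `ℚ_p`. -/
def IsFrobenius (σ : PadicGal p) : Prop :=
  ∀ x : PadicAlgCl p, ‖x‖ ≤ 1 → ‖σ x - x ^ p‖ < 1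

theorem IsFrobenius.inv_mul_mem {φ ψ : PadicGal p} (hφ : IsFrobenius φ) (hψ : IsFrobenius ψ) :
    φ⁻¹ * ψ ∈ inertiaGroup p := by
  intro x hx
  have h : (φ⁻¹ * ψ) x - x = φ⁻¹ ((ψ x - x ^ p) + -(φ x - x ^ p)) := by
    rw [← sub_eq_add_neg, sub_sub_sub_cancel_right, map_sub]
    congr 1
    exact (AlgEquiv.symm_apply_apply φ x).symm
  rw [h, PadicGal.norm_apply]
  refine (IsUltrametricDist.norm_add_le_max _ _).trans_lt (max_lt (hψ x hx) ?_)
  rw [norm_neg]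
  exact hφ x hx

end Galois

/-! ### The symmetric square `L`-function of an elliptic curve over `ℚ` -/

section SymSq

/-- An auxiliary prime `ℓ ≠ p`. -/
def auxPrime (p : ℕ) : ℕ := if p = 2 then 3 else 2

instance (p : ℕ) : Fact (auxPrime p).Prime :=
  ⟨by unfold auxPrime; split_ifs; exacts [Nat.prime_three, Nat.prime_two]⟩

variable (W : WeierstrassCurve ℚ) (p : ℕ) [Fact p.Prime]

instance : DecidableEq (PadicAlgCl p) := Classical.decEq _

/-- The group of points of `W` over the algebraic closure of `ℚ_p`. -/
abbrev LocalPoints : Type :=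
  ((W.baseChange ℚ_[p]).baseChange (PadicAlgCl p)).toAffine.Point

/-- The `ℓ`-adic Tate module of `W` over the algebraic closure of `ℚ_p`, with `ℓ ≠ p`. -/
abbrev LocalTate : Type := TateModule (auxPrime p) (LocalPoints W p)

/-- The action of the Galois group on the Tate module. -/
def tateRep : PadicGal p →* Module.End ℤ_[auxPrime p] (LocalTate W p) where
  toFun σ := TateModule.map (WeierstrassCurve.Affine.Point.map (W' := W.baseChange ℚ_[p])
    (σ : PadicAlgCl p →ₐ[ℚ_[p]] PadicAlgCl p))
  map_one' := LinearMap.ext fun x => Subtype.ext <| funext fun n =>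
    WeierstrassCurve.Affine.Point.map_id (W' := W.baseChange ℚ_[p]) (x.1 n)
  map_mul' σ τ := LinearMap.ext fun x => Subtype.ext <| funext fun n =>
    (WeierstrassCurve.Affine.Point.map_map (W' := W.baseChange ℚ_[p])
      (τ : PadicAlgCl p →ₐ[ℚ_[p]] PadicAlgCl p) (σ : PadicAlgCl p →ₐ[ℚ_[p]] PadicAlgCl p)
      (x.1 n)).symm

/-- `P = det(1 - Frob_p⁻¹ X | (Sym² H¹_ℓ(W))^{I_p})`, where `H¹_ℓ(W) = Hom(T_ℓ W, ℚ_ℓ)` and `Frob_p`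
is an arithmetic Frobenius element. The equality with the polynomial `P` is stated as equality of
values at all elements of the infinite field `ℚ_ℓ`. -/
def IsGaloisSymSqFactor (P : ℤ[X]) : Prop :=
  ∃ φ : PadicGal p, IsFrobenius φ ∧ ∀ t : ℚ_[auxPrime p],
    symSqDet ℚ_[auxPrime p] (tateRep W p) (inertiaGroup p) φ t = aeval t P

/-- The polynomial `det(1 - Frob_p⁻¹ X | (Sym² H¹_ℓ(W))^{I_p})` does not depend on the choice of the
Frobenius element. -/
theorem IsGaloisSymSqFactor.unique {P Q : ℤ[X]} (hP : IsGaloisSymSqFactor W p P)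
    (hQ : IsGaloisSymSqFactor W p Q) : P = Q := by
  obtain ⟨φ, hφ, h⟩ := hP
  obtain ⟨ψ, hψ, h'⟩ := hQ
  refine Polynomial.map_injective (Int.castRingHom ℚ_[auxPrime p]) Int.cast_injective
    (Polynomial.funext fun t => ?_)
  have key : symSqDet ℚ_[auxPrime p] (tateRep W p) (inertiaGroup p) φ t =
      symSqDet ℚ_[auxPrime p] (tateRep W p) (inertiaGroup p) ψ t := by
    rw [symSqDet, symSqDet, symSqPullback_congr _ _ _ (hφ.inv_mul_mem hψ)]
  have := (h t).symm.trans (key.trans (h' t))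
  simpa [Polynomial.aeval_def, Polynomial.eval_map] using this

/-- A minimal Weierstrass equation of `W` over `ℚ_p`. -/
abbrev localMinimal : WeierstrassCurve ℚ_[p] := (W.baseChange ℚ_[p]).minimal ℤ_[p]

/-- The trace of Frobenius `a_p = p + 1 - #W̃(𝔽_p)`, for the reduction `W̃` of a minimal
equation of `W` at `p`. -/
def frobeniusTrace : ℤ :=
  p + 1 - Nat.card ((localMinimal W p).reduction ℤ_[p]).toAffine.Point

/-- `P` is the polynomial of the Euler factor `P(p⁻ˢ)⁻¹` of `L(Sym² W, s)` at `p`.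
* If `W` has good reduction at `p`, then `P = (1 - α² X)(1 - α β X)(1 - β² X)`, where
  `α + β = a_p` and `α β = p`.
* If `W` has bad reduction at `p`, then `P = det(1 - Frob_p⁻¹ X | (Sym² H¹_ℓ(W))^{I_p})`. -/
def IsSymSqFactor (P : ℤ[X]) : Prop :=
  ((localMinimal W p).HasGoodReduction ℤ_[p] →
    P = (1 - C (p : ℤ) * X) *
      (1 - C (frobeniusTrace W p ^ 2 - 2 * (p : ℤ)) * X + C ((p : ℤ) ^ 2) * X ^ 2)) ∧
  (¬ (localMinimal W p).HasGoodReduction ℤ_[p] → IsGaloisSymSqFactor W p P)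

/-- `L` is the symmetric square `L`-function of `W`: the entire function which is given for
`Re s > 2` by the absolutely convergent Euler product `∏_p P_p(p⁻ˢ)⁻¹`. -/
structure IsSymSqLFunction (L : ℂ → ℂ) : Prop where
  entire : Differentiable ℂ L
  eulerProduct : ∃ P : Nat.Primes → ℤ[X],
    (∀ p : Nat.Primes, haveI : Fact (p : ℕ).Prime := ⟨p.2⟩; IsSymSqFactor W p (P p)) ∧
    ∀ s : ℂ, 2 < s.re →
      HasProd (fun p : Nat.Primes => (aeval ((p : ℂ) ^ (-s)) (P p))⁻¹) (L s)

end SymSq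

/-! ### The cusp form `g` and the character `χ₋₃` -/

/-- `g(τ) = η(2τ)³ η(6τ)³`. -/
def gForm (τ : UpperHalfPlane) : ℂ :=
  ModularForm.eta (2 * (τ : ℂ)) ^ 3 * ModularForm.eta (6 * (τ : ℂ)) ^ 3

/-- `L` is the `L`-function of a weight `3` cusp form `f = ∑ a_n q^n`: the entire function which is
given for `Re s > 2` by the absolutely convergent Dirichlet series `∑ a_n n⁻ˢ`. -/
structure IsCuspLFunction (f : UpperHalfPlane → ℂ) (L : ℂ → ℂ) : Prop where
  entire : Differentiable ℂ L
  dirichletSeries : ∀ s : ℂ, 2 < s.re →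
    LSeriesHasSum (fun n => (UpperHalfPlane.qExpansion 1 f).coeff n) s (L s)

/-- `χ₋₃`, the Dirichlet character of `ℚ(√-3)`: the nontrivial quadratic character modulo `3`. -/
def chiNegThree : DirichletCharacter ℂ 3 :=
  (quadraticChar (ZMod 3)).ringHomComp (Int.castRingHom ℂ)

/-! ### The curves `E_r` -/

/-- The homogeneous form of `xy - r (x + y + 1) (xy + x + y)`. -/
def cubicForm {K : Type*} [CommRing K] (r x y z : K) : K :=
  x * y * z - r * (x + y + z) * (x * y + x * z + y * z)

/-- The elliptic curve `E_r : xy - r (x + y + 1) (xy + x + y) = 0` for `r ≠ 0`, in the Weierstrass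
form that has its rational flex `(1 : -1 : 0)` as the origin; see `curveE_equation`. -/
def curveE (r : ℚ) : WeierstrassCurve ℚ where
  a₁ := (r - 1) / r
  a₂ := (2 - r) / r
  a₃ := (r - 1) / r ^ 2
  a₄ := -((r - 1) / r ^ 2)
  a₆ := 0

/-- The linear change of coordinates `(X : Y : Z) ↦ (Y : -Y - a₁ X - a₃ Z : X)`, which is
invertible for `r ≠ 0, 1` and sends `(0 : 1 : 0)` to `(1 : -1 : 0)`, carries the Weierstrass
equation of `curveE r` to the cubic equation of `E_r`. -/
theorem curveE_equation {r : ℚ} (h0 : r ≠ 0) (h1 : r ≠ 1) {K : Type*} [Field K] [Algebra ℚ K]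
    (X Y Z : K) :
    ((curveE r).baseChange K).toProjective.Equation ![X, Y, Z] ↔
      cubicForm (algebraMap ℚ K r) Y
        (-Y - algebraMap ℚ K (curveE r).a₁ * X - algebraMap ℚ K (curveE r).a₃ * Z) X = 0 := by
  have h0' : algebraMap ℚ K r ≠ 0 := 
    (map_ne_zero (algebraMap ℚ K)).2 h0
  have h1' : algebraMap ℚ K r - 1 ≠ 0 := by
    
    rw [← map_one (algebraMap ℚ K), ← map_sub]
    exact (map_ne_zero (algebraMap ℚ K)).2 (sub_ne_zero.2 h1)
  rw [WeierstrassCurve.Projective.equation_iff]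
  simp only [cubicForm, curveE, WeierstrassCurve.baseChange, WeierstrassCurve.map, map_div₀,
    map_sub, map_one, map_pow, map_neg, map_ofNat, map_zero, Matrix.cons_val]
  generalize algebraMap ℚ K r = ρ at *
  have key : Y * (-Y - (ρ - 1) / ρ * X - (ρ - 1) / ρ ^ 2 * Z) * X
      - ρ * (Y + (-Y - (ρ - 1) / ρ * X - (ρ - 1) / ρ ^ 2 * Z) + X) *
        (Y * (-Y - (ρ - 1) / ρ * X - (ρ - 1) / ρ ^ 2 * Z) + Y * X
          + (-Y - (ρ - 1) / ρ * X - (ρ - 1) / ρ ^ 2 * Z) * X)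
      = -((ρ - 1) / ρ) * (Y ^ 2 * Z + (ρ - 1) / ρ * X * Y * Z + (ρ - 1) / ρ ^ 2 * Y * Z ^ 2
        - (X ^ 3 + (2 - ρ) / ρ * X ^ 2 * Z + -((ρ - 1) / ρ ^ 2) * X * Z ^ 2 + 0 * Z ^ 3)) := by
    field_simp
    ring
  rw [key, mul_eq_zero, sub_eq_zero]
  simp [h0', h1']

end

/-!
The curves `E_{1/3}`, which is `y² = x³ + 1`, and `E_{-1/3}`, which is `y² = x³ + 6 x² - 3 x`, are
`2`-isogenous and have complex multiplication by orders in the Eisenstein integers. All three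
functions are therefore governed by the arithmetic of `ℤ[√-3]`, and the identity holds Euler factor
by Euler factor; the function `L(χ₋₃, s - 1) L(g, s)` serves as the common analytic continuation.

*The form `g`.* Jacobi's identity `∏ (1 - qⁿ)³ = ½ ∑ (-1)ᵏ (2k + 1) q^{k(k+1)/2}`, over `k ∈ ℤ`
(`hasSum_jacobi_cube`), which is the derivative of a finite form of the triple product at its middle
zero, turns `η(2τ)³ η(6τ)³` into the theta series `½ ∑ (A² - 3 B²) q^{A² + 3 B²}` over the pairs
with `A + B` odd (`hasSum_gCoeff`). Multiplication by elements of norm `p` in `ℤ[√-3]` gives the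
Hecke relations for its coefficients directly, without class groups or modular forms
(`thetaCoeff_three_mul`, `thetaCoeff_mul_of_mod_three_eq_two`, `thetaCoeff_mul_of_norm`), and they
sum to an Euler product (`hasProd_of_hasHeckeRelation`). The transformation law of `η` makes
`L(g, s)` entire, as a Mellin transform divided by its `Γ`-factor (`isCuspLFunction_gLFunction`).

*The primes `p > 3`.* Both curves have good reduction. The number of points of `y² = x³ + 1` is
given by the sum `∑ χ(x³ + 1)`, which vanishes for `p ≡ 2 (mod 3)` and is otherwise the trace of a
Jacobi sum, an element of norm `p` of `ℤ[√-3]` (`exists_sum_quadraticChar_cube_add_one`). The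
isogeny is replaced by a substitution in a character sum (`sum_quadraticChar_two_isogeny`). If the
trace of Frobenius is `2 A` with `p = A² + 3 B²`, then `α² + β² = 2 (A² - 3 B²)` is the Hecke
eigenvalue of `g`, while `α β = p` accounts for the factor of `L(χ₋₃, s - 1)`; if it is `0`, then
`α² = β² = -p` (`aeval_symSqPoly`).

*The primes `2` and `3`.* The factor is `1 + p X`. Over a totally ramified extension of degree
`p + 1` both curves acquire a model that reduces to the supersingular curve `y² + y = x³` for
`p = 2` and `y² = x³ - x` for `p = 3` (`isSupersingularModel_supersingularTwo`,
`isSupersingularModel_supersingularThree`). The torsion of order prime to `p` injects under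
reduction (`isRigid_of_norm`), so that the Galois action on it can be read off from the reduced
curve: inertia acts through the powers of an automorphism `J` with `J² + c J + 1 = 0`, and Frobenius
acts by some `φ` with `φ J φ⁻¹ = J⁻¹` and `φ² = -p`. As `1 - J` has cyclic kernel on the torsion,
`T_ℓ` is free of rank one over `ℤ_ℓ[J]` (`symSqDet_tateModule`). The symmetric forms invariant under
`J` are then the multiples of the norm form of `ℤ_ℓ[J]`, and `φ` multiplies them by `-p`
(`symSqDet_of_rotation`). Galois elements with the required properties come from the surjectivity of
the Galois group onto the automorphisms of the residue field
(`exists_frobenius_of_residueField`, `exists_inertia_two`, `exists_inertia_three`).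
-/

noncomputable section

/-! ### Changes of variables and points of Weierstrass curves -/

namespace WeierstrassCurve

section VariableChangePoints

variable {F : Type*} [Field F] (W : WeierstrassCurve F) (v : VariableChange F)

theorem variableChange_equation_iff (x y : F) :
    (v • W).toAffine.Equation x y ↔
      W.toAffine.Equation (v.u ^ 2 * x + v.r) (v.u ^ 3 * y + v.u ^ 2 * v.s * x + v.t) := by
  have hu : (v.u : F) ≠ 0 := v.u.ne_zero
  rw [Affine.equation_iff', Affine.equation_iff', ← mul_right_inj' (pow_ne_zero 6 hu), mul_zero]
  simp only [variableChange_def, Units.val_inv_eq_inv_val]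
  refine Eq.congr ?_ rfl
  field_simp
  ring

theorem variableChange_nonsingular_iff (x y : F) :
    (v • W).toAffine.Nonsingular x y ↔
      W.toAffine.Nonsingular (v.u ^ 2 * x + v.r) (v.u ^ 3 * y + v.u ^ 2 * v.s * x + v.t) := by
  have hu : (v.u : F) ≠ 0 := v.u.ne_zero
  rw [Affine.nonsingular_iff', Affine.nonsingular_iff', variableChange_equation_iff]
  have h1 : (v • W).a₁ * y - (3 * x ^ 2 + 2 * (v • W).a₂ * x + (v • W).a₄) =
      (v.u : F)⁻¹ ^ 4 * (W.a₁ * (v.u ^ 3 * y + v.u ^ 2 * v.s * x + v.t) -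
        (3 * (v.u ^ 2 * x + v.r) ^ 2 + 2 * W.a₂ * (v.u ^ 2 * x + v.r) + W.a₄)) +
      (v.u : F)⁻¹ ^ 4 * v.s * (2 * (v.u ^ 3 * y + v.u ^ 2 * v.s * x + v.t) +
        W.a₁ * (v.u ^ 2 * x + v.r) + W.a₃) := by
    simp only [variableChange_def, Units.val_inv_eq_inv_val]
    field_simp
    ring
  have h2 : 2 * y + (v • W).a₁ * x + (v • W).a₃ =
      (v.u : F)⁻¹ ^ 3 * (2 * (v.u ^ 3 * y + v.u ^ 2 * v.s * x + v.t) +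
        W.a₁ * (v.u ^ 2 * x + v.r) + W.a₃) := by
    simp only [variableChange_def, Units.val_inv_eq_inv_val]
    field_simp
    ring
  rw [h1, h2]
  refine and_congr_right fun _ => ?_
  generalize W.a₁ * (v.u ^ 3 * y + v.u ^ 2 * v.s * x + v.t) -
        (3 * (v.u ^ 2 * x + v.r) ^ 2 + 2 * W.a₂ * (v.u ^ 2 * x + v.r) + W.a₄) = A
  generalize 2 * (v.u ^ 3 * y + v.u ^ 2 * v.s * x + v.t) +
        W.a₁ * (v.u ^ 2 * x + v.r) + W.a₃ = B
  by_cases hB : B = 0 <;> simp [hB, hu]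

variable [DecidableEq F]

theorem variableChange_slope {x₁ x₂ y₁ y₂ : F}
    (h : ¬ (x₁ = x₂ ∧ y₁ = (v • W).toAffine.negY x₂ y₂))
    (h₁ : (v • W).toAffine.Equation x₁ y₁) (h₂ : (v • W).toAffine.Equation x₂ y₂) :
    W.toAffine.slope (v.u ^ 2 * x₁ + v.r) (v.u ^ 2 * x₂ + v.r)
      (v.u ^ 3 * y₁ + v.u ^ 2 * v.s * x₁ + v.t) (v.u ^ 3 * y₂ + v.u ^ 2 * v.s * x₂ + v.t) =
      v.u * (v • W).toAffine.slope x₁ x₂ y₁ y₂ + v.s := by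
  have hu : (v.u : F) ≠ 0 := v.u.ne_zero
  by_cases hx : x₁ = x₂
  · have hy : y₁ ≠ (v • W).toAffine.negY x₂ y₂ := fun e => h ⟨hx, e⟩
    have hyy := Affine.Y_eq_of_Y_ne h₁ h₂ hx hy
    subst hx hyy
    rw [Affine.slope_of_Y_ne rfl hy]
    have key : v.u ^ 3 * y₁ + v.u ^ 2 * v.s * x₁ + v.t - W.toAffine.negY (v.u ^ 2 * x₁ + v.r)
        (v.u ^ 3 * y₁ + v.u ^ 2 * v.s * x₁ + v.t) =
        v.u ^ 3 * (y₁ - (v • W).toAffine.negY x₁ y₁) := by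
      simp only [Affine.negY, variableChange_def, Units.val_inv_eq_inv_val]
      field_simp
      ring
    have hne : y₁ - (v • W).toAffine.negY x₁ y₁ ≠ 0 := sub_ne_zero.2 hy
    rw [Affine.slope_of_Y_ne rfl (by
      rw [← sub_ne_zero, key]; exact mul_ne_zero (pow_ne_zero 3 hu) hne), key]
    rw [div_eq_iff (mul_ne_zero (pow_ne_zero 3 hu) hne)]
    have key' : ∀ A D : F, D ≠ 0 → (v.u * (A / D) + v.s) * (v.u ^ 3 * D) =
        v.u ^ 4 * A + v.s * v.u ^ 3 * D := fun A D hD => by field_simp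
    rw [key' _ _ hne]
    simp only [Affine.negY, variableChange_def, Units.val_inv_eq_inv_val]
    field_simp
    ring
  · rw [Affine.slope_of_X_ne hx, Affine.slope_of_X_ne (by simpa [hu] using hx)]
    have := sub_ne_zero.2 hx
    have h3 : (v.u : F) ^ 2 * x₁ + v.r - (v.u ^ 2 * x₂ + v.r) = v.u ^ 2 * (x₁ - x₂) := by ring
    rw [h3]
    field_simp
    ring

/-- The group isomorphism between the points of `v • W` and those of `W` which is given by the
admissible change of variables `v`. -/
def pointOfVariableChange : (v • W).toAffine.Point →+ W.toAffine.Point where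
  toFun
    | .zero => 0
    | .some x y h => .some (v.u ^ 2 * x + v.r) (v.u ^ 3 * y + v.u ^ 2 * v.s * x + v.t)
        ((variableChange_nonsingular_iff W v x y).1 h)
  map_zero' := rfl
  map_add' := by
    have hu : (v.u : F) ≠ 0 := v.u.ne_zero
    rintro (_ | ⟨x₁, y₁, h₁⟩) (_ | ⟨x₂, y₂, h₂⟩)
    · rfl
    · rw [← Affine.Point.zero_def, zero_add]
      exact (zero_add _).symm
    · rw [← Affine.Point.zero_def, add_zero]
      exact (add_zero _).symm
    · have hY : v.u ^ 3 * y₁ + v.u ^ 2 * v.s * x₁ + v.t - W.toAffine.negY (v.u ^ 2 * x₂ + v.r)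
        (v.u ^ 3 * y₂ + v.u ^ 2 * v.s * x₂ + v.t) =
        v.u ^ 3 * (y₁ - (v • W).toAffine.negY x₂ y₂) + v.u ^ 2 * v.s * (x₁ - x₂) := by
        simp only [Affine.negY, variableChange_def, Units.val_inv_eq_inv_val]
        field_simp
        ring
      by_cases h : x₁ = x₂ ∧ y₁ = (v • W).toAffine.negY x₂ y₂
      · rw [Affine.Point.add_of_Y_eq h.1 h.2]
        refine (Affine.Point.add_of_Y_eq (by rw [h.1]) ?_).symm
        rw [← sub_eq_zero, hY, h.1, ← h.2]
        ring
      · have h' : ¬ (v.u ^ 2 * x₁ + v.r = v.u ^ 2 * x₂ + v.r ∧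
            v.u ^ 3 * y₁ + v.u ^ 2 * v.s * x₁ + v.t = W.toAffine.negY (v.u ^ 2 * x₂ + v.r)
              (v.u ^ 3 * y₂ + v.u ^ 2 * v.s * x₂ + v.t)) := by
          rintro ⟨hx, hy⟩
          have hx : x₁ = x₂ := by simpa [hu] using hx
          rw [← sub_eq_zero, hY, hx, sub_self, mul_zero, add_zero] at hy
          exact h ⟨hx, sub_eq_zero.1 (by simpa [hu] using hy)⟩
        rw [Affine.Point.add_some h]
        refine Eq.trans ?_ (Affine.Point.add_some h').symm
        simp only [Affine.Point.some.injEq, variableChange_slope W v h h₁.1 h₂.1]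
        generalize (v • W).toAffine.slope x₁ x₂ y₁ y₂ = l
        simp only [Affine.addX, Affine.addY, Affine.negAddY, Affine.negY, variableChange_def,
          Units.val_inv_eq_inv_val]
        constructor <;> field_simp <;> ring

theorem pointOfVariableChange_injective :
    Function.Injective (pointOfVariableChange W v) := by
  rw [injective_iff_map_eq_zero]
  rintro (_ | ⟨x, y, h⟩) h0
  · rfl
  · exact absurd h0 (Affine.Point.some_ne_zero _)

theorem pointOfVariableChange_surjective :
    Function.Surjective (pointOfVariableChange W v) := by
  have hu : (v.u : F) ≠ 0 := v.u.ne_zero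
  rintro (_ | ⟨x, y, h⟩)
  · exact ⟨0, rfl⟩
  · have hx : v.u ^ 2 * ((x - v.r) / v.u ^ 2) + v.r = x := by field_simp; ring
    have hy : v.u ^ 3 * ((y - v.t - v.s * (x - v.r)) / v.u ^ 3) +
      v.u ^ 2 * v.s * ((x - v.r) / v.u ^ 2) + v.t = y := by field_simp; ring
    refine ⟨.some ((x - v.r) / v.u ^ 2) ((y - v.t - v.s * (x - v.r)) / v.u ^ 3)
      ((variableChange_nonsingular_iff W v _ _).2 (by rwa [hx, hy])), ?_⟩
    exact (Affine.Point.some.injEq ..).mpr ⟨hx, hy⟩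

end VariableChangePoints

end WeierstrassCurve

/-! ### Point counts and character sums over finite fields -/

section PointCounts

variable {F : Type*} [Field F] [Fintype F] [DecidableEq F]

/-- Counting the points of `y² = x³ + a₂ x² + a₄ x + a₆` fibre by fibre over the `x`-line. -/
theorem natCard_point_eq (hF : ringChar F ≠ 2) (W : WeierstrassCurve F) (h1 : W.a₁ = 0)
    (h3 : W.a₃ = 0) (hΔ : W.Δ ≠ 0) :
    (Nat.card W.toAffine.Point : ℤ) = Fintype.card F + 1 +
      ∑ x : F, quadraticChar F (x ^ 3 + W.a₂ * x ^ 2 + W.a₄ * x + W.a₆) := by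
  have e : W.toAffine.Point ≃ Option (Σ x : F, {y : F // y ^ 2 = x ^ 3 + W.a₂ * x ^ 2 + W.a₄ * x + W.a₆}) :=
    (W.toAffine.nonsingularPointEquiv).trans <| Equiv.optionCongr
      { toFun := fun z => ⟨z.1.1, z.1.2, by
          have := (WeierstrassCurve.Affine.equation_iff ..).1 z.2.1
          simpa [h1, h3] using this⟩
        invFun := fun z => ⟨(z.1, z.2.1),
          (WeierstrassCurve.Affine.equation_iff_nonsingular_of_Δ_ne_zero hΔ).1
          ((WeierstrassCurve.Affine.equation_iff ..).2 (by simpa [h1, h3] using z.2.2))⟩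
        left_inv := fun z => rfl
        right_inv := fun z => rfl }
  rw [Nat.card_congr e, Nat.card_eq_fintype_card, Fintype.card_option, Fintype.card_sigma]
  push_cast
  have : ∀ x : F, (Fintype.card {y : F // y ^ 2 = x ^ 3 + W.a₂ * x ^ 2 + W.a₄ * x + W.a₆} : ℤ) =
      quadraticChar F (x ^ 3 + W.a₂ * x ^ 2 + W.a₄ * x + W.a₆) + 1 := fun x => by
    rw [← quadraticChar_card_sqrts hF, Set.toFinset_card]
    rfl
  simp only [this, Finset.sum_add_distrib, Finset.sum_const, Finset.card_univ, nsmul_eq_mul]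
  ring

/-- If cubing is bijective, then `∑ χ(x³ + 1) = ∑ χ(x) = 0`. -/
theorem sum_quadraticChar_cube_add_one_of_mod_three (hF : ringChar F ≠ 2)
    (h : Fintype.card F % 3 = 2) : ∑ x : F, quadraticChar F (x ^ 3 + 1) = 0 := by
  have hinj : Function.Injective (fun x : F => x ^ 3) := by
    have hco : (Nat.card Fˣ).Coprime 3 := by
      rw [Nat.card_units, Nat.card_eq_fintype_card, Nat.coprime_comm,
        Nat.prime_three.coprime_iff_not_dvd]
      omega
    intro x y hxy
    by_cases hx : x = 0
    · subst hx
      simpa [eq_comm (a := (0 : F))] using hxy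
    by_cases hy : y = 0
    · subst hy
      simpa using hxy
    have := (powCoprime hco).injective (a₁ := Units.mk0 x hx) (a₂ := Units.mk0 y hy)
      (Units.ext (by simpa using hxy))
    simpa using congrArg Units.val this
  have hbij : Function.Bijective (fun x : F => x ^ 3 + 1) :=
    (Equiv.addRight (1 : F)).bijective.comp (Finite.injective_iff_bijective.1 hinj)
  rw [Function.Bijective.sum_comp hbij (fun x => quadraticChar F x)]
  exact quadraticChar_sum_zero hF

/-- The `2`-isogeny between `y² = x (x² + a x + b)` and `y² = x (x² - 2 a x + a² - 4 b)` preserves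
the number of points: put `w = x + a + b / x` in the first sum. -/
theorem sum_quadraticChar_two_isogeny (hF : ringChar F ≠ 2) (a b : F) (hb : b ≠ 0) :
    ∑ x : F, quadraticChar F (x ^ 3 + a * x ^ 2 + b * x) =
      ∑ x : F, quadraticChar F (x ^ 3 + (-2 * a) * x ^ 2 + (a ^ 2 - 4 * b) * x) := by
  have h2 : (2 : F) ≠ 0 := Ring.two_ne_zero hF
  set χ := quadraticChar F
  have hcount : ∀ w : F, ((Finset.univ.filter fun x : F => x ≠ 0 ∧ x + a + b / x = w).card : ℤ) =
      χ ((w - a) ^ 2 - 4 * b) + 1 := by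
    intro w
    rw [← quadraticChar_card_sqrts hF]
    norm_cast
    refine Finset.card_bij (fun x _ => 2 * x - (w - a)) ?_ ?_ ?_
    · intro x hx
      simp only [Finset.mem_filter, Finset.mem_univ, true_and] at hx
      obtain ⟨hx0, rfl⟩ := hx
      simp only [Set.mem_toFinset, Set.mem_ofPred_eq]
      field_simp
      ring
    · intro x _ y _ hxy
      exact mul_left_cancel₀ h2 (by linear_combination hxy)
    · intro d hd
      simp only [Set.mem_toFinset, Set.mem_ofPred_eq] at hd
      have key : ((d + (w - a)) / 2) * ((w - a) - (d + (w - a)) / 2) = b := by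
        field_simp
        linear_combination -hd
      have hx0 : (d + (w - a)) / 2 ≠ 0 := fun h0 => hb (by rw [← key, h0, zero_mul])
      refine ⟨(d + (w - a)) / 2, ?_, by field_simp; ring⟩
      simp only [Finset.mem_filter, Finset.mem_univ, true_and]
      refine ⟨hx0, ?_⟩
      have : b / ((d + (w - a)) / 2) = (w - a) - (d + (w - a)) / 2 := by
        rw [div_eq_iff hx0, mul_comm, key]
      rw [this]
      ring
  have h0 : ∀ x : F, x ≠ 0 → χ (x ^ 3 + a * x ^ 2 + b * x) = χ (x + a + b / x) := by
    intro x hx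
    have : x ^ 3 + a * x ^ 2 + b * x = x ^ 2 * (x + a + b / x) := by field_simp
    rw [this, map_mul, quadraticChar_sq_one' hx, one_mul]
  calc ∑ x : F, χ (x ^ 3 + a * x ^ 2 + b * x)
      = ∑ x ∈ Finset.univ.filter (fun x : F => x ≠ 0), χ (x + a + b / x) := by
        rw [Finset.sum_filter]
        refine Finset.sum_congr rfl fun x _ => ?_
        split_ifs with hx
        · exact h0 x hx
        · simp only [not_not] at hx
          simp [hx, χ]
    _ = ∑ w : F, ∑ x ∈ (Finset.univ.filter (fun x : F => x ≠ 0)).filter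
          (fun x => x + a + b / x = w), χ (x + a + b / x) :=
        (Finset.sum_fiberwise _ _ _).symm
    _ = ∑ w : F, (χ ((w - a) ^ 2 - 4 * b) + 1) * χ w := by
        refine Finset.sum_congr rfl fun w _ => ?_
        rw [← hcount, Finset.filter_filter, ← nsmul_eq_mul, ← Finset.sum_const]
        refine Finset.sum_congr rfl fun x hx => ?_
        simp only [Finset.mem_filter] at hx
        rw [hx.2.2]
    _ = ∑ w : F, χ (w ^ 3 + (-2 * a) * w ^ 2 + (a ^ 2 - 4 * b) * w) := by
        simp only [add_mul, one_mul, Finset.sum_add_distrib]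
        rw [quadraticChar_sum_zero hF, add_zero]
        refine Finset.sum_congr rfl fun w _ => ?_
        rw [← map_mul]
        congr 1
        ring

/-- The number of cube roots of `t` in terms of a cubic character. -/
theorem card_cube_roots {ρ : MulChar F ℂ} (hρ : orderOf ρ = 3) (t : F) :
    ((Finset.univ.filter fun x : F => x ^ 3 = t).card : ℂ) =
      1 + ρ t + (ρ ^ 2) t := by
  by_cases ht : t = 0
  · subst ht
    have : (Finset.univ.filter fun x : F => x ^ 3 = 0) = {0} := by ext x; simp
    rw [this]
    simp [MulChar.map_zero]
  have hρ3 : ρ ^ 3 = 1 := hρ ▸ pow_orderOf_eq_one ρ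
  have hρ1 : ρ ≠ 1 := fun h => by simp [h] at hρ
  obtain ⟨g, hg⟩ := IsCyclic.exists_generator (α := Fˣ)
  have hz3 : ρ g ^ 3 = 1 := by
    rw [← MulChar.pow_apply_coe, hρ3, MulChar.one_apply_coe]
  have hz1 : ρ g ≠ 1 := by
    intro h
    apply hρ1
    ext u
    obtain ⟨k, rfl⟩ := (Submonoid.mem_powers_iff _ _).1 (mem_powers_iff_mem_zpowers.2 (hg u))
    rw [Units.val_pow_eq_pow_val, map_pow, h, one_pow, ← Units.val_pow_eq_pow_val,
      MulChar.one_apply_coe]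
  have hprim : orderOf (ρ (g : F)) = 3 := orderOf_eq_prime hz3 hz1
  obtain ⟨k, hk⟩ := (Submonoid.mem_powers_iff _ _).1
    (mem_powers_iff_mem_zpowers.2 (hg (Units.mk0 t ht)))
  have hk' : t = (g : F) ^ k := by rw [← Units.val_pow_eq_pow_val, hk]; rfl
  have hρt : ρ t = ρ g ^ k := by rw [hk', map_pow]
  rw [MulChar.pow_apply' ρ two_ne_zero]
  by_cases h3 : 3 ∣ k
  · have h1 : ρ t = 1 := by
      rw [hρt, ← orderOf_dvd_iff_pow_eq_one, hprim]; exact h3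
    -- the three cube roots of unity are powers of the generator
    have hcard : 3 ∣ orderOf g := by
      rw [← hprim]
      refine orderOf_dvd_of_pow_eq_one ?_
      rw [← map_pow, ← Units.val_pow_eq_pow_val, pow_orderOf_eq_one, Units.val_one, map_one]
    obtain ⟨m, hm⟩ := hcard
    have hm0 : m ≠ 0 := fun h => (orderOf_pos g).ne' (by rw [hm, h])
    have hω : orderOf (g ^ m) = 3 := by
      rw [orderOf_pow, hm, Nat.gcd_eq_right (Dvd.intro_left _ rfl), Nat.mul_div_cancel _ (by omega)]
    set w : F := ((g ^ m : Fˣ) : F)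
    have hw3 : w ^ 3 = 1 := by
      rw [← Units.val_pow_eq_pow_val, ← hω, pow_orderOf_eq_one, Units.val_one]
    have hw1 : w ≠ 1 := fun h => by
      have : g ^ m = 1 := Units.ext h
      rw [this, orderOf_one] at hω
      omega
    have hw : w ^ 2 + w + 1 = 0 := by
      have : (w - 1) * (w ^ 2 + w + 1) = 0 := by linear_combination hw3
      exact (mul_eq_zero.1 this).resolve_left (sub_ne_zero.2 hw1)
    obtain ⟨j, rfl⟩ := h3
    set s : F := (g : F) ^ j
    have hs : s ^ 3 = t := by rw [hk', ← pow_mul, mul_comm]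
    have hs0 : s ≠ 0 := pow_ne_zero _ g.ne_zero
    have hw0 : w ≠ 0 := Units.ne_zero _
    have : (Finset.univ.filter fun x : F => x ^ 3 = t) = {s, w * s, w ^ 2 * s} := by
      ext x
      simp only [Finset.mem_filter, Finset.mem_univ, true_and, Finset.mem_insert,
        Finset.mem_singleton]
      have hfac : x ^ 3 - t = (x - s) * ((x - w * s) * (x - w ^ 2 * s)) := by
        rw [← hs]
        linear_combination (x - s) * s * x * hw - (x - s) * s ^ 2 * hw3
      rw [← sub_eq_zero, hfac, mul_eq_zero, mul_eq_zero, sub_eq_zero, sub_eq_zero, sub_eq_zero]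
    have hne2 : w ^ 2 ≠ 1 := fun h => hw1 (by
      have : w = w ^ 3 := by rw [pow_succ, h, one_mul]
      rw [this, hw3])
    have n1 : s ≠ w * s := fun h => hw1 (mul_right_cancel₀ hs0 (by rw [one_mul]; exact h.symm))
    have n2 : s ≠ w ^ 2 * s := fun h => hne2 (mul_right_cancel₀ hs0 (by rw [one_mul]; exact h.symm))
    have n3 : w * s ≠ w ^ 2 * s := fun h => hw1 (by
      have := mul_right_cancel₀ hs0 h
      rw [sq] at this
      exact (mul_left_cancel₀ hw0 (by rw [mul_one]; exact this)).symm)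
    rw [this, Finset.card_insert_of_notMem (by simp [n1, n2]),
      Finset.card_insert_of_notMem (by simp [n3]), Finset.card_singleton, h1]
    norm_num
  · have h1 : ρ t ≠ 1 := by
      rw [hρt, ne_eq, ← orderOf_dvd_iff_pow_eq_one, hprim]; exact h3
    have ht3 : ρ t ^ 3 = 1 := by rw [hρt, ← pow_mul, mul_comm, pow_mul, hz3, one_pow]
    have hsum : 1 + ρ t + ρ t ^ 2 = 0 := by
      have : (ρ t - 1) * (1 + ρ t + ρ t ^ 2) = 0 := by linear_combination ht3
      exact (mul_eq_zero.1 this).resolve_left (sub_ne_zero.2 h1)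
    rw [hsum]
    have : (Finset.univ.filter fun x : F => x ^ 3 = t) = ∅ := by
      refine Finset.filter_eq_empty_iff.2 fun x _ hx => h1 ?_
      have hx0 : x ≠ 0 := fun h => ht (by rw [← hx, h]; ring)
      rw [← hx, map_pow, ← MulChar.pow_apply' ρ three_ne_zero, hρ3]
      exact MulChar.one_apply_coe (Units.mk0 x hx0)
    rw [this]
    simp

end PointCounts

section PointCounts

variable {F : Type*} [Field F] [Fintype F] [DecidableEq F]

/-- The ring generated by a primitive sixth root of unity is `ℤ + ℤ μ`. -/
theorem mem_adjoin_int_sixth_root {μ : ℂ} (hμ : μ ^ 2 = μ - 1) {z : ℂ}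
    (hz : z ∈ Algebra.adjoin ℤ {μ}) : ∃ a b : ℤ, z = a + b * μ := by
  induction hz using Algebra.adjoin_induction with
  | mem x hx => exact ⟨0, 1, by simp_all⟩
  | algebraMap r => exact ⟨r, 0, by simp⟩
  | add x y _ _ hx hy =>
    obtain ⟨a, b, rfl⟩ := hx
    obtain ⟨c, d, rfl⟩ := hy
    exact ⟨a + c, b + d, by push_cast; ring⟩
  | mul x y _ _ hx hy =>
    obtain ⟨a, b, rfl⟩ := hx
    obtain ⟨c, d, rfl⟩ := hy
    exact ⟨a * c - b * d, a * d + b * c + b * d, by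
      push_cast; linear_combination (b * d : ℂ) * hμ⟩

/-- If the field contains the cube roots of unity, then `∑ χ(x³ + 1) = J + J̄` for the Jacobi sum
`J = J(χ, ρ)` with a cubic character `ρ`. As `J` lies in `ℤ[ω]` and has norm `q`, and as the sum is
even, `J` lies in `ℤ[√-3]`. -/
theorem exists_sum_quadraticChar_cube_add_one (hF : ringChar F ≠ 2)
    (h : Fintype.card F % 3 = 1) :
    ∃ A B : ℤ, A ^ 2 + 3 * B ^ 2 = Fintype.card F ∧
      ∑ x : F, quadraticChar F (x ^ 3 + 1) = 2 * A := by
  obtain ⟨μ, hμ6⟩ : ∃ μ : ℂ, IsPrimitiveRoot μ 6 :=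
    ⟨_, Complex.isPrimitiveRoot_exp 6 (by norm_num)⟩
  have hζ : IsPrimitiveRoot (μ ^ 2) 3 := hμ6.pow (by norm_num) (by norm_num)
  have hμ3 : μ ^ 3 = -1 := (hμ6.pow (by norm_num) (show 6 = 3 * 2 by norm_num)).eq_neg_one_of_two_right
  have hμ : μ ^ 2 = μ - 1 := by
    have hne : μ + 1 ≠ 0 := fun h0 => by
      have : μ ^ 2 = 1 := by rw [eq_neg_of_add_eq_zero_left h0]; ring
      exact hμ6.pow_ne_one_of_pos_of_lt (by norm_num) (by norm_num) this
    have : (μ + 1) * (μ ^ 2 - μ + 1) = 0 := by linear_combination hμ3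
    linear_combination (mul_eq_zero.1 this).resolve_left hne
  obtain ⟨ρ, hρ⟩ := MulChar.exists_mulChar_orderOf F (n := 3) (by omega) hζ
  have hρ3 : ρ ^ 3 = 1 := hρ ▸ pow_orderOf_eq_one ρ
  set χ : MulChar F ℂ := (quadraticChar F).ringHomComp (Int.castRingHom ℂ) with hχdef
  have hχq : ∀ x, χ x = (quadraticChar F x : ℂ) := fun x => rfl
  have hχ2 : χ ^ 2 = 1 := by
    exact ((quadraticChar_isQuadratic F).comp (Int.castRingHom ℂ)).sq_eq_one
  have hχ1 : χ ≠ 1 := (MulChar.ringHomComp_ne_one_iff (Int.castRingHom ℂ).injective_int).2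
    (quadraticChar_ne_one hF)
  have hρ1 : ρ ≠ 1 := fun h => by simp [h] at hρ
  have hχinv : χ⁻¹ = χ := inv_eq_of_mul_eq_one_left (by rw [← sq, hχ2])
  have hρinv : ρ⁻¹ = ρ ^ 2 := inv_eq_of_mul_eq_one_left (by rw [← pow_succ, hρ3])
  have hρneg : ρ (-1) = 1 := by
    have : ρ (-1) = (ρ ^ 3) (-1) := by
      rw [MulChar.pow_apply' ρ three_ne_zero, ← map_pow]
      norm_num
    rw [this, hρ3]
    exact MulChar.one_apply_coe (-1)
  -- the sum as a sum of two conjugate Jacobi sums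
  have hsum : ((∑ x : F, quadraticChar F (x ^ 3 + 1) : ℤ) : ℂ) =
      jacobiSum χ ρ + jacobiSum χ (ρ ^ 2) := by
    have hneg : ∀ σ : MulChar F ℂ, σ (-1) = 1 → ∑ t : F, χ (t + 1) * σ t = jacobiSum χ σ := by
      intro σ hσ
      rw [jacobiSum_comm, jacobiSum, ← Equiv.sum_comp (Equiv.neg F)]
      refine Finset.sum_congr rfl fun t _ => ?_
      rw [Equiv.neg_apply, ← neg_one_mul t, map_mul, hσ, one_mul, mul_comm]
      congr 2
      ring
    have hzero : ∑ t : F, χ (t + 1) = 0 := by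
      refine (Equiv.sum_comp (Equiv.addRight (1 : F)) (fun t => χ t)).trans ?_
      exact MulChar.sum_eq_zero_of_ne_one hχ1
    calc ((∑ x : F, quadraticChar F (x ^ 3 + 1) : ℤ) : ℂ)
        = ∑ t : F, ∑ x ∈ Finset.univ.filter (fun x : F => x ^ 3 = t), χ (x ^ 3 + 1) := by
          rw [Finset.sum_fiberwise]
          push_cast
          rfl
      _ = ∑ t : F, (1 + ρ t + (ρ ^ 2) t) * χ (t + 1) := by
          refine Finset.sum_congr rfl fun t _ => ?_
          rw [← card_cube_roots hρ, ← nsmul_eq_mul, ← Finset.sum_const]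
          refine Finset.sum_congr rfl fun x hx => ?_
          rw [(Finset.mem_filter.1 hx).2]
      _ = _ := by
          rw [← hneg ρ hρneg, ← hneg (ρ ^ 2) (by rw [MulChar.pow_apply' ρ two_ne_zero, hρneg,
            one_pow])]
          simp only [add_mul, one_mul, Finset.sum_add_distrib, hzero, zero_add,
            mul_comm (χ _)]
  -- modulo `2` only the three zeros of `x³ + 1` matter
  have hpar : (2 : ℤ) ∣ ∑ x : F, quadraticChar F (x ^ 3 + 1) := by
    have h3 : (Finset.univ.filter fun x : F => x ^ 3 = -1).card = 3 := by
      have := card_cube_roots hρ (-1)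
      rw [MulChar.pow_apply' ρ two_ne_zero, hρneg] at this
      norm_num at this
      exact_mod_cast this
    have hsq : ∀ y : F, quadraticChar F y ^ 2 = 1 - if y = 0 then 1 else 0 := fun y => by
      split_ifs with hy
      · simp [hy]
      · rw [quadraticChar_sq_one hy, sub_zero]
    have h1 : (2 : ℤ) ∣ ∑ x : F, (quadraticChar F (x ^ 3 + 1) - quadraticChar F (x ^ 3 + 1) ^ 2) :=
      Finset.dvd_sum fun x _ => by
        have := (Int.even_mul_pred_self (quadraticChar F (x ^ 3 + 1))).two_dvd
        rw [← dvd_neg]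
        convert this using 1
        ring
    have h2 : ∑ x : F, quadraticChar F (x ^ 3 + 1) ^ 2 = Fintype.card F - 3 := by
      simp only [hsq, Finset.sum_sub_distrib, Finset.sum_const, Finset.card_univ, nsmul_eq_mul,
        mul_one, Finset.sum_boole, add_eq_zero_iff_eq_neg, h3]
      norm_num
    rw [Finset.sum_sub_distrib, h2] at h1
    have hodd := FiniteField.odd_card_of_char_ne_two hF
    omega
  have hJ1 : jacobiSum χ ρ ∈ Algebra.adjoin ℤ {μ} :=
    jacobiSum_mem_algebraAdjoin_of_pow_eq_one (n := 6)
      (by rw [show 6 = 2 * 3 by norm_num, pow_mul, hχ2, one_pow])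
      (by rw [show 6 = 3 * 2 by norm_num, pow_mul, hρ3, one_pow]) hμ6
  obtain ⟨a, b, hab⟩ := mem_adjoin_int_sixth_root hμ hJ1
  have hstar : ∀ σ : MulChar F ℂ, σ.ringHomComp (starRingEnd ℂ) = σ⁻¹ :=
    fun σ => MulChar.star_eq_inv σ
  have hconj : jacobiSum χ (ρ ^ 2) = starRingEnd ℂ (jacobiSum χ ρ) := by
    rw [← jacobiSum_ringHomComp, hstar, hstar, hχinv, hρinv]
  have hχρ : χ * ρ ≠ 1 := fun h => by
    have : χ = ρ⁻¹ := eq_inv_of_mul_eq_one_left h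
    apply hχ1
    calc χ = χ ^ 3 := by rw [pow_succ, hχ2, one_mul]
      _ = 1 := by rw [this, inv_pow, hρ3, inv_one]
  have hchar : ringChar ℂ ≠ ringChar F := by
    rw [ringChar.eq_zero]
    intro h0
    exact CharP.ringChar_ne_zero_of_finite F h0.symm
  have hnorm : jacobiSum χ ρ * jacobiSum χ (ρ ^ 2) = Fintype.card F := by
    have := jacobiSum_mul_jacobiSum_inv (F := F) (F' := ℂ) (χ := χ) (φ := ρ) hchar hχ1 hρ1 hχρ
    rwa [hχinv, hρinv] at this
  have hμc : starRingEnd ℂ μ = 1 - μ := by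
    have hμ0 : μ ≠ 0 := fun h0 => by rw [h0] at hμ; norm_num at hμ
    have hn : ‖μ‖ = 1 := hμ6.norm'_eq_one (by norm_num)
    have h1 : starRingEnd ℂ μ * μ = 1 := by
      rw [mul_comm, Complex.mul_conj, Complex.normSq_eq_norm_sq, hn]
      norm_num
    refine mul_right_cancel₀ hμ0 (h1.trans ?_)
    linear_combination hμ
  rw [hconj, hab, map_add, map_mul, hμc] at hsum hnorm
  simp only [map_intCast] at hsum hnorm
  have e1 : ∑ x : F, quadraticChar F (x ^ 3 + 1) = 2 * a + b := by
    have : ((∑ x : F, quadraticChar F (x ^ 3 + 1) : ℤ) : ℂ) = ((2 * a + b : ℤ) : ℂ) := by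
      rw [hsum]; push_cast; ring
    exact_mod_cast this
  have e2 : a ^ 2 + a * b + b ^ 2 = Fintype.card F := by
    have : ((a ^ 2 + a * b + b ^ 2 : ℤ) : ℂ) = ((Fintype.card F : ℤ) : ℂ) := by
      push_cast
      rw [← hnorm]
      linear_combination (b ^ 2 : ℂ) * hμ
    exact_mod_cast this
  obtain ⟨b', rfl⟩ : (2 : ℤ) ∣ b := by
    rw [e1] at hpar
    omega
  exact ⟨a + b', b', by rw [← e2]; ring, by rw [e1]; ring⟩

end PointCounts

/-! ### Good reduction and minimal equations -/

section GoodReduction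

open WeierstrassCurve IsLocalRing

/-- Two Weierstrass equations over an integrally closed domain `R` in which `3` is invertible which
differ by a change of variables over the fraction field with a unit `u` differ by a change of
variables over `R`. -/
theorem exists_variableChange_of_isUnit {R K : Type*} [CommRing R] [IsDomain R]
    [IsIntegrallyClosed R] [Field K] [Algebra R K] [IsFractionRing R K] (h3 : IsUnit (3 : R))
    (W M : WeierstrassCurve R) (v : VariableChange K) (hv : v • W⁄K = M⁄K)
    (u : Rˣ) (hu : algebraMap R K u = v.u) : ∃ v₀ : VariableChange R, v₀ • W = M := by
  have hinj : Function.Injective (algebraMap R K) := IsFractionRing.injective R K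
  obtain ⟨w, hw⟩ := h3.exists_right_inv
  have hK : (3 : K) * algebraMap R K w = 1 := by
    rw [← map_ofNat (algebraMap R K) 3, ← map_mul, hw, map_one]
  have hu0 : (v.u : K) ≠ 0 := v.u.ne_zero
  have e8 := congrArg WeierstrassCurve.b₈ hv
  have e2 := congrArg WeierstrassCurve.a₂ hv
  have e6 := congrArg WeierstrassCurve.a₆ hv
  rw [variableChange_b₈] at e8
  rw [variableChange_a₂] at e2
  rw [variableChange_a₆] at e6
  simp only [Units.val_inv_eq_inv_val, inv_pow, ← hu] at e8 e2 e6
  rw [← hu] at hu0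
  rw [inv_mul_eq_iff_eq_mul₀ (pow_ne_zero _ hu0)] at e8 e2 e6
  simp only [baseChange, map_a₁, map_a₂, map_a₃, map_a₄, map_a₆, map_b₂, map_b₄, map_b₆,
    map_b₈] at e8 e2 e6
  -- the transformation laws of `b₈`, `a₂`, `a₆` are integral equations for `r`, `s`, `t`
  obtain ⟨r, hr⟩ : ∃ r : R, algebraMap R K r = v.r := by
    refine IsIntegrallyClosed.isIntegral_iff.1 ⟨X ^ 4 + C (w * W.b₂) * X ^ 3 + C (W.b₄) * X ^ 2 +
      C W.b₆ * X + C (w * (W.b₈ - u ^ 8 * M.b₈)), by monicity!, ?_⟩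
    simp only [eval₂_add, eval₂_mul, eval₂_pow, eval₂_X, eval₂_C, eval₂_sub,
      map_mul, map_sub, map_pow]
    linear_combination (algebraMap R K w) * e8 - (v.r ^ 4 + algebraMap R K W.b₄ * v.r ^ 2 +
      algebraMap R K W.b₆ * v.r) * hK
  obtain ⟨s, hs⟩ : ∃ s : R, algebraMap R K s = v.s := by
    refine IsIntegrallyClosed.isIntegral_iff.1 ⟨X ^ 2 + C W.a₁ * X +
      C (u ^ 2 * M.a₂ - W.a₂ - 3 * r), by monicity!, ?_⟩
    simp only [eval₂_add, eval₂_mul, eval₂_pow, eval₂_X, eval₂_C, eval₂_sub,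
      eval₂_ofNat, map_mul, map_sub, map_pow, hr,
      map_ofNat]
    linear_combination -e2
  obtain ⟨t, ht⟩ : ∃ t : R, algebraMap R K t = v.t := by
    refine IsIntegrallyClosed.isIntegral_iff.1 ⟨X ^ 2 + C (W.a₃ + r * W.a₁) * X +
      C (u ^ 6 * M.a₆ - W.a₆ - r * W.a₄ - r ^ 2 * W.a₂ - r ^ 3), by monicity!, ?_⟩
    simp only [eval₂_add, eval₂_mul, eval₂_pow, eval₂_X, eval₂_C, eval₂_sub,
      map_mul, map_sub, map_pow, hr, map_add]
    linear_combination -e6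
  refine ⟨⟨u, r, s, t⟩, WeierstrassCurve.map_injective hinj ?_⟩
  refine (map_variableChange ..).symm.trans (Eq.trans ?_ hv)
  congr 1
  ext
  · exact hu
  · exact hr
  · exact hs
  · exact ht

variable (p : ℕ) [Fact p.Prime]

theorem exists_minimal_eq (W : WeierstrassCurve ℚ_[p]) :
    ∃ v : VariableChange ℚ_[p], W.minimal ℤ_[p] = v • W := ⟨_, rfl⟩

/-- The discriminant of an integral model of a minimal equation with good reduction is a unit. -/
theorem isUnit_integralModel_Δ {W : WeierstrassCurve ℚ_[p]} [IsMinimal ℤ_[p] W]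
    (h : W.HasGoodReduction ℤ_[p]) : IsUnit (W.integralModel ℤ_[p]).Δ := by
  rw [hasGoodReduction_iff_isElliptic_reduction] at h
  have := h.isUnit
  rw [reduction, map_Δ] at this
  exact isUnit_of_map_unit (residue ℤ_[p]) _ this

/-- An integral equation with unit discriminant already has the largest possible value `1` of the
norm of the discriminant, so that a minimal equation has unit discriminant as well. -/
theorem minimal_hasGoodReduction {W : WeierstrassCurve ℤ_[p]} (hW : IsUnit W.Δ) :
    ((W⁄ℚ_[p]).minimal ℤ_[p]).HasGoodReduction ℤ_[p] := by
  obtain ⟨v, hv⟩ := exists_minimal_eq p (W⁄ℚ_[p])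
  have hint : IsIntegral ℤ_[p] (W⁄ℚ_[p]) := ⟨W, rfl⟩
  have hmin : IsMinimal ℤ_[p] (v • W⁄ℚ_[p]) := hv ▸ inferInstance
  have hv1 : v⁻¹ • v • (W⁄ℚ_[p]) = W⁄ℚ_[p] := inv_smul_smul _ _
  have h := (hmin.val_Δ_maximal).2 (j := v⁻¹) (by simpa only [hv1] using hint)
  simp only [hv1, one_smul] at h
  have h1 : (valuation_Δ_aux ℤ_[p] (W⁄ℚ_[p]) : WithZero (Multiplicative ℤ)) = 1 := by
    rw [valuation_Δ_aux_eq_of_isIntegral, baseChange, map_Δ]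
    exact IsDedekindDomain.HeightOneSpectrum.valuation_eq_one_iff_notMem _ |>.2
      fun h => (mem_maximalIdeal _).1 h hW
  have h2 : (valuation_Δ_aux ℤ_[p] (v • W⁄ℚ_[p]) : WithZero (Multiplicative ℤ)) = 1 := by
    refine le_antisymm (valuation_Δ_aux ℤ_[p] (v • W⁄ℚ_[p])).2 (h1.symm.le.trans ?_)
    exact h (Subtype.coe_le_coe.1
      ((valuation_Δ_aux ℤ_[p] (v • W⁄ℚ_[p])).2.trans h1.symm.le))
  rw [hv]
  refine ⟨?_⟩
  rw [← h2, valuation_Δ_aux_eq_of_isIntegral]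

/-- The reduction of a minimal equation has as many points as the reduction of any integral
equation with unit discriminant. -/
theorem natCard_reduction_point (hp : 3 < p) {W : WeierstrassCurve ℤ_[p]} (hW : IsUnit W.Δ) :
    Nat.card (((W⁄ℚ_[p]).minimal ℤ_[p]).reduction ℤ_[p]).toAffine.Point =
      Nat.card (W.map (residue ℤ_[p])).toAffine.Point := by
  obtain ⟨v, hv⟩ := exists_minimal_eq p (W⁄ℚ_[p])
  set M := ((W⁄ℚ_[p]).minimal ℤ_[p]).integralModel ℤ_[p] with hM
  have hMeq : M⁄ℚ_[p] = v • W⁄ℚ_[p] := by rw [hM, baseChange_integralModel_eq, hv]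
  have hMΔ : IsUnit M.Δ := isUnit_integralModel_Δ p (minimal_hasGoodReduction p hW)
  have hnorm : ‖(v.u : ℚ_[p])‖ = 1 := by
    have := congrArg WeierstrassCurve.Δ hMeq
    rw [variableChange_Δ] at this
    simp only [baseChange, map_Δ] at this
    have := congrArg norm this
    rw [norm_mul, Units.val_inv_eq_inv_val, norm_pow, norm_inv, PadicInt.algebraMap_apply,
      PadicInt.algebraMap_apply, ← PadicInt.norm_def, ← PadicInt.norm_def,
      PadicInt.isUnit_iff.1 hW, PadicInt.isUnit_iff.1 hMΔ, mul_one, inv_pow, eq_comm,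
      inv_eq_one] at this
    exact (pow_eq_one_iff_of_nonneg (norm_nonneg _) (by norm_num)).1 this
  have h3 : IsUnit (3 : ℤ_[p]) := by
    have : IsUnit ((3 : ℕ) : ℤ_[p]) := by
      rw [PadicInt.isUnit_iff, PadicInt.norm_def, PadicInt.coe_natCast,
        Padic.norm_natCast_eq_one_iff]
      exact (Nat.coprime_primes Fact.out Nat.prime_three).2 hp.ne'
    exact_mod_cast this
  have hu : IsUnit (show ℤ_[p] from ⟨v.u, hnorm.le⟩) := PadicInt.isUnit_iff.2 hnorm
  obtain ⟨v₀, hv₀⟩ := exists_variableChange_of_isUnit h3 W M v hMeq.symm hu.unit rfl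
  have hred : ((W⁄ℚ_[p]).minimal ℤ_[p]).reduction ℤ_[p] =
      v₀.map (residue ℤ_[p]) • W.map (residue ℤ_[p]) := by
    rw [map_variableChange, hv₀]
    rfl
  rw [hred]
  classical
  exact Nat.card_congr (Equiv.ofBijective _ ⟨pointOfVariableChange_injective _ _,
    pointOfVariableChange_surjective _ _⟩)

/-- A change of variables multiplies the discriminant by a `12`-th power, so that there is no good
reduction if the valuation of the discriminant is not divisible by `12`. -/
theorem not_minimal_hasGoodReduction {W : WeierstrassCurve ℚ_[p]} {n : ℤ} (hn : ¬ (12 : ℤ) ∣ n)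
    (hW : ‖W.Δ‖ = (p : ℝ) ^ n) : ¬ (W.minimal ℤ_[p]).HasGoodReduction ℤ_[p] := by
  intro hg
  obtain ⟨v, hv⟩ := exists_minimal_eq p W
  have h1 : ‖(W.minimal ℤ_[p]).Δ‖ = 1 := by
    rw [← integralModel_Δ_eq ℤ_[p], PadicInt.algebraMap_apply, ← PadicInt.norm_def]
    exact PadicInt.isUnit_iff.1 (isUnit_integralModel_Δ p hg)
  have hp1 : (1 : ℝ) < p := by exact_mod_cast (Fact.out : p.Prime).one_lt
  rw [hv, variableChange_Δ, norm_mul, norm_pow, hW, Padic.norm_eq_zpow_neg_valuation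
    (Units.ne_zero _), ← zpow_natCast, ← zpow_mul, ← zpow_add₀ (by positivity),
    zpow_eq_one_iff_right₀ (by positivity) hp1.ne'] at h1
  exact hn ⟨_, by push_cast at h1; linarith⟩

end GoodReduction

/-! ### The curves `E_{1/3}` and `E_{-1/3}` at primes greater than `3` -/

section CurvesGood

open WeierstrassCurve IsLocalRing

theorem natCard_point_variableChange {F : Type*} [Field F] (W : WeierstrassCurve F)
    (v : VariableChange F) :
    Nat.card (v • W).toAffine.Point = Nat.card W.toAffine.Point := by
  classical
  exact Nat.card_congr (Equiv.ofBijective _ ⟨pointOfVariableChange_injective W v,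
    pointOfVariableChange_surjective W v⟩)

/-- The equation of `E_{1/3}`, over any ring. -/
def curveOneThird (R : Type*) [CommRing R] : WeierstrassCurve R := ⟨-2, 5, -6, 6, 0⟩

/-- The equation of `E_{-1/3}`, over any ring. -/
def curveNegOneThird (R : Type*) [CommRing R] : WeierstrassCurve R := ⟨4, -7, -12, 12, 0⟩

theorem curveOneThird_map {R S : Type*} [CommRing R] [CommRing S] (f : R →+* S) :
    (curveOneThird R).map f = curveOneThird S := by
  ext <;> simp [curveOneThird, map_ofNat]

theorem curveNegOneThird_map {R S : Type*} [CommRing R] [CommRing S] (f : R →+* S) :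
    (curveNegOneThird R).map f = curveNegOneThird S := by
  ext <;> simp [curveNegOneThird, map_ofNat]

theorem curveE_one_third : curveE (1 / 3) = curveOneThird ℚ := by
  ext <;> norm_num [curveE, curveOneThird]

theorem curveE_neg_one_third : curveE (-1 / 3) = curveNegOneThird ℚ := by
  ext <;> norm_num [curveE, curveNegOneThird]

theorem curveOneThird_Δ (R : Type*) [CommRing R] : (curveOneThird R).Δ = -432 := by
  simp only [WeierstrassCurve.Δ, b₂, b₄, b₆, b₈, curveOneThird]
  norm_num

theorem curveNegOneThird_Δ (R : Type*) [CommRing R] : (curveNegOneThird R).Δ = 6912 := by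
  simp only [WeierstrassCurve.Δ, b₂, b₄, b₆, b₈, curveNegOneThird]
  norm_num

/-- The change of variables `x ↦ x - 2`, `y ↦ y + x + 1` turns `E_{1/3}` into `y² = x³ + 1`. -/
theorem variableChange_curveOneThird (R : Type*) [CommRing R] :
    (⟨1, -2, 1, 1⟩ : VariableChange R) • curveOneThird R = ⟨0, 0, 0, 0, 1⟩ := by
  ext <;> simp [variableChange_def, curveOneThird] <;> norm_num

/-- The change of variables `x ↦ x + 3`, `y ↦ y - 2 x` turns `E_{-1/3}` into
`y² = x³ + 6 x² - 3 x`. -/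
theorem variableChange_curveNegOneThird (R : Type*) [CommRing R] :
    (⟨1, 3, -2, 0⟩ : VariableChange R) • curveNegOneThird R = ⟨0, 6, 0, -3, 0⟩ := by
  ext <;> simp [variableChange_def, curveNegOneThird] <;> norm_num

section FiniteField

variable {F : Type*} [Field F] [Fintype F] [DecidableEq F]

theorem natCard_curveOneThird (hF : ringChar F ≠ 2) (h6 : (6 : F) ≠ 0) :
    (Nat.card (curveOneThird F).toAffine.Point : ℤ) = Fintype.card F + 1 +
      ∑ x : F, quadraticChar F (x ^ 3 + 1) := by
  have hΔ : ((⟨1, -2, 1, 1⟩ : VariableChange F) • curveOneThird F).Δ ≠ 0 := by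
    rw [variableChange_Δ, curveOneThird_Δ]
    have : (-432 : F) = -((6 : F) ^ 3 * 2) := by norm_num
    have h2 : (2 : F) ≠ 0 := Ring.two_ne_zero hF
    simpa [this] using ⟨h6, h2⟩
  rw [← natCard_point_variableChange _ ⟨1, -2, 1, 1⟩,
    natCard_point_eq hF _ (by rw [variableChange_curveOneThird])
      (by rw [variableChange_curveOneThird]) hΔ, variableChange_curveOneThird]
  simp

/-- By the `2`-isogeny, `E_{-1/3}` has as many points as `y² = x³ - 3 x² + 3 x`, which is the curve
`y² = (x - 1)³ + 1`. -/
theorem natCard_curveNegOneThird (hF : ringChar F ≠ 2) (h6 : (6 : F) ≠ 0) :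
    (Nat.card (curveNegOneThird F).toAffine.Point : ℤ) = Fintype.card F + 1 +
      ∑ x : F, quadraticChar F (x ^ 3 + 1) := by
  have h3 : (3 : F) ≠ 0 := fun h => h6 (by linear_combination 2 * h)
  have hΔ : ((⟨1, 3, -2, 0⟩ : VariableChange F) • curveNegOneThird F).Δ ≠ 0 := by
    rw [variableChange_Δ, curveNegOneThird_Δ]
    have : (6912 : F) = (6 : F) ^ 3 * 2 ^ 5 := by norm_num
    have h2 : (2 : F) ≠ 0 := Ring.two_ne_zero hF
    simpa [this] using ⟨h6, h2⟩
  rw [← natCard_point_variableChange _ ⟨1, 3, -2, 0⟩,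
    natCard_point_eq hF _ (by rw [variableChange_curveNegOneThird])
      (by rw [variableChange_curveNegOneThird]) hΔ, variableChange_curveNegOneThird]
  rw [← Equiv.sum_comp (Equiv.subRight (1 : F)) (fun x => quadraticChar F (x ^ 3 + 1))]
  have := sum_quadraticChar_two_isogeny hF (-3) 3 h3
  congr 1
  refine Eq.trans (Finset.sum_congr rfl fun x _ => congrArg _ ?_)
    (this.symm.trans (Finset.sum_congr rfl fun x _ => congrArg _ ?_))
  · norm_num
  · simp only [Equiv.subRight_apply]
    ring

end FiniteField

variable (p : ℕ) [Fact p.Prime]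

instance : Finite (ResidueField ℤ_[p]) := Finite.of_equiv _ PadicInt.residueField.symm.toEquiv

theorem natCard_residueField : Nat.card (ResidueField ℤ_[p]) = p := by
  rw [Nat.card_congr PadicInt.residueField.toEquiv, Nat.card_zmod]

theorem ringChar_residueField : ringChar (ResidueField ℤ_[p]) = p :=
  ringChar.eq_iff.2
    (((PadicInt.residueField (p := p)).symm.toRingHom.charP_iff_charP p).1 inferInstance)

variable {p}

theorem six_unit (hp : 3 < p) : ‖(6 : ℚ_[p])‖ = 1 := by
  have hpp : p.Prime := Fact.out
  have : ((6 : ℕ) : ℚ_[p]) = 6 := by norm_num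
  rw [← this, Padic.norm_natCast_eq_one_iff, show 6 = 2 * 3 by norm_num]
  exact Nat.Coprime.mul_right ((Nat.coprime_primes hpp Nat.prime_two).2 (by omega))
    ((Nat.coprime_primes hpp Nat.prime_three).2 (by omega))

theorem isUnit_curve_Δ (hp : 3 < p) :
    IsUnit (curveOneThird ℤ_[p]).Δ ∧ IsUnit (curveNegOneThird ℤ_[p]).Δ := by
  have h6 : IsUnit (6 : ℤ_[p]) := PadicInt.isUnit_iff.2 (by
    rw [PadicInt.norm_def]; exact_mod_cast six_unit hp)
  have h2 : IsUnit (2 : ℤ_[p]) := isUnit_of_mul_isUnit_left (y := 3) (by norm_num; exact h6)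
  rw [curveOneThird_Δ, curveNegOneThird_Δ]
  refine ⟨?_, ?_⟩
  · have : (-432 : ℤ_[p]) = -((6 : ℤ_[p]) ^ 3 * 2) := by norm_num
    rw [this]
    exact ((h6.pow 3).mul h2).neg
  · have : (6912 : ℤ_[p]) = (6 : ℤ_[p]) ^ 3 * 2 ^ 5 := by norm_num
    rw [this]
    exact (h6.pow 3).mul (h2.pow 5)

theorem baseChange_curveE :
    (curveE (1 / 3)).baseChange ℚ_[p] = (curveOneThird ℤ_[p])⁄ℚ_[p] ∧
    (curveE (-1 / 3)).baseChange ℚ_[p] = (curveNegOneThird ℤ_[p])⁄ℚ_[p] := by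
  rw [curveE_one_third, curveE_neg_one_third]
  simp only [baseChange, curveOneThird_map, curveNegOneThird_map, and_self]

theorem hasGoodReduction_curveE (hp : 3 < p) :
    (localMinimal (curveE (1 / 3)) p).HasGoodReduction ℤ_[p] ∧
    (localMinimal (curveE (-1 / 3)) p).HasGoodReduction ℤ_[p] := by
  simp only [localMinimal]
  rw [baseChange_curveE.1, baseChange_curveE.2]
  exact ⟨minimal_hasGoodReduction p (isUnit_curve_Δ hp).1,
    minimal_hasGoodReduction p (isUnit_curve_Δ hp).2⟩

/-- The trace of Frobenius of both curves at `p > 3`: it is `0` if `p ≡ 2 (mod 3)`, and `± 2 A` with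
`p = A² + 3 B²` if `p ≡ 1 (mod 3)`. -/
theorem frobeniusTrace_curveE (hp : 3 < p) :
    ∃ t : ℤ, frobeniusTrace (curveE (1 / 3)) p = t ∧ frobeniusTrace (curveE (-1 / 3)) p = t ∧
      (p % 3 = 2 → t = 0) ∧
      (p % 3 = 1 → ∃ A B : ℤ, A ^ 2 + 3 * B ^ 2 = p ∧ t = 2 * A) := by
  classical
  have := Fintype.ofFinite (ResidueField ℤ_[p])
  have hchar : ringChar (ResidueField ℤ_[p]) ≠ 2 := by
    rw [ringChar_residueField]; omega
  have hcard : Fintype.card (ResidueField ℤ_[p]) = p := by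
    rw [← Nat.card_eq_fintype_card, natCard_residueField]
  have h6 : (6 : ResidueField ℤ_[p]) ≠ 0 := by
    rw [← map_ofNat (residue ℤ_[p]) 6]
    exact ((PadicInt.isUnit_iff.2 (by
      rw [PadicInt.norm_def]; exact_mod_cast six_unit hp) : IsUnit (6 : ℤ_[p])).map _).ne_zero
  refine ⟨-∑ x : ResidueField ℤ_[p], quadraticChar _ (x ^ 3 + 1), ?_, ?_, ?_, ?_⟩
  · simp only [frobeniusTrace, localMinimal]
    rw [show Nat.card _ = _ from by
      simp only [baseChange_curveE.1]
      exact natCard_reduction_point p hp (isUnit_curve_Δ hp).1, curveOneThird_map,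
      natCard_curveOneThird hchar h6, hcard]
    ring
  · simp only [frobeniusTrace, localMinimal]
    rw [show Nat.card _ = _ from by
      simp only [baseChange_curveE.2]
      exact natCard_reduction_point p hp (isUnit_curve_Δ hp).2, curveNegOneThird_map,
      natCard_curveNegOneThird hchar h6, hcard]
    ring
  · intro h
    rw [sum_quadraticChar_cube_add_one_of_mod_three hchar (by rw [hcard, h]), neg_zero]
  · intro h
    obtain ⟨A, B, hAB, hS⟩ := exists_sum_quadraticChar_cube_add_one hchar (by rw [hcard, h])
    exact ⟨-A, B, by rw [← hcard, ← hAB]; ring, by rw [hS]; ring⟩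

theorem not_hasGoodReduction_curveE (hp : p = 2 ∨ p = 3) :
    ¬ (localMinimal (curveE (1 / 3)) p).HasGoodReduction ℤ_[p] ∧
    ¬ (localMinimal (curveE (-1 / 3)) p).HasGoodReduction ℤ_[p] := by
  have h23 : ∀ (q : ℕ) [Fact q.Prime] (n m : ℕ), ¬ q ∣ m → ‖((q ^ n * m : ℕ) : ℚ_[q])‖ =
      (q : ℝ) ^ (-n : ℤ) := by
    intro q _ n m hm
    rw [Nat.cast_mul, norm_mul, Nat.cast_pow, Padic.norm_p_pow,
      Padic.norm_natCast_eq_one_iff.2 (((Fact.out : q.Prime).coprime_iff_not_dvd).2 hm), mul_one]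
  simp only [localMinimal]
  rw [baseChange_curveE.1, baseChange_curveE.2]
  simp only [baseChange, curveOneThird_map, curveNegOneThird_map]
  rcases hp with rfl | rfl
  · refine ⟨not_minimal_hasGoodReduction 2 (n := -4) (by norm_num) ?_,
      not_minimal_hasGoodReduction 2 (n := -8) (by norm_num) ?_⟩
    · rw [curveOneThird_Δ, norm_neg]
      simpa using h23 2 4 27 (by norm_num)
    · rw [curveNegOneThird_Δ]
      simpa using h23 2 8 27 (by norm_num)
  · refine ⟨not_minimal_hasGoodReduction 3 (n := -3) (by norm_num) ?_,
      not_minimal_hasGoodReduction 3 (n := -3) (by norm_num) ?_⟩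
    · rw [curveOneThird_Δ, norm_neg]
      simpa using h23 3 3 16 (by norm_num)
    · rw [curveNegOneThird_Δ]
      simpa using h23 3 3 256 (by norm_num)

end CurvesGood

/-! ### The finite form of Jacobi's triple product -/

section JacobiIdentity

open Finset Filter Topology

/-- The `q`-Pochhammer symbol `(q; q)_m = (1 - q) (1 - q²) ⋯ (1 - q^m)`. -/
def qPoch (q : ℂ) (m : ℕ) : ℂ := ∏ i ∈ range m, (1 - q ^ (i + 1))

/-- The Gaussian binomial coefficient `(q; q)_{i + j} / ((q; q)_i (q; q)_j)`. -/
def qBinom (q : ℂ) (i j : ℕ) : ℂ := qPoch q (i + j) / (qPoch q i * qPoch q j)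

variable {q : ℂ}

theorem one_sub_pow_ne_zero (hq : ‖q‖ < 1) (i : ℕ) : 1 - q ^ (i + 1) ≠ 0 := by
  intro h
  have : ‖q ^ (i + 1)‖ = 1 := by rw [← sub_eq_zero.1 h, norm_one]
  rw [norm_pow] at this
  exact (pow_lt_one₀ (norm_nonneg _) hq (by omega)).ne this

theorem qPoch_ne_zero (hq : ‖q‖ < 1) (m : ℕ) : qPoch q m ≠ 0 :=
  prod_ne_zero_iff.2 fun i _ => one_sub_pow_ne_zero hq i

theorem qPoch_succ (m : ℕ) : qPoch q (m + 1) = qPoch q m * (1 - q ^ (m + 1)) :=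
  prod_range_succ _ _

/-- The `q`-binomial theorem. -/
theorem prod_one_sub_mul_pow (hq : ‖q‖ < 1) (z : ℂ) (N : ℕ) :
    ∏ k ∈ range N, (1 - z * q ^ k) =
      ∑ ij ∈ antidiagonal N, qBinom q ij.1 ij.2 * (-1) ^ ij.1 * q ^ (ij.1.choose 2) * z ^ ij.1 := by
  induction N with
  | zero => simp [qBinom, qPoch]
  | succ N ih =>
    -- Pascal's rule, from `1 - q^(i + j) = (1 - q^j) + q^j (1 - q^i)`
    set u : ℕ × ℕ → ℂ := fun ij => qPoch q N / (qPoch q ij.1 * qPoch q ij.2) * (1 - q ^ ij.2) *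
      ((-1) ^ ij.1 * q ^ (ij.1.choose 2) * z ^ ij.1) with hu
    set v : ℕ × ℕ → ℂ := fun ij => qPoch q N / (qPoch q ij.1 * qPoch q ij.2) *
      (q ^ ij.2 * (1 - q ^ ij.1)) * ((-1) ^ ij.1 * q ^ (ij.1.choose 2) * z ^ ij.1) with hv
    have hsplit : ∑ ij ∈ antidiagonal (N + 1),
        qBinom q ij.1 ij.2 * (-1) ^ ij.1 * q ^ (ij.1.choose 2) * z ^ ij.1 =
        ∑ ij ∈ antidiagonal (N + 1), u ij + ∑ ij ∈ antidiagonal (N + 1), v ij := by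
      rw [← sum_add_distrib]
      refine sum_congr rfl fun ij hij => ?_
      rw [HasAntidiagonal.mem_antidiagonal] at hij
      have : q ^ (N + 1) = q ^ ij.1 * q ^ ij.2 := by rw [← hij, pow_add]
      simp only [hu, hv, qBinom, hij, qPoch_succ, this]
      ring
    rw [hsplit, Nat.sum_antidiagonal_succ', Nat.sum_antidiagonal_succ, prod_range_succ, ih,
      sum_mul]
    have h0 : u (N + 1, 0) = 0 := by simp [hu]
    have h1 : v (0, N + 1) = 0 := by simp [hv]
    rw [h0, h1, zero_add, zero_add, ← sum_add_distrib]
    refine sum_congr rfl fun ij hij => ?_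
    rw [HasAntidiagonal.mem_antidiagonal] at hij
    have hi := qPoch_ne_zero hq ij.1
    have hj := qPoch_ne_zero hq ij.2
    have hi' := one_sub_pow_ne_zero hq ij.1
    have hj' := one_sub_pow_ne_zero hq ij.2
    simp only [hu, hv, qBinom, hij, qPoch_succ, Nat.choose_succ_succ' ij.1 1, Nat.choose_one_right]
    rw [← hij]
    field_simp
    ring

/-- The left half of the product `∏ (1 - z q^k)` over `k ≤ 2 n + 1`, at its zero
`z = q^(-n - 1)`, up to the order of the factors. -/
theorem prod_one_sub_inv_pow (hq0 : q ≠ 0) (m : ℕ) :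
    ∏ k ∈ range m, (1 - (q ^ (k + 1))⁻¹) = (-1) ^ m * qPoch q m / q ^ ((m + 1).choose 2) := by
  induction m with
  | zero => simp [qPoch]
  | succ m ih =>
    rw [prod_range_succ, ih, qPoch_succ, Nat.choose_succ_succ' (m + 1) 1, Nat.choose_one_right,
      pow_add]
    have h1 := pow_ne_zero (m + 1) hq0
    have h2 := pow_ne_zero ((m + 1).choose 2) hq0
    field_simp
    ring

theorem two_mul_choose_two (i : ℕ) : 2 * ((i.choose 2 : ℕ) : ℤ) = i * (i - 1) := by
  induction i with
  | zero => simp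
  | succ i ih =>
    rw [Nat.choose_succ_succ' i 1, Nat.choose_one_right]
    push_cast
    linarith

/-- The `q`-binomial theorem for `∏ (1 - z q^k)` over `k ≤ 2 n + 1`, differentiated at the zero
`z = q^(-n - 1)` of the middle factor. As the product vanishes there, the factor `i` that comes from
`z^i` may be replaced by `i - (n + 1)`. -/
theorem finite_jacobi_aux (hq : ‖q‖ < 1) (hq0 : q ≠ 0) (n : ℕ) :
    ∑ ij ∈ antidiagonal (2 * (n + 1)), ((ij.1 : ℂ) - (n + 1 : ℕ)) * (qBinom q ij.1 ij.2 *
      (-1) ^ ij.1 * q ^ (ij.1.choose 2) * ((q ^ (n + 1))⁻¹) ^ ij.1) =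
      (-1) ^ n * qPoch q (n + 1) / q ^ ((n + 2).choose 2) * qPoch q n := by
  set m := n + 1 with hm
  set z₀ := (q ^ m)⁻¹ with hz₀
  have hqm : q ^ m ≠ 0 := pow_ne_zero _ hq0
  set A : ℂ → ℂ := fun z => ∏ k ∈ range m, (1 - z * q ^ k) with hA
  set D : ℂ → ℂ := fun z => ∏ k ∈ range n, (1 - z * q ^ (m + (k + 1))) with hD
  -- the middle factor `1 - z q^m` vanishes at `z₀`
  have hfun : (fun z => A z * ((1 - z * q ^ m) * D z)) = fun z =>
      ∑ ij ∈ antidiagonal (2 * m), qBinom q ij.1 ij.2 * (-1) ^ ij.1 * q ^ (ij.1.choose 2) *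
        z ^ ij.1 := by
    funext z
    rw [← prod_one_sub_mul_pow hq, two_mul, prod_range_add]
    conv_rhs => rw [show range m = range (n + 1) from rfl]
    rw [prod_range_succ' (fun x => 1 - z * q ^ (m + x)), add_zero, mul_comm (1 - z * q ^ m)]
  have hz1 : 1 - z₀ * q ^ m = 0 := by rw [hz₀, inv_mul_cancel₀ hqm, sub_self]
  have hdA : DifferentiableAt ℂ A z₀ := by fun_prop
  have hdD : DifferentiableAt ℂ D z₀ := by fun_prop
  have hd1 : HasDerivAt (fun z : ℂ => 1 - z * q ^ m) (-(q ^ m)) z₀ := by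
    simpa using ((hasDerivAt_id z₀).mul_const (q ^ m)).const_sub 1
  have hL := hdA.hasDerivAt.mul (hd1.mul hdD.hasDerivAt)
  have hR : HasDerivAt (fun z => ∑ ij ∈ antidiagonal (2 * m), qBinom q ij.1 ij.2 * (-1) ^ ij.1 *
      q ^ (ij.1.choose 2) * z ^ ij.1) (∑ ij ∈ antidiagonal (2 * m), qBinom q ij.1 ij.2 *
      (-1) ^ ij.1 * q ^ (ij.1.choose 2) * (ij.1 * z₀ ^ (ij.1 - 1))) z₀ :=
    HasDerivAt.fun_sum fun ij _ => (hasDerivAt_pow ij.1 z₀).const_mul _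
  have hL' : HasDerivAt (fun z => A z * ((1 - z * q ^ m) * D z)) _ z₀ := hL
  rw [hfun] at hL'
  have hEq := hL'.unique hR
  have hval := congrFun hfun z₀
  simp only [Pi.mul_apply, hz1, zero_mul, mul_zero, zero_add, add_zero] at hEq hval
  have hA0 : A z₀ = (-1) ^ m * qPoch q m / q ^ ((n + 2).choose 2) := by
    rw [← prod_one_sub_inv_pow hq0, hA]
    simp only
    rw [← prod_range_reflect]
    refine prod_congr rfl fun k hk => ?_
    have hk' : m = (m - 1 - k) + (k + 1) := by have := mem_range.1 hk; omega
    have h1 : q ^ m = q ^ (m - 1 - k) * q ^ (k + 1) := by rw [← pow_add, ← hk']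
    rw [hz₀, h1, mul_inv]
    have := pow_ne_zero (m - 1 - k) hq0
    field_simp
  have hD0 : D z₀ = qPoch q n := by
    refine prod_congr rfl fun k _ => ?_
    rw [pow_add, ← mul_assoc, hz₀, inv_mul_cancel₀ hqm, one_mul]
  have hz0 : z₀ ≠ 0 := inv_ne_zero hqm
  calc _ = z₀ * (∑ ij ∈ antidiagonal (2 * m), qBinom q ij.1 ij.2 *
      (-1) ^ ij.1 * q ^ (ij.1.choose 2) * (ij.1 * z₀ ^ (ij.1 - 1))) - m *
      ∑ ij ∈ antidiagonal (2 * m), qBinom q ij.1 ij.2 * (-1) ^ ij.1 * q ^ (ij.1.choose 2) *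
        z₀ ^ ij.1 := by
        rw [mul_sum, mul_sum, ← sum_sub_distrib]
        refine sum_congr rfl fun ij _ => ?_
        rcases ij with ⟨_ | i, j⟩
        · simp
        · simp only [Nat.add_sub_cancel]
          ring
    _ = _ := by
        rw [← hEq, ← hval, hA0, hD0, mul_zero, sub_zero, hm, pow_succ (-1 : ℂ) n]
        have : z₀ * (-(q ^ m)) = -1 := by rw [mul_neg, hz₀, inv_mul_cancel₀ hqm]
        linear_combination (-1) ^ n * (-1) * qPoch q (n + 1) / q ^ ((n + 2).choose 2) * qPoch q n * this

/-- The division in the exponent `k (k - 1) / 2` is exact. -/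
theorem two_mul_triangle (k : ℤ) : 2 * (k * (k - 1) / 2) = k * (k - 1) :=
  Int.mul_ediv_cancel' (Int.even_mul_pred_self k).two_dvd

/-- The derivative of the finite form of Jacobi's triple product at its middle zero, in terms of
`k = i - (n + 1)`. -/
theorem finite_jacobi (hq : ‖q‖ < 1) (hq0 : q ≠ 0) (n : ℕ) :
    ∑ k ∈ Icc (-(n + 1 : ℤ)) (n + 1), (k : ℂ) * (-1) ^ k * q ^ (k * (k - 1) / 2) *
      qBinom q (n + 1 + k).toNat (n + 1 - k).toNat = - (qPoch q (n + 1) * qPoch q n) := by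
  have h := finite_jacobi_aux hq hq0 n
  have hb : q ^ ((n + 2).choose 2) ≠ 0 := pow_ne_zero _ hq0
  have key : ∑ k ∈ Icc (-(n + 1 : ℤ)) (n + 1), (k : ℂ) * (-1) ^ k * q ^ (k * (k - 1) / 2) *
      qBinom q (n + 1 + k).toNat (n + 1 - k).toNat =
      (-1) ^ (n + 1) * q ^ ((n + 2).choose 2) *
      ∑ ij ∈ antidiagonal (2 * (n + 1)), ((ij.1 : ℂ) - (n + 1 : ℕ)) * (qBinom q ij.1 ij.2 *
      (-1) ^ ij.1 * q ^ (ij.1.choose 2) * ((q ^ (n + 1))⁻¹) ^ ij.1) := by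
    rw [mul_sum]
    symm
    refine sum_bij' (fun ij _ => (ij.1 : ℤ) - (n + 1)) (fun k _ => ((n + 1 + k).toNat,
      (n + 1 - k).toNat)) ?_ ?_ ?_ ?_ ?_
    · intro ij hij
      rw [HasAntidiagonal.mem_antidiagonal] at hij
      rw [mem_Icc]
      omega
    · intro k hk
      rw [mem_Icc] at hk
      rw [HasAntidiagonal.mem_antidiagonal]
      simp only
      omega
    · intro ij hij
      rw [HasAntidiagonal.mem_antidiagonal] at hij
      ext <;> simp only <;> omega
    · intro k hk
      rw [mem_Icc] at hk
      simp only
      omega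
    · rintro ⟨i, j⟩ hij
      rw [HasAntidiagonal.mem_antidiagonal] at hij
      simp only at hij ⊢
      have hi : ((n + 1 + ((i : ℤ) - (n + 1))).toNat) = i := by omega
      have hj : ((n + 1 - ((i : ℤ) - (n + 1))).toNat) = j := by omega
      have hexp : q ^ ((n + 2).choose 2) * (q ^ (i.choose 2) * ((q ^ (n + 1))⁻¹) ^ i) =
          q ^ (((i : ℤ) - (n + 1)) * ((i : ℤ) - (n + 1) - 1) / 2) := by
        rw [inv_pow, ← pow_mul, ← zpow_natCast, ← zpow_natCast, ← zpow_natCast q ((n + 1) * i),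
          ← zpow_neg, ← zpow_add₀ hq0, ← zpow_add₀ hq0]
        congr 1
        have h1 := two_mul_choose_two (n + 2)
        have h2 := two_mul_choose_two i
        have h3 := two_mul_triangle ((i : ℤ) - (n + 1))
        push_cast at h1 ⊢
        linarith
      have hsgn : ((-1 : ℂ)) ^ ((i : ℤ) - (n + 1)) = (-1) ^ (n + 1) * (-1) ^ i := by
        rw [zpow_sub₀ (by norm_num), zpow_natCast, div_eq_mul_inv, mul_comm]
        congr 1
        have : ((n : ℤ) + 1) = ((n + 1 : ℕ) : ℤ) := by push_cast; ring
        rw [this, zpow_natCast, ← inv_pow]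
        norm_num
      rw [hi, hj, ← hexp, hsgn]
      push_cast
      ring
  rw [key, h]
  field_simp
  have hs : ((-1 : ℂ) ^ n) ^ 2 = 1 := by rw [← pow_mul, mul_comm, pow_mul]; norm_num
  linear_combination (-(qPoch q (n + 1) * qPoch q n)) * hs

end JacobiIdentity

/-! ### Jacobi's identity for the cube of the Euler product -/

section JacobiCube

open Finset Filter Topology

variable {q : ℂ}

theorem tendsto_qPoch (hq : ‖q‖ < 1) :
    Tendsto (qPoch q) atTop (𝓝 (∏' n : ℕ, (1 - q ^ (n + 1)))) :=
  (ModularForm.multipliable_one_sub_pow hq).hasProd.tendsto_prod_nat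

theorem tprod_one_sub_pow_ne_zero (hq : ‖q‖ < 1) : ∏' n : ℕ, (1 - q ^ (n + 1)) ≠ 0 := by
  refine tprod_one_add_ne_zero_of_summable (f := fun n => -q ^ (n + 1)) (fun i => ?_) ?_
  · simpa [sub_eq_add_neg] using one_sub_pow_ne_zero hq i
  · simpa using (summable_nat_add_iff 1).mpr (summable_geometric_of_lt_one (norm_nonneg _) hq)

/-- A geometric bound, by `|k| - 1 ≤ k (k - 1) / 2`. -/
theorem norm_zpow_triangle_le (hq : ‖q‖ < 1) (hq0 : q ≠ 0) (k : ℤ) :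
    ‖q ^ (k * (k - 1) / 2)‖ ≤ ‖q‖⁻¹ * ‖q‖ ^ k.natAbs := by
  have h0 : 0 < ‖q‖ := norm_pos_iff.2 hq0
  rw [norm_zpow, ← zpow_natCast, ← zpow_neg_one, ← zpow_add₀ h0.ne']
  refine zpow_le_zpow_right_of_le_one₀ h0 hq.le ?_
  have h := two_mul_triangle k
  rcases Int.natAbs_eq k with hk | hk
  · generalize k.natAbs = n at *
    subst hk
    have : 0 ≤ ((n : ℤ) - 1) * (n - 2) := by
      rcases n with _ | _ | n
      · simp
      · simp
      · push_cast; have : (0:ℤ) ≤ n := by positivity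
        nlinarith
    nlinarith
  · generalize k.natAbs = n at *
    subst hk
    nlinarith [sq_nonneg (n : ℤ)]

theorem summable_natAbs_mul_pow {r : ℝ} (h0 : 0 ≤ r) (h1 : r < 1) :
    Summable fun k : ℤ => (k.natAbs : ℝ) * r ^ k.natAbs := by
  have h : Summable fun n : ℕ => (n : ℝ) * r ^ n := by
    simpa using summable_pow_mul_geometric_of_norm_lt_one 1 (r := r) (by rwa [Real.norm_of_nonneg h0])
  exact Summable.of_nat_of_neg (by simpa using h) (by simpa using h)

/-- The limit of the finite identity, in which the Gaussian binomial coefficients tend to the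
inverse of the Euler product while the right hand side tends to minus its square. -/
theorem hasSum_mul_neg_one_zpow_mul_zpow (hq : ‖q‖ < 1) (hq0 : q ≠ 0) :
    HasSum (fun k : ℤ => (k : ℂ) * (-1) ^ k * q ^ (k * (k - 1) / 2))
      (-(∏' n : ℕ, (1 - q ^ (n + 1))) ^ 3) := by
  set P := ∏' n : ℕ, (1 - q ^ (n + 1)) with hP
  have hP0 : P ≠ 0 := tprod_one_sub_pow_ne_zero hq
  have hlim := tendsto_qPoch hq
  have hsum : Summable fun k : ℤ => ‖q‖⁻¹ * ((k.natAbs : ℝ) * ‖q‖ ^ k.natAbs) :=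
    (summable_natAbs_mul_pow (norm_nonneg q) hq).mul_left _
  have hbound : ∀ k : ℤ, ‖(k : ℂ) * (-1) ^ k * q ^ (k * (k - 1) / 2)‖ ≤
      ‖q‖⁻¹ * ((k.natAbs : ℝ) * ‖q‖ ^ k.natAbs) := fun k => by
    rw [norm_mul, norm_mul, norm_zpow, norm_neg, norm_one, one_zpow, mul_one, Complex.norm_intCast,
      Nat.cast_natAbs, Int.cast_abs, mul_left_comm]
    exact mul_le_mul_of_nonneg_left (by simpa using norm_zpow_triangle_le hq hq0 k) (abs_nonneg _)
  have hS : Summable fun k : ℤ => (k : ℂ) * (-1) ^ k * q ^ (k * (k - 1) / 2) :=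
    hsum.of_norm_bounded hbound
  -- uniform bounds for `(q; q)_m` and its inverse
  obtain ⟨C, hC⟩ := hlim.norm.bddAbove_range
  obtain ⟨C', hC'⟩ := (hlim.inv₀ hP0).norm.bddAbove_range
  replace hC : ∀ m, ‖qPoch q m‖ ≤ C := fun m => hC ⟨m, rfl⟩
  replace hC' : ∀ m, ‖(qPoch q m)⁻¹‖ ≤ C' := fun m => hC' ⟨m, rfl⟩
  have hC0 : 0 ≤ C := (norm_nonneg _).trans (hC 0)
  have hC0' : 0 ≤ C' := (norm_nonneg _).trans (hC' 0)
  have hB : ∀ i j, ‖qBinom q i j‖ ≤ C * (C' * C') := fun i j => by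
    rw [qBinom, div_eq_mul_inv, mul_inv, norm_mul, norm_mul]
    gcongr
    exacts [hC _, hC' _, hC' _]
  set F : ℕ → ℤ → ℂ := fun n => (Set.Icc (-(n + 1 : ℤ)) (n + 1)).indicator fun k : ℤ =>
    (k : ℂ) * (-1) ^ k * q ^ (k * (k - 1) / 2) * qBinom q (n + 1 + k).toNat (n + 1 - k).toNat with hF
  have hFsum : ∀ n, ∑' k, F n k = -(qPoch q (n + 1) * qPoch q n) := fun n => by
    rw [← finite_jacobi hq hq0 n, tsum_eq_sum (s := Icc (-(n + 1 : ℤ)) (n + 1))]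
    · refine sum_congr rfl fun k hk => ?_
      rw [hF]
      exact Set.indicator_of_mem (by simpa using hk) _
    · intro k hk
      exact Set.indicator_of_notMem (by simpa using hk) _
  have hT : Tendsto (fun n => ∑' k, F n k) atTop
      (𝓝 (∑' k : ℤ, (k : ℂ) * (-1) ^ k * q ^ (k * (k - 1) / 2) * P⁻¹)) := by
    refine tendsto_tsum_of_dominated_convergence (hsum.mul_right (C * (C' * C'))) (fun k => ?_)
      (Eventually.of_forall fun n k => ?_)
    · have hev : (fun n => F n k) =ᶠ[atTop] fun n : ℕ => (k : ℂ) * (-1) ^ k * q ^ (k * (k - 1) / 2) *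
          (qPoch q ((n + 1 + k).toNat + (n + 1 - k).toNat) *
            ((qPoch q (n + 1 + k).toNat)⁻¹ * (qPoch q (n + 1 - k).toNat)⁻¹)) := by
        filter_upwards [eventually_ge_atTop k.natAbs] with n hn
        rw [hF]
        simp only
        rw [Set.indicator_of_mem (by rw [Set.mem_Icc]; omega), qBinom, div_eq_mul_inv, mul_inv]
      rw [tendsto_congr' hev]
      have h1 : Tendsto (fun n : ℕ => ((n : ℤ) + 1 + k).toNat) atTop atTop :=
        tendsto_atTop.2 fun b => by
          filter_upwards [eventually_ge_atTop (b + k.natAbs)] with n hn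
          omega
      have h2 : Tendsto (fun n : ℕ => ((n : ℤ) + 1 - k).toNat) atTop atTop :=
        tendsto_atTop.2 fun b => by
          filter_upwards [eventually_ge_atTop (b + k.natAbs)] with n hn
          omega
      have h3 := (hlim.comp (h1.atTop_add_atTop h2)).mul (((hlim.inv₀ hP0).comp h1).mul
        ((hlim.inv₀ hP0).comp h2))
      have h4 : P * (P⁻¹ * P⁻¹) = P⁻¹ := by field_simp
      rw [← hP, h4] at h3
      exact h3.const_mul _
    · rw [hF]
      simp only
      refine (norm_indicator_le_norm_self _ _).trans ?_
      rw [norm_mul]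
      exact mul_le_mul (hbound k) (hB _ _) (norm_nonneg _) ((norm_nonneg _).trans (hbound k))
  simp only [hFsum, tsum_mul_right] at hT
  have hT' : Tendsto (fun n => -(qPoch q (n + 1) * qPoch q n)) atTop (𝓝 (-(P * P))) :=
    ((hlim.comp (tendsto_add_atTop_nat 1)).mul hlim).neg
  have := tendsto_nhds_unique hT hT'
  have h5 : ∑' k : ℤ, (k : ℂ) * (-1) ^ k * q ^ (k * (k - 1) / 2) = -P ^ 3 := by
    rw [← div_eq_mul_inv, div_eq_iff hP0] at this
    rw [this]
    ring
  exact h5 ▸ hS.hasSum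

/-- **Jacobi's identity** for the cube of the Euler product, as a sum over all integers, in which
every term of the usual sum appears twice. -/
theorem hasSum_jacobi_cube (hq : ‖q‖ < 1) (hq0 : q ≠ 0) :
    HasSum (fun k : ℤ => (-1) ^ k * (2 * k + 1) * q ^ (k * (k + 1) / 2))
      (2 * (∏' n : ℕ, (1 - q ^ (n + 1))) ^ 3) := by
  have h1 := hasSum_mul_neg_one_zpow_mul_zpow hq hq0
  have h2 := (Equiv.subLeft (1 : ℤ)).hasSum_iff.2 h1
  have h3 := (Equiv.addRight (1 : ℤ)).hasSum_iff.2 (h1.add h2)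
  have key : (fun k : ℤ => (-1 : ℂ) ^ k * (2 * k + 1) * q ^ (k * (k + 1) / 2)) = fun k : ℤ =>
      -(((k + 1 : ℤ) : ℂ) * (-1) ^ (k + 1) * q ^ ((k + 1) * (k + 1 - 1) / 2) +
        ((1 - (k + 1) : ℤ) : ℂ) * (-1) ^ (1 - (k + 1)) *
          q ^ ((1 - (k + 1)) * (1 - (k + 1) - 1) / 2)) := by
    funext k
    have e1 : (k + 1) * (k + 1 - 1) = k * (k + 1) := by ring
    have e2 : (1 - (k + 1)) * (1 - (k + 1) - 1) = k * (k + 1) := by ring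
    have e3 : (-1 : ℂ) ^ (1 - (k + 1)) = (-1) ^ k := by
      rw [show 1 - (k + 1) = -k by ring, zpow_neg, ← inv_zpow, inv_neg_one]
    rw [e1, e2, e3, zpow_add₀ (by norm_num)]
    push_cast
    ring
  have key' : 2 * (∏' n : ℕ, (1 - q ^ (n + 1))) ^ 3 =
      -(-(∏' n : ℕ, (1 - q ^ (n + 1))) ^ 3 + -(∏' n : ℕ, (1 - q ^ (n + 1))) ^ 3) := by ring
  rw [key, key']
  exact h3.neg

end JacobiCube

/-! ### The coefficients of `g` -/

section CuspFormCoefficients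

open Finset Filter Topology

/-- The representations of `n` by the form `A² + 3B²`. -/
def normReps (n : ℕ) : Finset (ℤ × ℤ) :=
  (Icc (-(n : ℤ)) n ×ˢ Icc (-(n : ℤ)) n).filter fun x => x.1 ^ 2 + 3 * x.2 ^ 2 = n

theorem mem_normReps {n : ℕ} {x : ℤ × ℤ} : x ∈ normReps n ↔ x.1 ^ 2 + 3 * x.2 ^ 2 = n := by
  refine ⟨fun h => (mem_filter.1 h).2, fun h => mem_filter.2 ⟨?_, h⟩⟩
  rw [mem_product, mem_Icc, mem_Icc]
  refine ⟨⟨?_, ?_⟩, ?_, ?_⟩ <;> nlinarith [sq_nonneg (x.1), sq_nonneg x.2,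
    Int.le_self_sq x.1, Int.le_self_sq (-x.1), Int.le_self_sq x.2, Int.le_self_sq (-x.2)]

/-- The sum of `Re (A + B√-3)² = A² - 3B²` over the elements `A + B√-3` of norm `n`. -/
def thetaCoeff (n : ℕ) : ℤ := ∑ x ∈ normReps n, (x.1 ^ 2 - 3 * x.2 ^ 2)

/-- The coefficients of `g`: a theta series with a spherical polynomial, restricted to odd
exponents. -/
def gCoeff (n : ℕ) : ℂ := if Odd n then (thetaCoeff n : ℂ) / 2 else 0

/-- The summand of the theta series of `g`, as a function on `ℤ × ℤ`. -/
def thetaTerm (q : ℂ) (x : ℤ × ℤ) : ℂ :=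
  if Odd (x.1 ^ 2 + 3 * x.2 ^ 2).toNat then
    ((x.1 ^ 2 - 3 * x.2 ^ 2 : ℤ) : ℂ) / 2 * q ^ (x.1 ^ 2 + 3 * x.2 ^ 2).toNat else 0

theorem odd_toNat_norm_iff (A B : ℤ) : Odd (A ^ 2 + 3 * B ^ 2).toNat ↔ Odd (A - B) := by
  have h : ((A ^ 2 + 3 * B ^ 2).toNat : ℤ) = A ^ 2 + 3 * B ^ 2 := Int.toNat_of_nonneg (by positivity)
  rw [← Int.odd_coe_nat, h]
  simp only [Int.odd_add, Int.odd_sub, Int.even_mul, Int.even_pow, Int.odd_pow]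
  simp only [← Int.not_even_iff_odd]
  have : ¬ Even (3 : ℤ) := by decide
  simp [this]

variable {q : ℂ}

theorem tsum_fiber_thetaTerm (n : ℕ) :
    ∑' x : (fun x : ℤ × ℤ => (x.1 ^ 2 + 3 * x.2 ^ 2).toNat) ⁻¹' {n}, thetaTerm q x =
      gCoeff n * q ^ n := by
  have hset : (fun x : ℤ × ℤ => (x.1 ^ 2 + 3 * x.2 ^ 2).toNat) ⁻¹' {n} = ↑(normReps n) := by
    ext x
    have : 0 ≤ x.1 ^ 2 + 3 * x.2 ^ 2 := by positivity
    simp only [Set.mem_preimage, Set.mem_singleton_iff, mem_coe, mem_normReps]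
    omega
  rw [hset, Finset.tsum_subtype', gCoeff, thetaCoeff]
  have hn : ∀ x ∈ normReps n, (x.1 ^ 2 + 3 * x.2 ^ 2).toNat = n := fun x hx => by
    rw [mem_normReps.1 hx, Int.toNat_natCast]
  split_ifs with h
  · rw [Int.cast_sum, sum_div, sum_mul]
    refine sum_congr rfl fun x hx => ?_
    rw [thetaTerm, hn x hx, if_pos h]
  · rw [zero_mul]
    exact sum_eq_zero fun x hx => by rw [thetaTerm, hn x hx, if_neg h]

/-- The double series for `4 g` that results from Jacobi's identity. -/
def jacobiTerm (q : ℂ) (x : ℤ × ℤ) : ℂ :=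
  (-1) ^ (x.1 + x.2) * ((2 * x.1 + 1) * (2 * x.2 + 1)) *
    q ^ (1 + x.1 * (x.1 + 1) + 3 * (x.2 * (x.2 + 1)))

theorem HasSum.mul_of_complete {f g : ℤ → ℂ} {a b : ℂ} (hf : HasSum f a) (hg : HasSum g b) :
    HasSum (fun x : ℤ × ℤ => f x.1 * g x.2) (a * b) :=
  hf.mul hg (summable_mul_of_summable_norm hf.summable.norm hg.summable.norm)

theorem hasSum_jacobiTerm (hq : ‖q‖ < 1) (hq0 : q ≠ 0) :
    HasSum (jacobiTerm q) (4 *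
      (q * (∏' n : ℕ, (1 - (q ^ 2) ^ (n + 1))) ^ 3 * (∏' n : ℕ, (1 - (q ^ 6) ^ (n + 1))) ^ 3)) := by
  have hpow : ∀ n : ℕ, n ≠ 0 → ‖q ^ n‖ < 1 := fun n hn => by
    rw [norm_pow]
    exact pow_lt_one₀ (norm_nonneg _) hq hn
  have h2 := hasSum_jacobi_cube (hpow 2 (by norm_num)) (pow_ne_zero 2 hq0)
  have h6 := hasSum_jacobi_cube (hpow 6 (by norm_num)) (pow_ne_zero 6 hq0)
  have h := (h2.mul_of_complete h6).mul_left q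
  have e : jacobiTerm q = fun i : ℤ × ℤ => q * ((-1) ^ i.1 * (2 * (i.1 : ℂ) + 1) *
      (q ^ 2) ^ (i.1 * (i.1 + 1) / 2) * ((-1) ^ i.2 * (2 * (i.2 : ℂ) + 1) *
      (q ^ 6) ^ (i.2 * (i.2 + 1) / 2))) := by
    funext x
    have e1 := two_mul_triangle (x.1 + 1)
    have e2 := two_mul_triangle (x.2 + 1)
    rw [add_sub_cancel_right, mul_comm (x.1 + 1)] at e1
    rw [add_sub_cancel_right, mul_comm (x.2 + 1)] at e2
    have e3 : (q ^ 2) ^ (x.1 * (x.1 + 1) / 2) = q ^ (x.1 * (x.1 + 1)) := by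
      rw [← zpow_natCast, ← zpow_mul, Nat.cast_ofNat, e1]
    have e4 : (q ^ 6) ^ (x.2 * (x.2 + 1) / 2) = q ^ (3 * (x.2 * (x.2 + 1))) := by
      have e5 : ((6 : ℕ) : ℤ) * (x.2 * (x.2 + 1) / 2) = 3 * (x.2 * (x.2 + 1)) := by
        push_cast
        linarith
      rw [← zpow_natCast, ← zpow_mul, e5]
    rw [e3, e4, jacobiTerm, zpow_add₀ hq0, zpow_add₀ hq0, zpow_one,
      zpow_add₀ (by norm_num : (-1 : ℂ) ≠ 0)]
    ring
  have e' : 4 * (q * (∏' n : ℕ, (1 - (q ^ 2) ^ (n + 1))) ^ 3 *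
      (∏' n : ℕ, (1 - (q ^ 6) ^ (n + 1))) ^ 3) = q * (2 * (∏' n : ℕ, (1 - (q ^ 2) ^ (n + 1))) ^ 3 *
      (2 * (∏' n : ℕ, (1 - (q ^ 6) ^ (n + 1))) ^ 3)) := by
    ring
  rw [e, e']
  exact h

/-- The pairs `(k, l)` of equal parity contribute half of the double series: they are exchanged
with the others by `l ↦ -1 - l`. -/
theorem hasSum_jacobiTerm_even (hq : ‖q‖ < 1) (hq0 : q ≠ 0) :
    HasSum (fun y : ℤ × ℤ => jacobiTerm q (y.1 + 2 * y.2, y.1)) (2 *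
      (q * (∏' n : ℕ, (1 - (q ^ 2) ^ (n + 1))) ^ 3 * (∏' n : ℕ, (1 - (q ^ 6) ^ (n + 1))) ^ 3)) := by
  have hF := hasSum_jacobiTerm hq hq0
  generalize q * (∏' n : ℕ, (1 - (q ^ 2) ^ (n + 1))) ^ 3 *
    (∏' n : ℕ, (1 - (q ^ 6) ^ (n + 1))) ^ 3 = G at *
  set i₁ : ℤ × ℤ → ℤ × ℤ := fun y => (y.1 + 2 * y.2, y.1) with hi₁
  set i₂ : ℤ × ℤ → ℤ × ℤ := fun y => (y.1 + 2 * y.2, -1 - y.1) with hi₂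
  have hinj₁ : Function.Injective i₁ := fun x y h => by
    simp only [hi₁, Prod.mk.injEq] at h
    ext <;> omega
  have hinj₂ : Function.Injective i₂ := fun x y h => by
    simp only [hi₂, Prod.mk.injEq] at h
    ext <;> omega
  have hcompl : (Set.range i₁)ᶜ = Set.range i₂ := by
    ext ⟨k, l⟩
    simp only [Set.mem_compl_iff, Set.mem_range, hi₁, hi₂, Prod.mk.injEq, Prod.exists, not_exists,
      not_and]
    constructor
    · intro h
      have := h l ((k - l) / 2)
      exact ⟨-1 - l, (k - (-1 - l)) / 2, by omega, by omega⟩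
    · rintro ⟨a, b, h1, h2⟩ c d h3
      omega
  have hsame : ∀ y, jacobiTerm q (i₂ y) = jacobiTerm q (i₁ y) := fun y => by
    simp only [jacobiTerm, hi₁, hi₂]
    have e1 : 1 + (y.1 + 2 * y.2) * (y.1 + 2 * y.2 + 1) + 3 * ((-1 - y.1) * (-1 - y.1 + 1)) =
      1 + (y.1 + 2 * y.2) * (y.1 + 2 * y.2 + 1) + 3 * (y.1 * (y.1 + 1)) := by ring
    have e2 : (-1 : ℂ) ^ (y.1 + 2 * y.2 + (-1 - y.1)) = -1 :=
      Odd.neg_one_zpow ⟨y.2 - 1, by ring⟩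
    have e3 : (-1 : ℂ) ^ (y.1 + 2 * y.2 + y.1) = 1 :=
      Even.neg_one_zpow ⟨y.2 + y.1, by ring⟩
    rw [e1, e2, e3]
    push_cast
    ring
  have hG : Summable (jacobiTerm q ∘ i₁) := hF.summable.comp_injective hinj₁
  have hGval : ∑' y, jacobiTerm q (i₁ y) = 2 * G := by
    have h := Summable.tsum_add_tsum_compl (s := Set.range i₁) (hF.summable.subtype _)
      (hF.summable.subtype _)
    rw [hcompl, tsum_range _ hinj₁, tsum_range _ hinj₂, hF.tsum_eq] at h
    simp only [hsame] at h
    linear_combination h / 2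
  exact hGval ▸ hG.hasSum

/-- With `k = l + 2 B`, the exponent `1 + k (k + 1) + 3 l (l + 1)` is the norm of `A + B√-3` for
`A = 2 l + 1 + B`, and `(2 k + 1) (2 l + 1)` is `(A + 3 B) (A - B)`, whose part that is even in `B`
is `A² - 3 B²`. -/
theorem hasSum_thetaTerm (hq : ‖q‖ < 1) (hq0 : q ≠ 0) :
    HasSum (thetaTerm q)
      (q * (∏' n : ℕ, (1 - (q ^ 2) ^ (n + 1))) ^ 3 * (∏' n : ℕ, (1 - (q ^ 6) ^ (n + 1))) ^ 3) := by
  have h1 := hasSum_jacobiTerm_even hq hq0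
  generalize q * (∏' n : ℕ, (1 - (q ^ 2) ^ (n + 1))) ^ 3 *
    (∏' n : ℕ, (1 - (q ^ 6) ^ (n + 1))) ^ 3 = G at *
  -- symmetrization of the terms in `B ↦ -B`
  let e : ℤ × ℤ ≃ ℤ × ℤ :=
    { toFun := fun y => (y.1 + y.2, -y.2)
      invFun := fun y => (y.1 + y.2, -y.2)
      left_inv := fun y => by simp
      right_inv := fun y => by simp }
  have h2 := (h1.add (e.hasSum_iff.2 h1)).mul_left (1 / 4 : ℂ)
  -- the theta series is supported on the image of `(l, B) ↦ (2l + 1 + B, B)`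
  set j : ℤ × ℤ → ℤ × ℤ := fun y => (2 * y.1 + 1 + y.2, y.2) with hj
  have hinj : Function.Injective j := fun x y h => by
    simp only [hj, Prod.mk.injEq] at h
    ext <;> omega
  have hsupp : ∀ x ∉ Set.range j, thetaTerm q x = 0 := by
    rintro ⟨A, B⟩ hx
    rw [thetaTerm, if_neg]
    rw [odd_toNat_norm_iff]
    rintro ⟨l, hl⟩
    refine hx ⟨(l, B), Prod.ext ?_ rfl⟩
    change A - B = 2 * l + 1 at hl
    change 2 * l + 1 + B = A
    omega
  rw [← hinj.hasSum_iff hsupp]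
  have e1 : thetaTerm q ∘ j = fun b => (1 / 4 : ℂ) * (jacobiTerm q (b.1 + 2 * b.2, b.1) +
      ((fun y : ℤ × ℤ => jacobiTerm q (y.1 + 2 * y.2, y.1)) ∘ e) b) := by
    funext ⟨l, B⟩
    simp only [Function.comp, hj, jacobiTerm, thetaTerm, e, Equiv.coe_fn_mk]
    rw [if_pos ((odd_toNat_norm_iff _ _).2 ⟨l, by ring⟩), ← zpow_natCast,
      Int.toNat_of_nonneg (by positivity),
      Even.neg_one_zpow (⟨l + B, by ring⟩ : Even (l + 2 * B + l)),
      Even.neg_one_zpow (⟨l, by ring⟩ : Even (l + B + 2 * (-B) + (l + B)))]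
    have x1 : 1 + (l + 2 * B) * (l + 2 * B + 1) + 3 * (l * (l + 1)) =
      (2 * l + 1 + B) ^ 2 + 3 * B ^ 2 := by ring
    have x2 : 1 + (l + B + 2 * (-B)) * (l + B + 2 * (-B) + 1) + 3 * ((l + B) * (l + B + 1)) =
      (2 * l + 1 + B) ^ 2 + 3 * B ^ 2 := by ring
    rw [x1, x2]
    push_cast
    ring
  have e2 : G = 1 / 4 * (2 * G + 2 * G) := by ring
  rw [e1, e2]
  exact h2

/-- The expansion of `η(2τ)³ η(6τ)³` in powers of `q` as a theta series of `ℤ[√-3]`. -/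
theorem hasSum_gCoeff (hq : ‖q‖ < 1) (hq0 : q ≠ 0) :
    HasSum (fun n => gCoeff n * q ^ n)
      (q * (∏' n : ℕ, (1 - (q ^ 2) ^ (n + 1))) ^ 3 * (∏' n : ℕ, (1 - (q ^ 6) ^ (n + 1))) ^ 3) := by
  have h := (hasSum_thetaTerm hq hq0).tsum_fiberwise fun x : ℤ × ℤ => (x.1 ^ 2 + 3 * x.2 ^ 2).toNat
  simpa only [tsum_fiber_thetaTerm] using h

open UpperHalfPlane Function.Periodic in
theorem hasSum_gForm (τ : UpperHalfPlane) :
    HasSum (fun n => gCoeff n • qParam 1 τ ^ n) (gForm τ) := by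
  have hq : ‖qParam 1 (τ : ℂ)‖ < 1 := norm_qParam_lt_one one_pos τ.im_pos
  have h := hasSum_gCoeff hq (qParam_ne_zero _)
  simp only [smul_eq_mul]
  convert h using 1
  have hp : ∀ m : ℕ, qParam 1 ((m : ℂ) * (τ : ℂ)) = qParam 1 (τ : ℂ) ^ m := fun m => by
    rw [qParam, qParam, ← Complex.exp_nat_mul]
    congr 1
    push_cast
    ring
  have h2 := hp 2
  have h6 := hp 6
  push_cast at h2 h6
  rw [gForm, ModularForm.eta, ModularForm.eta]
  simp only [ModularForm.eta_q, h2, h6]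
  have : qParam 24 (2 * (τ : ℂ)) ^ 3 * qParam 24 (6 * (τ : ℂ)) ^ 3 = qParam 1 (τ : ℂ) := by
    rw [qParam, qParam, qParam, ← Complex.exp_nat_mul, ← Complex.exp_nat_mul, ← Complex.exp_add]
    congr 1
    push_cast
    ring
  rw [← this]
  ring

open UpperHalfPlane in
theorem differentiableOn_gForm :
    DifferentiableOn ℂ (fun z : ℂ => ModularForm.eta (2 * z) ^ 3 * ModularForm.eta (6 * z) ^ 3)
      {z | 0 < z.im} := by
  have key : ∀ c : ℝ, 0 < c → DifferentiableOn ℂ (fun z : ℂ => ModularForm.eta (c * z))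
      {z | 0 < z.im} := fun c hc z hz => by
    have h : DifferentiableAt ℂ ModularForm.eta (c * z) :=
      ModularForm.differentiableAt_eta_of_mem_upperHalfPlaneSet (by
        simpa [upperHalfPlaneSet] using mul_pos hc hz)
    have h2 : DifferentiableAt ℂ (fun z : ℂ => (c : ℂ) * z) z := by fun_prop
    exact (h.comp z h2).differentiableWithinAt
  have h2 := key 2 (by norm_num)
  have h6 := key 6 (by norm_num)
  push_cast at h2 h6
  exact (h2.pow 3).mul (h6.pow 3)

open UpperHalfPlane in
theorem gForm_comp_ofComplex {z : ℂ} (hz : 0 < z.im) :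
    (gForm ∘ ofComplex) z = ModularForm.eta (2 * z) ^ 3 * ModularForm.eta (6 * z) ^ 3 := by
  rw [Function.comp, ofComplex_apply_of_im_pos hz]
  rfl

open UpperHalfPlane Function.Periodic in
theorem periodic_gForm : Function.Periodic (gForm ∘ ofComplex) ((1 : ℝ) : ℂ) := fun z => by
  by_cases hz : 0 < z.im
  · have hz' : 0 < (z + ((1 : ℝ) : ℂ)).im := by simpa using hz
    simp only [Function.comp, ofComplex_apply_of_im_pos hz, ofComplex_apply_of_im_pos hz']
    refine (hasSum_gForm _).unique ?_
    have := hasSum_gForm ⟨z, hz⟩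
    simp only at this ⊢
    rwa [show qParam 1 (z + ((1 : ℝ) : ℂ)) = qParam 1 z by
      simp [qParam, mul_add, Complex.exp_add]]
  · have hz' : ¬ 0 < (z + ((1 : ℝ) : ℂ)).im := by simpa using hz
    simp only [Function.comp]
    rw [ofComplex_apply_of_im_nonpos (not_lt.1 hz), ofComplex_apply_of_im_nonpos (not_lt.1 hz')]

open UpperHalfPlane in
theorem differentiableOn_gForm_comp_ofComplex :
    DifferentiableOn ℂ (gForm ∘ ofComplex) {z | 0 < z.im} :=
  differentiableOn_gForm.congr fun _ hz => gForm_comp_ofComplex hz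

open UpperHalfPlane in
theorem analyticAt_cuspFunction_gForm : AnalyticAt ℂ (cuspFunction 1 gForm) 0 :=
  analyticAt_cuspFunction_zero one_pos periodic_gForm
    (mdifferentiable_iff.2 differentiableOn_gForm_comp_ofComplex)
    (isBoundedAtImInfty_of_hasSum_qExpansion one_pos hasSum_gForm)

open UpperHalfPlane in
/-- The coefficients of the `q`-expansion are those of the theta series, because a power series is
determined by its sum. -/
theorem qExpansion_gForm_coeff (n : ℕ) : (qExpansion 1 gForm).coeff n = gCoeff n := by
  have han := analyticAt_cuspFunction_gForm
  have h1 := (hasFPowerSeriesOnBall_cuspFunction one_pos han hasSum_gForm).hasFPowerSeriesAt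
  have h2 := h1.eq_formalMultilinearSeries han.hasFPowerSeriesAt
  have h3 := congrArg (fun s => FormalMultilinearSeries.coeff s n) h2
  simp only [FormalMultilinearSeries.coeff_ofScalars] at h3
  rw [h3, qExpansion_coeff, div_eq_inv_mul]

end CuspFormCoefficients

/-! ### Hecke relations in `ℤ[√-3]` -/

section HeckeRelations

open Finset

/-- Only the real part of `(A + B√-3)²` contributes to a sum over all elements of given norm. -/
theorem sum_normReps_mul_eq_zero (n : ℕ) : ∑ x ∈ normReps n, x.1 * x.2 = 0 := by
  have h : ∑ x ∈ normReps n, x.1 * x.2 = ∑ x ∈ normReps n, -(x.1 * x.2) :=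
    sum_bij' (fun x _ => (x.1, -x.2)) (fun x _ => (x.1, -x.2))
      (fun x hx => by rw [mem_normReps] at hx ⊢; simpa using hx)
      (fun x hx => by rw [mem_normReps] at hx ⊢; simpa using hx)
      (fun x _ => by simp) (fun x _ => by simp) (fun x _ => by ring)
  rw [sum_neg_distrib] at h
  linarith

theorem thetaCoeff_one : thetaCoeff 1 = 2 := by decide

/-- Multiplication by `√-3` maps the elements of norm `n` onto those of norm `3 n`. -/
theorem thetaCoeff_three_mul (n : ℕ) : thetaCoeff (3 * n) = -3 * thetaCoeff n := by
  rw [thetaCoeff, thetaCoeff, mul_sum]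
  symm
  refine sum_bij' (fun x _ => (-3 * x.2, x.1)) (fun x _ => (x.2, -(x.1 / 3))) ?_ ?_ ?_ ?_ ?_
  · intro x hx
    rw [mem_normReps] at hx ⊢
    push_cast
    linarith
  · intro x hx
    rw [mem_normReps] at hx ⊢
    have h3 : (3 : ℤ) ∣ x.1 := Int.prime_three.dvd_of_dvd_pow (n := 2) ⟨n - x.2 ^ 2, by
      push_cast at hx; linarith⟩
    obtain ⟨k, hk⟩ := h3
    rw [hk, Int.mul_ediv_cancel_left _ (by norm_num)]
    rw [hk] at hx
    push_cast at hx
    linarith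
  · intro x hx
    ext
    · rfl
    · simp only
      omega
  · intro x hx
    rw [mem_normReps] at hx
    have h3 : (3 : ℤ) ∣ x.1 := Int.prime_three.dvd_of_dvd_pow (n := 2) ⟨n - x.2 ^ 2, by
      push_cast at hx; linarith⟩
    ext
    · simp only
      omega
    · rfl
  · intro x hx
    ring

/-- Multiplication by `p` maps the elements of norm `n / p` onto the multiples of `p` of norm
`p n`. -/
theorem sum_normReps_dvd {p : ℕ} (hp : p.Prime) (n : ℕ) :
    ∑ x ∈ (normReps (p * n)).filter (fun x => (p : ℤ) ∣ x.1 ∧ (p : ℤ) ∣ x.2),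
      (x.1 ^ 2 - 3 * x.2 ^ 2) = if p ∣ n then (p : ℤ) ^ 2 * thetaCoeff (n / p) else 0 := by
  have hp0 : (p : ℤ) ≠ 0 := by exact_mod_cast hp.ne_zero
  split_ifs with h
  · obtain ⟨m, rfl⟩ := h
    rw [Nat.mul_div_cancel_left _ hp.pos, thetaCoeff, mul_sum]
    symm
    refine sum_bij' (fun x _ => (p * x.1, p * x.2)) (fun x _ => (x.1 / p, x.2 / p)) ?_ ?_ ?_ ?_ ?_
    · intro x hx
      rw [mem_normReps] at hx
      rw [mem_filter, mem_normReps]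
      refine ⟨?_, dvd_mul_right _ _, dvd_mul_right _ _⟩
      push_cast
      rw [← hx]
      ring
    · intro x hx
      rw [mem_filter, mem_normReps] at hx
      obtain ⟨h1, ⟨a, ha⟩, b, hb⟩ := hx
      rw [mem_normReps, ha, hb, Int.mul_ediv_cancel_left _ hp0, Int.mul_ediv_cancel_left _ hp0]
      rw [ha, hb] at h1
      push_cast at h1
      refine mul_left_cancel₀ (pow_ne_zero 2 hp0) ?_
      linarith
    · intro x hx
      ext
      exacts [Int.mul_ediv_cancel_left _ hp0, Int.mul_ediv_cancel_left _ hp0]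
    · intro x hx
      rw [mem_filter] at hx
      ext
      exacts [Int.mul_ediv_cancel' hx.2.1, Int.mul_ediv_cancel' hx.2.2]
    · intro x hx
      ring
  · rw [filter_false_of_mem, sum_empty]
    rintro x hx ⟨⟨a, ha⟩, b, hb⟩
    rw [mem_normReps, ha, hb] at hx
    push_cast at hx
    refine h (Int.natCast_dvd_natCast.1 ⟨a ^ 2 + 3 * b ^ 2, ?_⟩)
    refine mul_left_cancel₀ hp0 ?_
    linarith

theorem neg_three_not_isSquare {p : ℕ} [Fact p.Prime] (h2 : p ≠ 2) (h : p % 3 = 2) :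
    ¬ IsSquare (-3 : ZMod p) := by
  rintro ⟨y, hy⟩
  -- a square root of `-3` would give a primitive cube root of unity
  have h2' : (2 : ZMod p) ≠ 0 := by
    intro h0
    have : ((2 : ℕ) : ZMod p) = 0 := by exact_mod_cast h0
    rw [ZMod.natCast_eq_zero_iff] at this
    exact h2 ((Nat.prime_dvd_prime_iff_eq Fact.out Nat.prime_two).1 this)
  have h3' : (3 : ZMod p) ≠ 0 := by
    intro h0
    have : ((3 : ℕ) : ZMod p) = 0 := by exact_mod_cast h0
    rw [ZMod.natCast_eq_zero_iff] at this
    have := (Nat.prime_dvd_prime_iff_eq Fact.out Nat.prime_three).1 this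
    omega
  set w : ZMod p := (y - 1) / 2 with hw
  have hw2 : w ^ 2 + w + 1 = 0 := by
    rw [hw]
    field_simp
    linear_combination -hy
  have hw3 : w ^ 3 = 1 := by linear_combination (w - 1) * hw2
  have hw0 : w ≠ 0 := by
    intro h0
    rw [h0] at hw3
    norm_num at hw3
  have hw1 : w ≠ 1 := by
    intro h1
    rw [h1] at hw2
    apply h3'
    linear_combination hw2
  have ho : orderOf w = 3 := orderOf_eq_prime hw3 hw1
  have hd := ZMod.orderOf_dvd_card_sub_one hw0
  rw [ho] at hd
  have := (Fact.out : p.Prime).pos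
  omega

/-- The prime `p` is inert, so that every element of norm divisible by `p` is a multiple of `p`. -/
theorem thetaCoeff_mul_of_mod_three_eq_two {p : ℕ} (hp : p.Prime) (h2 : p ≠ 2) (h : p % 3 = 2)
    (n : ℕ) : thetaCoeff (p * n) = if p ∣ n then (p : ℤ) ^ 2 * thetaCoeff (n / p) else 0 := by
  have : Fact p.Prime := ⟨hp⟩
  rw [← sum_normReps_dvd hp, thetaCoeff, filter_true_of_mem]
  intro x hx
  rw [mem_normReps] at hx
  have h0 : (x.1 : ZMod p) ^ 2 + 3 * (x.2 : ZMod p) ^ 2 = 0 := by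
    have := congrArg (Int.cast : ℤ → ZMod p) hx
    push_cast at this
    rw [this, CharP.cast_eq_zero, zero_mul]
  have hy : (x.2 : ZMod p) = 0 := by
    by_contra hy
    refine neg_three_not_isSquare h2 h ⟨x.1 / x.2, ?_⟩
    field_simp
    linear_combination -h0
  have hx' : (x.1 : ZMod p) = 0 := by
    rw [hy] at h0
    exact pow_eq_zero_iff (two_ne_zero) |>.1 (by linear_combination h0)
  exact ⟨(ZMod.intCast_zmod_eq_zero_iff_dvd _ _).1 hx', (ZMod.intCast_zmod_eq_zero_iff_dvd _ _).1 hy⟩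

/-- Multiplication by `π = a + b√-3` of norm `p` maps the elements of norm `n` onto the multiples
of `π` of norm `p n`. -/
theorem sum_normReps_dvd_sub {p : ℕ} (hp : p.Prime) {a b : ℤ} (hab : a ^ 2 + 3 * b ^ 2 = p) (n : ℕ) :
    ∑ x ∈ (normReps (p * n)).filter (fun x => (p : ℤ) ∣ a * x.2 - b * x.1),
      (x.1 ^ 2 - 3 * x.2 ^ 2) = (a ^ 2 - 3 * b ^ 2) * thetaCoeff n := by
  have hp0 : (p : ℤ) ≠ 0 := by exact_mod_cast hp.ne_zero
  have hpZ : Prime (p : ℤ) := Nat.prime_iff_prime_int.1 hp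
  have hb : ¬ (p : ℤ) ∣ b := by
    rintro ⟨c, rfl⟩
    have ha : (p : ℤ) ∣ a := hpZ.dvd_of_dvd_pow (n := 2) ⟨1 - 3 * p * c ^ 2, by linarith⟩
    obtain ⟨d, rfl⟩ := ha
    have : (p : ℤ) ∣ 1 := ⟨d ^ 2 + 3 * c ^ 2, by
      refine mul_left_cancel₀ hp0 ?_
      linarith⟩
    exact hpZ.not_dvd_one this
  have key : ∀ x : ℤ × ℤ, (p : ℤ) ∣ a * x.2 - b * x.1 → (p : ℤ) ∣ a * x.1 + 3 * b * x.2 := by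
    rintro x ⟨c, hc⟩
    refine (hpZ.dvd_or_dvd (a := b) ⟨x.2 - a * c, ?_⟩).resolve_left hb
    rw [← hab] at hc ⊢
    linear_combination (-a) * hc
  -- `Re (π z)² = Re π² Re z² - Im π² Im z²`, and the imaginary parts cancel in the sum
  have hsum : (a ^ 2 - 3 * b ^ 2) * thetaCoeff n = ∑ x ∈ normReps n,
      ((a * x.1 - 3 * b * x.2) ^ 2 - 3 * (a * x.2 + b * x.1) ^ 2) := by
    have h0 := sum_normReps_mul_eq_zero n
    rw [← add_zero ((a ^ 2 - 3 * b ^ 2) * thetaCoeff n), ← mul_zero (-12 * a * b), ← h0, thetaCoeff,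
      mul_sum, mul_sum, ← sum_add_distrib]
    exact sum_congr rfl fun x _ => by ring
  rw [hsum]
  symm
  refine sum_bij' (fun x _ => (a * x.1 - 3 * b * x.2, a * x.2 + b * x.1))
    (fun x _ => ((a * x.1 + 3 * b * x.2) / p, (a * x.2 - b * x.1) / p)) ?_ ?_ ?_ ?_ ?_
  · intro x hx
    rw [mem_normReps] at hx
    rw [mem_filter, mem_normReps]
    refine ⟨?_, x.2, ?_⟩
    · push_cast
      rw [← hx, ← hab]
      ring
    · rw [← hab]
      ring
  · intro x hx
    rw [mem_filter, mem_normReps] at hx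
    obtain ⟨h1, h2⟩ := hx
    obtain ⟨d, hd⟩ := key x h2
    obtain ⟨c, hc⟩ := h2
    rw [mem_normReps, hd, hc, Int.mul_ediv_cancel_left _ hp0, Int.mul_ediv_cancel_left _ hp0]
    refine mul_left_cancel₀ (pow_ne_zero 2 hp0) ?_
    push_cast at h1
    have e : (p : ℤ) ^ 2 * (d ^ 2 + 3 * c ^ 2) = (a ^ 2 + 3 * b ^ 2) * (x.1 ^ 2 + 3 * x.2 ^ 2) := by
      linear_combination (-(p * d + (a * x.1 + 3 * b * x.2))) * hd -
        3 * (p * c + (a * x.2 - b * x.1)) * hc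
    rw [e, hab, h1]
    ring
  · intro x hx
    ext
    · simp only
      rw [show a * (a * x.1 - 3 * b * x.2) + 3 * b * (a * x.2 + b * x.1) = p * x.1 by
        rw [← hab]; ring, Int.mul_ediv_cancel_left _ hp0]
    · simp only
      rw [show a * (a * x.2 + b * x.1) - b * (a * x.1 - 3 * b * x.2) = p * x.2 by
        rw [← hab]; ring, Int.mul_ediv_cancel_left _ hp0]
  · intro x hx
    rw [mem_filter] at hx
    obtain ⟨d, hd⟩ := key x hx.2
    obtain ⟨c, hc⟩ := hx.2
    ext
    · simp only
      rw [hd, hc, Int.mul_ediv_cancel_left _ hp0, Int.mul_ediv_cancel_left _ hp0]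
      refine mul_left_cancel₀ hp0 ?_
      rw [← hab] at hd hc ⊢
      linear_combination (-a) * hd + 3 * b * hc
    · simp only
      rw [hd, hc, Int.mul_ediv_cancel_left _ hp0, Int.mul_ediv_cancel_left _ hp0]
      refine mul_left_cancel₀ hp0 ?_
      rw [← hab] at hd hc ⊢
      linear_combination (-b) * hd - a * hc
  · intro x hx
    rfl

/-- The prime `p = π π̄` splits. Every element of norm divisible by `p` is a multiple of `π` or of
`π̄`, and the common multiples are those of `p`; the formula is inclusion and exclusion. -/
theorem thetaCoeff_mul_of_norm {p : ℕ} (hp : p.Prime) (h2 : p ≠ 2) {a b : ℤ}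
    (hab : a ^ 2 + 3 * b ^ 2 = p) (h3 : p ≠ 3) (n : ℕ) : thetaCoeff (p * n) =
      2 * (a ^ 2 - 3 * b ^ 2) * thetaCoeff n -
        if p ∣ n then (p : ℤ) ^ 2 * thetaCoeff (n / p) else 0 := by
  have hp0 : (p : ℤ) ≠ 0 := by exact_mod_cast hp.ne_zero
  have hpZ : Prime (p : ℤ) := Nat.prime_iff_prime_int.1 hp
  have hd1 := sum_normReps_dvd_sub hp hab n
  have hd2 := sum_normReps_dvd_sub hp (a := a) (b := -b) (by rw [neg_sq, hab]) n
  rw [← sum_normReps_dvd hp]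
  have hp2 : ¬ (p : ℤ) ∣ 2 := fun h => h2 ((Nat.prime_dvd_prime_iff_eq hp Nat.prime_two).1
    (by exact_mod_cast h))
  have hp3 : ¬ (p : ℤ) ∣ 3 := fun h => h3 ((Nat.prime_dvd_prime_iff_eq hp Nat.prime_three).1
    (by exact_mod_cast h))
  have hpab : ¬ ((p : ℤ) ∣ a ∨ (p : ℤ) ∣ b) := by
    intro h
    have h' : (p : ℤ) ∣ a ∧ (p : ℤ) ∣ b := by
      rcases h with h | h
      · refine ⟨h, hpZ.dvd_of_dvd_pow (n := 2) ?_⟩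
        obtain ⟨d, rfl⟩ := h
        exact (hpZ.dvd_or_dvd (a := 3) ⟨1 - p * d ^ 2, by linarith⟩).resolve_left hp3
      · refine ⟨hpZ.dvd_of_dvd_pow (n := 2) ?_, h⟩
        obtain ⟨d, rfl⟩ := h
        exact ⟨1 - 3 * p * d ^ 2, by linarith⟩
    obtain ⟨⟨c, rfl⟩, d, rfl⟩ := h'
    refine hpZ.not_dvd_one ⟨c ^ 2 + 3 * d ^ 2, mul_left_cancel₀ hp0 ?_⟩
    linarith
  rw [not_or] at hpab
  have hunion : normReps (p * n) = (normReps (p * n)).filter (fun x => (p : ℤ) ∣ a * x.2 - b * x.1) ∪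
      (normReps (p * n)).filter (fun x => (p : ℤ) ∣ a * x.2 - -b * x.1) := by
    -- `(a B - b A) (a B + b A) = p (B² - b² n)` for an element `A + B√-3` of norm `p n`
    rw [← filter_or, filter_true_of_mem]
    intro x hx
    rw [mem_normReps] at hx
    push_cast at hx
    refine hpZ.dvd_or_dvd ⟨x.2 ^ 2 - b ^ 2 * n, ?_⟩
    linear_combination x.2 ^ 2 * hab - b ^ 2 * hx
  have hinter : (normReps (p * n)).filter (fun x => (p : ℤ) ∣ x.1 ∧ (p : ℤ) ∣ x.2) =
      (normReps (p * n)).filter (fun x => (p : ℤ) ∣ a * x.2 - b * x.1) ∩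
      (normReps (p * n)).filter (fun x => (p : ℤ) ∣ a * x.2 - -b * x.1) := by
    rw [← filter_and]
    refine filter_congr fun x _ => ⟨fun h => ?_, fun h => ?_⟩
    · exact ⟨dvd_sub (h.2.mul_left _) (h.1.mul_left _), dvd_sub (h.2.mul_left _) (h.1.mul_left _)⟩
    · have e1 : (p : ℤ) ∣ 2 * (b * x.1) := by
        have := dvd_sub h.2 h.1
        rwa [show a * x.2 - -b * x.1 - (a * x.2 - b * x.1) = 2 * (b * x.1) by ring] at this
      have e2 : (p : ℤ) ∣ 2 * (a * x.2) := by
        have := dvd_add h.2 h.1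
        rwa [show a * x.2 - -b * x.1 + (a * x.2 - b * x.1) = 2 * (a * x.2) by ring] at this
      exact ⟨(hpZ.dvd_or_dvd ((hpZ.dvd_or_dvd e1).resolve_left hp2)).resolve_left hpab.2,
        (hpZ.dvd_or_dvd ((hpZ.dvd_or_dvd e2).resolve_left hp2)).resolve_left hpab.1⟩
  have h := sum_union_inter (s₁ := (normReps (p * n)).filter
      (fun x => (p : ℤ) ∣ a * x.2 - b * x.1)) (s₂ := (normReps (p * n)).filter
      (fun x => (p : ℤ) ∣ a * x.2 - -b * x.1)) (f := fun x => x.1 ^ 2 - 3 * x.2 ^ 2)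
  rw [← hunion, ← hinter, hd1, hd2, ← thetaCoeff] at h
  linarith

end HeckeRelations

/-! ### Euler product and convergence of the Dirichlet series -/

section EulerProductOfRecursion

open Finset

/-- The relation `T_p c = l c` for the Hecke operator at `p`, where `e = χ(p) p^(k-1)`. -/
def HasHeckeRelation (c : ℕ → ℂ) (p : ℕ) (l e : ℂ) : Prop :=
  ∀ n, c (p * n) = l * c n - if p ∣ n then e * c (n / p) else 0

theorem gCoeff_one : gCoeff 1 = 1 := by
  rw [gCoeff, if_pos odd_one, thetaCoeff_one]
  norm_num

theorem gCoeff_zero : gCoeff 0 = 0 := by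
  rw [gCoeff, if_neg (by decide)]

/-- Only odd exponents occur in `g`. -/
theorem hasHeckeRelation_gCoeff_two : HasHeckeRelation gCoeff 2 0 0 := fun n => by
  rw [gCoeff, if_neg (by simp)]
  simp

/-- The Hecke relations of the theta series pass to its restriction to odd exponents. -/
theorem hasHeckeRelation_gCoeff {p : ℕ} (hp : p.Prime) (h2 : p ≠ 2) {l e : ℤ}
    (h : ∀ n, thetaCoeff (p * n) = l * thetaCoeff n - if p ∣ n then e * thetaCoeff (n / p) else 0) :
    HasHeckeRelation gCoeff p l e := fun n => by
  have hodd := hp.odd_of_ne_two h2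
  by_cases hn : Odd n
  · rw [gCoeff, if_pos (hodd.mul hn), h, gCoeff, if_pos hn]
    split_ifs with hd
    · obtain ⟨m, rfl⟩ := hd
      rw [Nat.mul_div_cancel_left _ hp.pos, gCoeff, if_pos (Nat.Odd.of_mul_right hn)]
      push_cast
      ring
    · push_cast
      ring
  · rw [gCoeff, if_neg (fun h => hn (Nat.Odd.of_mul_right h)), gCoeff, if_neg hn]
    split_ifs with hd
    · obtain ⟨m, rfl⟩ := hd
      rw [Nat.mul_div_cancel_left _ hp.pos, gCoeff, if_neg (fun h => hn (hodd.mul h))]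
      ring
    · ring

variable {c : ℕ → ℂ} {l e : ℕ → ℂ}

theorem mul_of_hasHeckeRelation (h1 : c 1 = 1)
    (h : ∀ p : ℕ, p.Prime → HasHeckeRelation c p (l p) (e p)) (m n : ℕ) (hmn : m.Coprime n) :
    c (m * n) = c m * c n := by
  induction m using Nat.strong_induction_on with
  | _ m ih =>
    rcases Nat.lt_trichotomy m 1 with hm | rfl | hm
    · obtain rfl : m = 0 := by omega
      obtain rfl : n = 1 := by simpa using hmn
      rw [h1, mul_one, mul_one]
    · rw [one_mul, h1, one_mul]
    · obtain ⟨p, hp, m', rfl⟩ := Nat.exists_prime_and_dvd hm.ne'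
      have hm0 : 0 < m' := Nat.pos_of_ne_zero (by rintro rfl; simp at hm)
      have hlt : m' < p * m' := lt_mul_of_one_lt_left hm0 hp.one_lt
      have hcop := Nat.Coprime.coprime_mul_left hmn
      have hpn : p.Coprime n := Nat.Coprime.coprime_mul_right hmn
      have hiff : p ∣ m' * n ↔ p ∣ m' :=
        ⟨fun hd => hpn.dvd_of_dvd_mul_right hd, fun hd => hd.mul_right n⟩
      rw [mul_assoc, h p hp, h p hp, ih m' hlt hcop]
      by_cases hd : p ∣ m'
      · rw [if_pos hd, if_pos (hiff.2 hd)]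
        obtain ⟨k, rfl⟩ := hd
        have hk : 0 < k := Nat.pos_of_ne_zero (by rintro rfl; simp at hm0)
        rw [mul_assoc, Nat.mul_div_cancel_left _ hp.pos, Nat.mul_div_cancel_left _ hp.pos,
          ih k ((lt_mul_of_one_lt_left hk hp.one_lt).trans hlt) (Nat.Coprime.coprime_mul_left hcop)]
        ring
      · rw [if_neg hd, if_neg (hiff.not.2 hd)]
        ring

/-- A Dirichlet series whose coefficients satisfy the Hecke relations has an Euler product with
quadratic factors. -/
theorem hasProd_of_hasHeckeRelation (h1 : c 1 = 1)
    (h : ∀ p : ℕ, p.Prime → HasHeckeRelation c p (l p) (e p)) {s : ℂ} (hs : LSeriesSummable c s) :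
    HasProd (fun p : Nat.Primes =>
      (1 - l p * (p : ℂ) ^ (-s) + e p * ((p : ℂ) ^ (-s)) ^ 2)⁻¹) (LSeries c s) := by
  have hmul : ∀ {m n : ℕ}, m.Coprime n →
      LSeries.term c s (m * n) = LSeries.term c s m * LSeries.term c s n := fun {m n} hmn => by
    rcases eq_or_ne m 0 with rfl | hm
    · simp
    rcases eq_or_ne n 0 with rfl | hn
    · simp
    rw [LSeries.term_of_ne_zero (mul_ne_zero hm hn), LSeries.term_of_ne_zero hm,
      LSeries.term_of_ne_zero hn, mul_of_hasHeckeRelation h1 h m n hmn, Nat.cast_mul,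
      Complex.natCast_mul_natCast_cpow]
    exact mul_div_mul_comm _ _ _ _
  have hone : LSeries.term c s 1 = 1 := by simp [LSeries.term_of_ne_zero, h1]
  have hprod := EulerProduct.eulerProduct_hasProd hone hmul hs.norm (LSeries.term_zero c s)
  rw [← LSeries] at hprod
  convert hprod using 2 with p
  set x : ℂ := ((p : ℕ) : ℂ) ^ (-s) with hx
  have hpp : (p : ℕ).Prime := p.2
  have hterm : ∀ k : ℕ, LSeries.term c s ((p : ℕ) ^ k) = c ((p : ℕ) ^ k) * x ^ k := fun k => by
    rw [LSeries.term_of_ne_zero (pow_ne_zero k hpp.ne_zero), Nat.cast_pow,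
      ← Complex.natCast_cpow_natCast_mul, mul_comm (k : ℂ), Complex.cpow_mul_nat, hx, Complex.cpow_neg,
      inv_pow, div_eq_mul_inv]
  have hsum : Summable fun k : ℕ => c ((p : ℕ) ^ k) * x ^ k := by
    simp only [← hterm]
    exact hs.comp_injective (Nat.pow_right_injective hpp.two_le)
  simp only [hterm]
  -- the recursion `c (p^(k+2)) = l c (p^(k+1)) - e c (p^k)` sums to a linear equation
  have hs1 := (summable_nat_add_iff 1).2 hsum
  have e1 := hsum.tsum_eq_zero_add
  have e2 := hs1.tsum_eq_zero_add
  have hrec : ∀ k : ℕ, c ((p : ℕ) ^ (k + 1 + 1)) * x ^ (k + 1 + 1) =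
      l p * x * (c ((p : ℕ) ^ (k + 1)) * x ^ (k + 1)) - e p * x ^ 2 * (c ((p : ℕ) ^ k) * x ^ k) :=
    fun k => by
      rw [pow_succ' (p : ℕ) (k + 1), h p hpp, if_pos (dvd_pow_self _ (by omega)), pow_succ' (p : ℕ) k,
        Nat.mul_div_cancel_left _ hpp.pos]
      ring
  have e3 : c ((p : ℕ) ^ (0 + 1)) = l p := by
    have := h p hpp 1
    rw [if_neg hpp.not_dvd_one, h1] at this
    simpa using this
  simp only [hrec] at e2
  rw [(hs1.mul_left _).tsum_sub (hsum.mul_left _), tsum_mul_left, tsum_mul_left, e3] at e2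
  simp only [pow_zero, h1, mul_one] at e1
  refine inv_eq_of_mul_eq_one_right ?_
  set S := ∑' k : ℕ, c ((p : ℕ) ^ k) * x ^ k
  set S' := ∑' k : ℕ, c ((p : ℕ) ^ (k + 1)) * x ^ (k + 1)
  linear_combination (1 - l p * x) * e1 + e2
end EulerProductOfRecursion

section Convergence

open Finset

theorem norm_gCoeff_le (n : ℕ) : ‖gCoeff n‖ ≤ ∑ _x ∈ normReps n, (n : ℝ) := by
  have h : |(thetaCoeff n : ℝ)| ≤ ∑ _x ∈ normReps n, (n : ℝ) := by
    rw [thetaCoeff, Int.cast_sum]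
    refine (abs_sum_le_sum_abs _ _).trans (sum_le_sum fun x hx => ?_)
    have h0 : (x.1 : ℝ) ^ 2 + 3 * (x.2 : ℝ) ^ 2 = n := by exact_mod_cast mem_normReps.1 hx
    push_cast
    rw [abs_le]
    constructor <;> nlinarith [sq_nonneg (x.1 : ℝ), sq_nonneg (x.2 : ℝ)]
  have h0 : (0 : ℝ) ≤ ∑ _x ∈ normReps n, (n : ℝ) := sum_nonneg fun _ _ => Nat.cast_nonneg n
  rw [gCoeff]
  split_ifs
  · rw [norm_div, Complex.norm_intCast, Complex.norm_ofNat]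
    linarith [abs_nonneg (thetaCoeff n : ℝ)]
  · simpa using h0

/-- The Dirichlet series of `g` is dominated by the Epstein zeta function of `ℤ²`. -/
theorem summable_norm_gCoeff_mul_rpow {σ : ℝ} (hσ : 2 < σ) :
    Summable fun n : ℕ => ‖gCoeff n‖ * (n : ℝ) ^ (-σ) := by
  have h1 : Summable fun x : ℤ × ℤ => ‖x‖ ^ (-(2 * (σ - 1))) := by
    have h := EisensteinSeries.summable_one_div_norm_rpow (k := 2 * (σ - 1)) (by linarith)
    refine ((finTwoArrowEquiv ℤ).symm.summable_iff.2 h).congr fun x => ?_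
    simp only [Function.comp, finTwoArrowEquiv_symm_apply]
    congr 1
    rw [EisensteinSeries.norm_eq_max_natAbs, Prod.norm_def]
    simp [Int.norm_eq_abs, Nat.cast_natAbs]
  have h2 : Summable fun x : ℤ × ℤ => ((x.1 ^ 2 + 3 * x.2 ^ 2 : ℤ) : ℝ) ^ (1 - σ) := by
    refine h1.of_nonneg_of_le (fun x => Real.rpow_nonneg (by positivity) _) fun x => ?_
    rcases eq_or_ne x 0 with rfl | hx
    · simp [Real.zero_rpow (by linarith : (1 : ℝ) - σ ≠ 0), Real.rpow_nonneg]
    · have hx0 : 0 < ‖x‖ := norm_pos_iff.2 hx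
      rw [show -(2 * (σ - 1)) = 2 * (1 - σ) by ring, Real.rpow_mul hx0.le, Real.rpow_two]
      refine Real.rpow_le_rpow_of_nonpos (by positivity) ?_ (by linarith)
      rw [Prod.norm_def, Int.norm_eq_abs, Int.norm_eq_abs]
      push_cast
      rcases max_choice |(x.1 : ℝ)| |(x.2 : ℝ)| with h | h <;> rw [h, sq_abs] <;>
        nlinarith [sq_nonneg (x.1 : ℝ), sq_nonneg (x.2 : ℝ)]
  have h3 := (h2.hasSum.tsum_fiberwise fun x : ℤ × ℤ => (x.1 ^ 2 + 3 * x.2 ^ 2).toNat).summable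
  refine h3.of_nonneg_of_le (fun n => by positivity) fun n => ?_
  have hset : (fun x : ℤ × ℤ => (x.1 ^ 2 + 3 * x.2 ^ 2).toNat) ⁻¹' {n} = ↑(normReps n) := by
    ext x
    have : 0 ≤ x.1 ^ 2 + 3 * x.2 ^ 2 := by positivity
    simp only [Set.mem_preimage, Set.mem_singleton_iff, mem_coe, mem_normReps]
    omega
  rw [hset, Finset.tsum_subtype' (normReps n) fun x : ℤ × ℤ =>
    ((x.1 ^ 2 + 3 * x.2 ^ 2 : ℤ) : ℝ) ^ (1 - σ)]
  refine (mul_le_mul_of_nonneg_right (norm_gCoeff_le n) (by positivity)).trans ?_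
  rw [sum_mul]
  refine sum_le_sum fun x hx => ?_
  rw [mem_normReps.1 hx, Int.cast_natCast]
  rcases Nat.eq_zero_or_pos n with rfl | hn
  · simp [Real.zero_rpow (by linarith : (1 : ℝ) - σ ≠ 0)]
  · rw [sub_eq_add_neg, Real.rpow_add (by exact_mod_cast hn), Real.rpow_one]

theorem lseriesSummable_gCoeff {s : ℂ} (hs : 2 < s.re) : LSeriesSummable gCoeff s := by
  refine Summable.of_norm_bounded (summable_norm_gCoeff_mul_rpow hs) fun n => ?_
  rcases Nat.eq_zero_or_pos n with rfl | hn
  · simp [gCoeff_zero]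
  · rw [LSeries.norm_term_eq, if_neg hn.ne', Real.rpow_neg (Nat.cast_nonneg n), div_eq_mul_inv]

end Convergence

/-! ### The analytic continuation of `L(g, s)` -/

section AnalyticContinuation

open Filter Topology UpperHalfPlane Asymptotics

/-- The transformation law of `η` on the imaginary axis. -/
theorem eta_I_mul_inv {y : ℝ} (hy : 0 < y) :
    ModularForm.eta (Complex.I * ((y⁻¹ : ℝ) : ℂ)) =
      ((√y : ℝ) : ℂ) * ModularForm.eta (Complex.I * (y : ℂ)) := by
  have hmem : Complex.I * (y : ℂ) ∈ upperHalfPlaneSet := by simpa [upperHalfPlaneSet] using hy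
  have h := ModularForm.eta_comp_eq_csqrt_I_inv hmem
  have hy0 : (y : ℂ) ≠ 0 := by exact_mod_cast hy.ne'
  have e1 : -1 / (Complex.I * (y : ℂ)) = Complex.I * ((y⁻¹ : ℝ) : ℂ) := by
    have := Complex.I_ne_zero
    push_cast
    field_simp
    rw [Complex.I_sq]
  have e2 : Complex.sqrt (Complex.I * (y : ℂ)) = Complex.sqrt Complex.I * ((√y : ℝ) : ℂ) := by
    rw [Complex.sqrt, Complex.sqrt, mul_comm Complex.I, Real.sqrt_eq_rpow, Complex.ofReal_cpow hy.le,
      Complex.cpow_def_of_ne_zero (mul_ne_zero hy0 Complex.I_ne_zero),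
      Complex.cpow_def_of_ne_zero Complex.I_ne_zero, Complex.cpow_def_of_ne_zero hy0,
      Complex.log_ofReal_mul hy Complex.I_ne_zero, ← Complex.exp_add, ← Complex.ofReal_log hy.le]
    congr 1
    push_cast
    ring
  have e3 : Complex.sqrt Complex.I ≠ 0 := by
    rw [Complex.sqrt, Ne, Complex.cpow_eq_zero_iff]
    simp
  simp only [Function.comp, Pi.smul_apply, Pi.mul_apply, smul_eq_mul] at h
  rw [e1, e2] at h
  rw [h]
  field_simp

/-- The restriction of `g` to the imaginary axis, rescaled so that the Fricke involution
`τ ↦ -1 / (12 τ)` becomes `t ↦ 1 / t`. -/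
def gAxis (t : ℝ) : ℂ := (gForm ∘ ofComplex) (Complex.I * ((t / √12 : ℝ) : ℂ))

theorem gAxis_eq {t : ℝ} (ht : 0 < t) : gAxis t =
    ModularForm.eta (Complex.I * ((2 * t / √12 : ℝ) : ℂ)) ^ 3 *
      ModularForm.eta (Complex.I * ((6 * t / √12 : ℝ) : ℂ)) ^ 3 := by
  have : 0 < (Complex.I * ((t / √12 : ℝ) : ℂ)).im := by
    simp only [Complex.I_mul_im, Complex.ofReal_re]
    positivity
  rw [gAxis, gForm_comp_ofComplex this]
  congr 3 <;> (push_cast; ring)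

/-- The Fricke involution exchanges the factors `η(2τ)` and `η(6τ)`. -/
theorem gAxis_one_div {t : ℝ} (ht : 0 < t) : gAxis (1 / t) = ((t ^ (3 : ℝ) : ℝ) : ℂ) * gAxis t := by
  have h12 : (√12 : ℝ) * √12 = 12 := Real.mul_self_sqrt (by norm_num)
  have h12' : (0 : ℝ) < √12 := by positivity
  rw [gAxis_eq (by positivity), gAxis_eq ht]
  have e1 : 2 * (1 / t) / √12 = (6 * t / √12)⁻¹ := by
    field_simp
    nlinarith
  have e2 : 6 * (1 / t) / √12 = (2 * t / √12)⁻¹ := by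
    field_simp
    nlinarith
  rw [e1, e2, eta_I_mul_inv (by positivity), eta_I_mul_inv (by positivity)]
  have e3 : √(6 * t / √12) * √(2 * t / √12) = t := by
    rw [← Real.sqrt_mul (by positivity), Real.sqrt_eq_iff_mul_self_eq (by positivity) ht.le]
    field_simp
    nlinarith
  have e4 : ((√(6 * t / √12) : ℝ) : ℂ) * ((√(2 * t / √12) : ℝ) : ℂ) = (t : ℂ) := by
    exact_mod_cast e3
  rw [show (3 : ℝ) = ((3 : ℕ) : ℝ) by norm_num, Real.rpow_natCast, Complex.ofReal_pow, ← e4]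
  ring

theorem continuousOn_gAxis : ContinuousOn gAxis (Set.Ioi 0) := by
  refine differentiableOn_gForm_comp_ofComplex.continuousOn.comp (by fun_prop) fun t ht => ?_
  have ht' : (0 : ℝ) < t := ht
  change 0 < (Complex.I * ((t / √12 : ℝ) : ℂ)).im
  simp only [Complex.I_mul_im, Complex.ofReal_re]
  positivity

/-- The constant term of `g` vanishes, so that `g` decays exponentially along the imaginary axis. -/
theorem gAxis_isBigO_rpow (r : ℝ) : gAxis =O[atTop] fun t : ℝ => t ^ r := by
  have hdec := exp_decay_sub_atImInfty one_pos periodic_gForm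
    (mdifferentiable_iff.2 differentiableOn_gForm_comp_ofComplex)
    (isBoundedAtImInfty_of_hasSum_qExpansion one_pos hasSum_gForm)
  have h0 : valueAtInfty gForm = 0 := by
    rw [← qExpansion_coeff_zero one_pos analyticAt_cuspFunction_gForm periodic_gForm,
      qExpansion_gForm_coeff, gCoeff_zero]
  simp only [h0, sub_zero] at hdec
  have h12 : (0 : ℝ) < √12 := by positivity
  have htend : Tendsto (fun t : ℝ => ofComplex (Complex.I * ((t / √12 : ℝ) : ℂ))) atTop atImInfty := by
    rw [atImInfty, tendsto_comap_iff]
    refine (tendsto_id.atTop_div_const h12).congr' ?_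
    filter_upwards [eventually_gt_atTop 0] with t ht
    have : 0 < (Complex.I * ((t / √12 : ℝ) : ℂ)).im := by
      simp only [Complex.I_mul_im, Complex.ofReal_re]
      positivity
    simp only [Function.comp, ofComplex_apply_of_im_pos this, ← coe_im, Complex.I_mul_im,
      Complex.ofReal_re, id]
  refine (hdec.comp_tendsto htend).trans ?_
  refine (EventuallyEq.isBigO ?_).trans
    (isLittleO_exp_neg_mul_rpow_atTop (a := 2 * Real.pi / √12) (by positivity) r).isBigO
  filter_upwards [eventually_gt_atTop 0] with t ht
  have : 0 < (Complex.I * ((t / √12 : ℝ) : ℂ)).im := by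
    simp only [Complex.I_mul_im, Complex.ofReal_re]
    positivity
  simp only [Function.comp, ofComplex_apply_of_im_pos this, ← coe_im, Complex.I_mul_im,
    Complex.ofReal_re]
  congr 1
  ring

/-- The functional equation of `g` under the Fricke involution, on the imaginary axis. -/
def gFEPair : WeakFEPair ℂ where
  f := gAxis
  g := gAxis
  k := 3
  ε := 1
  f₀ := 0
  g₀ := 0
  hf_int := continuousOn_gAxis.locallyIntegrableOn measurableSet_Ioi
  hg_int := continuousOn_gAxis.locallyIntegrableOn measurableSet_Ioi
  hk := by norm_num
  hε := one_ne_zero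
  h_feq t ht := by rw [one_mul, smul_eq_mul, gAxis_one_div ht]
  hf_top r := by simpa using gAxis_isBigO_rpow r
  hg_top r := by simpa using gAxis_isBigO_rpow r

theorem isStrongFEPair_gFEPair : IsStrongFEPair gFEPair := ⟨rfl, rfl⟩

/-- The entire function `L(g, s)`, as a Mellin transform divided by its `Γ`-factor. -/
def gLFunction (s : ℂ) : ℂ :=
  gFEPair.Λ s * (2 * (Complex.Gammaℂ s)⁻¹) * ((√12 : ℝ) : ℂ) ^ (-s)

theorem differentiable_gLFunction : Differentiable ℂ gLFunction := by
  have h1 := isStrongFEPair_gFEPair.differentiable_Λ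
  have h2 : Differentiable ℂ fun s => 2 * (Complex.Gammaℂ s)⁻¹ := by fun_prop
  have h3 : Differentiable ℂ fun s : ℂ => ((√12 : ℝ) : ℂ) ^ (-s) := by
    have : ((√12 : ℝ) : ℂ) ≠ 0 := by
      rw [Complex.ofReal_ne_zero]
      positivity
    exact fun s => (differentiableAt_id.neg).const_cpow (Or.inl this)
  exact (h1.mul h2).mul h3

/-- Term by term, the Mellin transform of `gAxis` is the Dirichlet series of `g` times
`(√12)^s (2 π)^(-s) Γ(s)`, and `Gammaℂ s = 2 (2 π)^(-s) Γ(s)`. -/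
theorem lseriesHasSum_gCoeff {s : ℂ} (hs : 2 < s.re) : LSeriesHasSum gCoeff s (gLFunction s) := by
  have hs0 : 0 < s.re := by linarith
  have h12 : (0 : ℝ) < √12 := by positivity
  have hmell : HasSum (fun n : ℕ => (Real.pi : ℂ) ^ (-s) * Complex.Gamma s * gCoeff n /
      ((2 * n / √12 : ℝ) : ℂ) ^ s) (mellin gAxis s) := by
    refine hasSum_mellin_pi_mul₀ (fun n => by positivity) hs0 ?_ ?_
    · intro t ht
      have ht' : (0 : ℝ) < t := ht
      have him : 0 < (Complex.I * ((t / √12 : ℝ) : ℂ)).im := by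
        simp only [Complex.I_mul_im, Complex.ofReal_re]
        positivity
      have h := hasSum_gForm ⟨_, him⟩
      rw [gAxis, Function.comp, ofComplex_apply_of_im_pos him]
      convert h using 1
      funext n
      rcases Nat.eq_zero_or_pos n with rfl | hn
      · simp [gCoeff_zero]
      · have : (2 * n / √12 : ℝ) ≠ 0 := by positivity
        rw [if_neg this, smul_eq_mul, Function.Periodic.qParam, ← Complex.exp_nat_mul,
          Complex.ofReal_exp]
        congr 2
        push_cast
        linear_combination (-2 * Real.pi * n * t / √12 : ℂ) * Complex.I_sq
    · have h := (summable_norm_gCoeff_mul_rpow hs).mul_right ((2 / √12 : ℝ) ^ (-s.re))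
      refine h.congr fun n => ?_
      rw [mul_assoc, ← Real.mul_rpow (Nat.cast_nonneg n) (by positivity), Real.rpow_neg (by positivity),
        ← div_eq_mul_inv]
      congr 2
      ring
  have hΛ : gFEPair.Λ s = mellin gAxis s := congrFun isStrongFEPair_gFEPair.Λ_eq s
  rw [← hΛ] at hmell
  have hres := (hmell.mul_right (2 * (Complex.Gammaℂ s)⁻¹)).mul_right (((√12 : ℝ) : ℂ) ^ (-s))
  rw [LSeriesHasSum]
  suffices key : LSeries.term gCoeff s = fun n : ℕ => (Real.pi : ℂ) ^ (-s) * Complex.Gamma s *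
      gCoeff n / ((2 * n / √12 : ℝ) : ℂ) ^ s * (2 * (Complex.Gammaℂ s)⁻¹) *
        ((√12 : ℝ) : ℂ) ^ (-s) by
    rw [key]
    exact hres
  funext n
  rcases Nat.eq_zero_or_pos n with rfl | hn
  · simp [gCoeff_zero]
  rw [LSeries.term_of_ne_zero hn.ne', Complex.Gammaℂ]
  have e1 : ((2 * n / √12 : ℝ) : ℂ) ^ s = 2 ^ s * n ^ s / ((√12 : ℝ) : ℂ) ^ s := by
    rw [Complex.ofReal_div, Complex.div_cpow_ofReal_nonneg (by positivity) (by positivity),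
      Complex.ofReal_mul, Complex.mul_cpow_ofReal_nonneg (by positivity) (by positivity)]
    push_cast
    rfl
  have e2 : (2 * (Real.pi : ℂ)) ^ (-s) = 2 ^ (-s) * (Real.pi : ℂ) ^ (-s) := by
    rw [← Complex.ofReal_ofNat, Complex.mul_cpow_ofReal_nonneg (by positivity) Real.pi_pos.le]
  have hG := Complex.Gamma_ne_zero_of_re_pos hs0
  have hπ : (Real.pi : ℂ) ^ s ≠ 0 := by
    rw [Ne, Complex.cpow_eq_zero_iff]
    simp [Real.pi_ne_zero]
  have hn0 : (n : ℂ) ^ s ≠ 0 := by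
    rw [Ne, Complex.cpow_eq_zero_iff]
    simp [hn.ne']
  have h12' : ((√12 : ℝ) : ℂ) ^ s ≠ 0 := by
    rw [Ne, Complex.cpow_eq_zero_iff]
    simp [h12.ne']
  have h2 : (2 : ℂ) ^ s ≠ 0 := by
    rw [Ne, Complex.cpow_eq_zero_iff]
    simp
  rw [e1, e2]
  simp only [Complex.cpow_neg]
  field_simp

theorem isCuspLFunction_gLFunction : IsCuspLFunction gForm gLFunction where
  entire := differentiable_gLFunction
  dirichletSeries s hs := by
    simpa only [qExpansion_gForm_coeff] using lseriesHasSum_gCoeff hs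

end AnalyticContinuation

/-! ### The symmetric square of a rank two lattice with a rotation -/

section PadicLattices

variable {ℓ : ℕ} [Fact ℓ.Prime] {M : Type*} [AddCommGroup M] [Module ℤ_[ℓ] M]

/-- Two elements that generate a separated `ℤ_ℓ`-module modulo `ℓ` generate it. -/
theorem exists_eq_smul_add_smul {e f : M}
    (hsep : ∀ x : M, (∀ n : ℕ, ∃ y, x = (ℓ : ℤ_[ℓ]) ^ n • y) → x = 0)
    (hdec : ∀ x : M, ∃ a b : ℤ_[ℓ], ∃ y, x = a • e + b • f + (ℓ : ℤ_[ℓ]) • y) (x : M) :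
    ∃ a b : ℤ_[ℓ], x = a • e + b • f := by
  choose a b r hr using hdec
  -- the digits of the coefficients
  have hx : ∀ n : ℕ, x = (∑ i ∈ Finset.range n, a (r^[i] x) * (ℓ : ℤ_[ℓ]) ^ i) • e +
      (∑ i ∈ Finset.range n, b (r^[i] x) * (ℓ : ℤ_[ℓ]) ^ i) • f + (ℓ : ℤ_[ℓ]) ^ n • r^[n] x := by
    intro n
    induction n with
    | zero => simp
    | succ n ih =>
      rw [Finset.sum_range_succ, Finset.sum_range_succ, Function.iterate_succ_apply']
      conv_lhs => rw [ih, hr (r^[n] x)]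
      module
  have hℓ : ‖(ℓ : ℤ_[ℓ])‖ < 1 := by
    rw [PadicInt.norm_p]
    exact inv_lt_one_of_one_lt₀ (by exact_mod_cast (Fact.out : ℓ.Prime).one_lt)
  have hsum : ∀ u : ℕ → ℤ_[ℓ], Summable fun i => u i * (ℓ : ℤ_[ℓ]) ^ i := fun u => by
    refine (summable_geometric_of_lt_one (norm_nonneg _) hℓ).of_norm_bounded fun i => ?_
    rw [norm_mul, norm_pow]
    exact mul_le_of_le_one_left (by positivity) (PadicInt.norm_le_one _)
  have hsplit : ∀ (u : ℕ → ℤ_[ℓ]) (n : ℕ), ∑' i, u i * (ℓ : ℤ_[ℓ]) ^ i =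
      ∑ i ∈ Finset.range n, u i * (ℓ : ℤ_[ℓ]) ^ i +
        (ℓ : ℤ_[ℓ]) ^ n * ∑' i, u (i + n) * (ℓ : ℤ_[ℓ]) ^ i := fun u n => by
    rw [← (hsum u).sum_add_tsum_nat_add n, ← (hsum fun i => u (i + n)).tsum_mul_left]
    congr 2
    funext i
    ring
  refine ⟨∑' i, a (r^[i] x) * (ℓ : ℤ_[ℓ]) ^ i, ∑' i, b (r^[i] x) * (ℓ : ℤ_[ℓ]) ^ i, ?_⟩
  rw [← sub_eq_zero]
  refine hsep _ fun n => ⟨r^[n] x - (∑' i, a (r^[i + n] x) * (ℓ : ℤ_[ℓ]) ^ i) • e -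
    (∑' i, b (r^[i + n] x) * (ℓ : ℤ_[ℓ]) ^ i) • f, ?_⟩
  rw [hsplit (fun i => a (r^[i] x)) n, hsplit (fun i => b (r^[i] x)) n]
  have hxn := hx n
  linear_combination (norm := module) hxn

/-- The form `a² - c a b + b²` is anisotropic over `ℤ_ℓ` for `ℓ = c + 2`, because it is
`(a + b)² - ℓ a b`. -/
theorem PadicInt.eq_zero_of_norm_form {c : ℕ} (hc : ℓ = c + 2) {a b : ℤ_[ℓ]}
    (h : a ^ 2 - c * a * b + b ^ 2 = 0) : a = 0 ∧ b = 0 := by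
  have hp : Prime (ℓ : ℤ_[ℓ]) := PadicInt.prime_p
  have hℓ : (ℓ : ℤ_[ℓ]) = c + 2 := by
    exact_mod_cast congrArg (Nat.cast : ℕ → ℤ_[ℓ]) hc
  have key : ∀ n : ℕ, ∀ a b : ℤ_[ℓ], a ^ 2 - c * a * b + b ^ 2 = 0 →
      (ℓ : ℤ_[ℓ]) ^ n ∣ a ∧ (ℓ : ℤ_[ℓ]) ^ n ∣ b := by
    intro n
    induction n with
    | zero => simp
    | succ n ih =>
      intro a b h
      have h1 : (a + b) ^ 2 = ℓ * (a * b) := by rw [hℓ]; linear_combination h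
      obtain ⟨m, hm⟩ := hp.dvd_of_dvd_pow (Dvd.intro _ h1.symm)
      have h2 : a * b = ℓ * m ^ 2 := by
        refine mul_left_cancel₀ hp.ne_zero ?_
        rw [← h1, hm]
        ring
      have hab : (ℓ : ℤ_[ℓ]) ∣ a ∧ (ℓ : ℤ_[ℓ]) ∣ b := by
        rcases hp.dvd_or_dvd (Dvd.intro _ h2.symm) with hd | hd
        · exact ⟨hd, (dvd_add_right hd).1 (Dvd.intro _ hm.symm)⟩
        · exact ⟨(dvd_add_left hd).1 (Dvd.intro _ hm.symm), hd⟩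
      obtain ⟨⟨a', rfl⟩, b', rfl⟩ := hab
      obtain ⟨ha, hb⟩ := ih a' b' (mul_left_cancel₀ (pow_ne_zero 2 hp.ne_zero)
        (by linear_combination h))
      rw [pow_succ']
      exact ⟨mul_dvd_mul_left _ ha, mul_dvd_mul_left _ hb⟩
  have hzero : ∀ x : ℤ_[ℓ], (∀ n : ℕ, (ℓ : ℤ_[ℓ]) ^ n ∣ x) → x = 0 := fun x hx => by
    by_contra hx0
    have h1 := (PadicInt.norm_le_pow_iff_mem_span_pow x (x.valuation + 1)).2
      (Ideal.mem_span_singleton.2 (hx _))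
    have h2 := (PadicInt.norm_le_pow_iff_le_valuation x hx0 _).1 h1
    omega
  exact ⟨hzero a fun n => (key n a b h).1, hzero b fun n => (key n a b h).2⟩

variable {G : Type*} [Group G]

/-- The symmetric square of a two-dimensional representation on which inertia acts through a
cyclic group of rotations `J`, with `J² + c J + 1 = 0`, that is inverted by `φ`, where
`φ² = -p`. The invariant forms are the multiples of the norm form `a² - c a b + b²` of `ℤ_ℓ[J]`;
if `φ e = (a + b J) e`, then `φ² e = (a² - c a b + b²) e`, so that `φ` multiplies them by `-p`. -/
theorem symSqDet_of_rotation (c : ℕ) (hc : ℓ = c + 2)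
    (htf : ∀ (a : ℤ_[ℓ]) (x : M), a • x = 0 → a = 0 ∨ x = 0)
    (ρ : G →* Module.End ℤ_[ℓ] M) (I : Subgroup G) [I.Normal] {φ σ₀ : G} (p : ℕ) (hσ₀ : σ₀ ∈ I)
    (hI : ∀ σ ∈ I, ∃ k : ℕ, ρ σ = ρ σ₀ ^ k)
    (hJ : ∀ x, ρ σ₀ (ρ σ₀ x) + (c : ℤ_[ℓ]) • ρ σ₀ x + x = 0)
    (hφJ : ∀ x, ρ σ₀ (ρ φ (ρ σ₀ x)) = ρ φ x) (hφ : ∀ x, ρ φ (ρ φ x) = -((p : ℤ_[ℓ]) • x))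
    {e : M} (he : e ≠ 0) (hspan : ∀ x, ∃ a b : ℤ_[ℓ], x = a • e + b • ρ σ₀ e) (t : ℚ_[ℓ]) :
    symSqDet ℚ_[ℓ] ρ I φ t = 1 + p * t := by
  set J := ρ σ₀ with hJdef
  have hJ2 : ∀ x, J (J x) = -((c : ℤ_[ℓ]) • J x) - x := fun x => by
    rw [eq_sub_iff_add_eq, eq_neg_iff_add_eq_zero, ← hJ x]
    abel
  -- `e` and `J e` form a basis
  have hindep : ∀ a b : ℤ_[ℓ], a • e + b • J e = 0 → a = 0 ∧ b = 0 := fun a b h => by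
    refine PadicInt.eq_zero_of_norm_form hc ?_
    have h2 : a • J e + b • J (J e) = 0 := by
      rw [← map_smul, ← map_smul, ← map_add, h, map_zero]
    rw [hJ2] at h2
    have h3 : (a ^ 2 - c * a * b + b ^ 2) • e = 0 := by
      have e1 : (a ^ 2 - c * a * b + b ^ 2) • e = (a - c * b) • (a • e + b • J e) -
          b • (a • J e + b • (-((c : ℤ_[ℓ]) • J e) - e)) := by module
      rw [e1, h, h2, smul_zero, smul_zero, sub_zero]
    exact (htf _ _ h3).resolve_right he
  have hli : LinearIndependent ℤ_[ℓ] ![e, J e] :=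
    LinearIndependent.pair_iff.2 fun a b h => hindep a b h
  have hsp : ⊤ ≤ Submodule.span ℤ_[ℓ] (Set.range ![e, J e]) := by
    intro x _
    obtain ⟨a, b, rfl⟩ := hspan x
    exact Submodule.add_mem _
      (Submodule.smul_mem _ _ (Submodule.subset_span ⟨0, rfl⟩))
      (Submodule.smul_mem _ _ (Submodule.subset_span ⟨1, rfl⟩))
  set β := Module.Basis.mk hli hsp with hβ
  -- an invariant form is determined by its value at `(e, e)`
  have hval : ∀ B : symSqInvariants ℚ_[ℓ] ρ I, ∀ a b : ℤ_[ℓ],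
      B.1 (a • e + b • J e) (a • e + b • J e) =
        ((a ^ 2 - c * a * b + b ^ 2 : ℤ_[ℓ]) : ℚ_[ℓ]) * B.1 e e := fun B a b => by
    have hsymm := B.2.1 (J e) e
    have h1 : B.1 (J e) (J e) = B.1 e e := B.2.2 σ₀ hσ₀ e e
    have h2 : B.1 (J e) (J (J e)) = B.1 e (J e) := B.2.2 σ₀ hσ₀ e (J e)
    rw [hJ2] at h2
    simp only [map_sub, map_neg, map_smul, Algebra.smul_def, h1, hsymm] at h2
    simp only [map_add, map_smul, LinearMap.add_apply, LinearMap.smul_apply, Algebra.smul_def, h1,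
      hsymm]
    simp only [PadicInt.algebraMap_apply] at h2 ⊢
    push_cast at h2 ⊢
    linear_combination (-(a * b : ℚ_[ℓ])) * h2
  have hpol : ∀ B C : symSqInvariants ℚ_[ℓ] ρ I, B.1 e e = C.1 e e → B = C := fun B C h => by
    have hdiag : ∀ x, B.1 x x = C.1 x x := fun x => by
      obtain ⟨a, b, rfl⟩ := hspan x
      rw [hval, hval, h]
    refine Subtype.ext (LinearMap.ext fun x => LinearMap.ext fun y => ?_)
    have h1 := hdiag (x + y)
    simp only [map_add, LinearMap.add_apply, hdiag x, hdiag y, B.2.1 y x, C.2.1 y x] at h1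
    linear_combination h1 / 2
  -- the norm form itself
  set coord : Fin 2 → M →ₗ[ℤ_[ℓ]] ℚ_[ℓ] := fun i =>
    (Algebra.linearMap ℤ_[ℓ] ℚ_[ℓ]).comp (β.coord i) with hcoord
  have hcoord_apply : ∀ i x, coord i x = ((β.repr x i : ℤ_[ℓ]) : ℚ_[ℓ]) := fun _ _ => rfl
  have hβ0 : β 0 = e := by rw [hβ, Module.Basis.mk_apply]; rfl
  have hβ1 : β 1 = J e := by rw [hβ, Module.Basis.mk_apply]; rfl
  have hc0 : ∀ a b : ℤ_[ℓ], coord 0 (a • e + b • J e) = a := fun a b => by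
    rw [hcoord_apply, ← hβ1, ← hβ0]
    simp
  have hc1 : ∀ a b : ℤ_[ℓ], coord 1 (a • e + b • J e) = b := fun a b => by
    rw [hcoord_apply, ← hβ1, ← hβ0]
    simp
  set prod : Fin 2 → Fin 2 → M →ₗ[ℤ_[ℓ]] M →ₗ[ℤ_[ℓ]] ℚ_[ℓ] := fun i j =>
    (LinearMap.mul ℤ_[ℓ] ℚ_[ℓ]).compl₁₂ (coord i) (coord j) with hprod
  have hprod_apply : ∀ i j x y, prod i j x y = coord i x * coord j y := fun _ _ _ _ => rfl
  set N : M →ₗ[ℤ_[ℓ]] M →ₗ[ℤ_[ℓ]] ℚ_[ℓ] := prod 0 0 + prod 1 1 -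
    ((c : ℚ_[ℓ]) / 2) • (prod 0 1 + prod 1 0) with hN
  have hN_apply : ∀ x y, N x y = coord 0 x * coord 0 y + coord 1 x * coord 1 y -
      (c : ℚ_[ℓ]) / 2 * (coord 0 x * coord 1 y + coord 1 x * coord 0 y) := fun _ _ => rfl
  have hNJ : ∀ x y, N (J x) (J y) = N x y := fun x y => by
    obtain ⟨a, b, rfl⟩ := hspan x
    obtain ⟨a', b', rfl⟩ := hspan y
    have hJx : ∀ a b : ℤ_[ℓ], J (a • e + b • J e) = (-b) • e + (a - c * b) • J e := fun a b => by
      rw [map_add, map_smul, map_smul, hJ2]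
      module
    rw [hJx, hJx, hN_apply, hN_apply]
    simp only [hc0, hc1]
    push_cast
    ring
  have hNpow : ∀ (k : ℕ) x y, N ((J ^ k) x) ((J ^ k) y) = N x y := fun k => by
    induction k with
    | zero => intro x y; rfl
    | succ k ih =>
      intro x y
      rw [pow_succ', Module.End.mul_apply, Module.End.mul_apply, hNJ, ih]
  have hNmem : N ∈ symSqInvariants ℚ_[ℓ] ρ I := by
    refine ⟨fun x y => ?_, fun σ hσ x y => ?_⟩
    · rw [hN_apply, hN_apply]
      ring
    · obtain ⟨k, hk⟩ := hI σ hσ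
      rw [hk]
      exact hNpow k x y
  have hNe : N e e = 1 := by
    have h0 := hc0 1 0
    have h1 := hc1 1 0
    rw [one_smul, zero_smul, add_zero] at h0 h1
    rw [hN_apply, h0, h1]
    simp
  have hfin : Module.finrank ℚ_[ℓ] (symSqInvariants ℚ_[ℓ] ρ I) = 1 := by
    refine finrank_eq_one (⟨N, hNmem⟩ : symSqInvariants ℚ_[ℓ] ρ I) ?_ fun B =>
      ⟨B.1 e e, hpol _ _ ?_⟩
    · intro h
      have h2 : N = 0 := congrArg Subtype.val h
      rw [h2] at hNe
      simp at hNe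
    · change B.1 e e * N e e = B.1 e e
      rw [hNe, mul_one]
  -- `φ e = (a + b J) e` and `φ² e = -p e` give `a² - c a b + b² = -p`
  obtain ⟨a, b, hab⟩ := hspan (ρ φ e)
  have hφJe : ρ φ (J e) = -((c : ℤ_[ℓ]) • ρ φ e) - J (ρ φ e) := by
    have h1 := hφJ e
    have h2 := hJ2 (ρ φ (J e))
    have h3 : J (J (ρ φ (J e))) = J (ρ φ e) := by rw [h1]
    rw [h3, h1] at h2
    rw [h2]
    abel
  have hnorm : a ^ 2 - c * a * b + b ^ 2 = -(p : ℤ_[ℓ]) := by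
    have h1 := hφ e
    conv_lhs at h1 => rw [hab, map_add, map_smul, map_smul, hφJe, hab, map_add, map_smul, map_smul,
      hJ2]
    have h2 : (a ^ 2 - c * a * b + b ^ 2 + p) • e = 0 := by
      rw [← sub_eq_zero] at h1
      rw [← h1]
      module
    exact eq_neg_of_add_eq_zero_left ((htf _ _ h2).resolve_right he)
  have hscal : symSqPullback ℚ_[ℓ] ρ I φ = (-(p : ℚ_[ℓ])) • LinearMap.id := by
    refine LinearMap.ext fun B => hpol _ _ ?_
    change B.1 (ρ φ e) (ρ φ e) = -(p : ℚ_[ℓ]) * B.1 e e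
    rw [hab, hval, hnorm]
    push_cast
    rfl
  rw [symSqDet, hscal, smul_smul]
  have : (LinearMap.id : symSqInvariants ℚ_[ℓ] ρ I →ₗ[ℚ_[ℓ]] symSqInvariants ℚ_[ℓ] ρ I) -
      (t * -(p : ℚ_[ℓ])) • LinearMap.id = (1 + p * t) • LinearMap.id := by
    module
  rw [this, LinearMap.det_smul, hfin, LinearMap.det_id, pow_one, mul_one]

end PadicLattices

/-! ### Tate modules of divisible groups -/

section TateModules

variable {ℓ : ℕ} {A : Type*} [AddCommGroup A]

/-- `P` is killed by a power of `ℓ`. -/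
def IsPowTorsion (ℓ : ℕ) (P : A) : Prop := ∃ n : ℕ, ℓ ^ n • P = 0

theorem IsPowTorsion.of_smul {P : A} (h : IsPowTorsion ℓ (ℓ • P)) : IsPowTorsion ℓ P := by
  obtain ⟨n, hn⟩ := h
  exact ⟨n + 1, by rw [pow_succ, mul_smul, hn]⟩

theorem IsPowTorsion.map {B : Type*} [AddCommGroup B] {P : A} (h : IsPowTorsion ℓ P) (f : A →+ B) :
    IsPowTorsion ℓ (f P) := by
  obtain ⟨n, hn⟩ := h
  exact ⟨n, by rw [← map_nsmul, hn, map_zero]⟩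

theorem IsPowTorsion.neg {P : A} (h : IsPowTorsion ℓ P) : IsPowTorsion ℓ (-P) := by
  obtain ⟨n, hn⟩ := h
  exact ⟨n, by rw [smul_neg, hn, neg_zero]⟩

theorem IsPowTorsion.add {P Q : A} (hP : IsPowTorsion ℓ P) (hQ : IsPowTorsion ℓ Q) :
    IsPowTorsion ℓ (P + Q) := by
  obtain ⟨n, hn⟩ := hP
  obtain ⟨m, hm⟩ := hQ
  refine ⟨n + m, ?_⟩
  rw [smul_add, pow_add, mul_smul _ _ Q, hm, mul_comm, mul_smul, hn, smul_zero, smul_zero, add_zero]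

theorem IsPowTorsion.nsmul {P : A} (hP : IsPowTorsion ℓ P) (k : ℕ) : IsPowTorsion ℓ (k • P) := by
  obtain ⟨n, hn⟩ := hP
  exact ⟨n, by rw [smul_comm, hn, smul_zero]⟩

namespace TateModule

theorem isPowTorsion_apply (x : TateModule ℓ A) (n : ℕ) : IsPowTorsion ℓ (x.1 n) :=
  ⟨n, pow_smul_apply x n⟩

theorem pow_smul_apply_add (x : TateModule ℓ A) (n k : ℕ) : ℓ ^ k • x.1 (n + k) = x.1 n := by
  induction k with
  | zero => simp
  | succ k ih => rw [pow_succ, mul_smul, ← add_assoc, x.2.2, ih]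

/-- Over an `ℓ`-divisible group every `ℓ`-torsion point is the first entry of an element of the
Tate module. -/
theorem exists_apply_one_eq (hdiv : ∀ P : A, ∃ R, ℓ • R = P) {P : A} (hP : ℓ • P = 0) :
    ∃ x : TateModule ℓ A, x.1 1 = P := by
  choose d hd using hdiv
  refine ⟨⟨fun n => match n with
    | 0 => 0
    | n + 1 => d^[n] P, rfl, fun n => ?_⟩, rfl⟩
  rcases n with _ | n
  · exact hP
  · change ℓ • d^[n + 1] P = d^[n] P
    rw [Function.iterate_succ_apply', hd]

/-- An element of the Tate module with vanishing first entry is `ℓ` times its shift. -/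
theorem exists_smul_eq {x : TateModule ℓ A} (h : x.1 1 = 0) : ∃ y : TateModule ℓ A, x = ℓ • y :=
  ⟨⟨fun n => x.1 (n + 1), h, fun n => x.2.2 (n + 1)⟩,
    Subtype.ext (funext fun n => (x.2.2 n).symm)⟩

theorem eq_zero_of_pow_smul_eq_zero {x : TateModule ℓ A} {k : ℕ} (h : ℓ ^ k • x = 0) : x = 0 :=
  Subtype.ext (funext fun n => by
    have h1 : ℓ ^ k • x.1 (n + k) = 0 := congrFun (congrArg Subtype.val h) (n + k)
    rwa [pow_smul_apply_add] at h1)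

theorem eq_zero_of_forall_pow_smul {x : TateModule ℓ A}
    (h : ∀ n : ℕ, ∃ y : TateModule ℓ A, x = ℓ ^ n • y) : x = 0 :=
  Subtype.ext (funext fun n => by
    obtain ⟨y, rfl⟩ := h n
    exact pow_smul_apply y n)

variable [Fact ℓ.Prime]

theorem smul_eq_zero_or {a : ℤ_[ℓ]} {x : TateModule ℓ A} (h : a • x = 0) : a = 0 ∨ x = 0 := by
  refine or_iff_not_imp_left.2 fun ha => ?_
  have h1 := PadicInt.unitCoeff_spec ha
  refine eq_zero_of_pow_smul_eq_zero (k := a.valuation) ?_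
  have h2 : (PadicInt.unitCoeff ha : ℤ_[ℓ]) • ((ℓ : ℤ_[ℓ]) ^ a.valuation • x) = 0 := by
    rw [← mul_smul, ← h1, h]
  have h3 : (ℓ : ℤ_[ℓ]) ^ a.valuation • x = 0 := by
    have := congrArg (fun y => (((PadicInt.unitCoeff ha)⁻¹ : ℤ_[ℓ]ˣ) : ℤ_[ℓ]) • y) h2
    simpa [← mul_smul] using this
  rw [← h3, ← Nat.cast_smul_eq_nsmul ℤ_[ℓ]]
  push_cast
  rfl

end TateModule

variable [Fact ℓ.Prime] {G : Type*} [Group G]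

/-- The symmetric square of the Tate module of an `ℓ`-divisible group `A` on whose `ℓ`-power torsion
inertia acts through powers of `J`, with `J² + c J + 1 = 0` and `ℓ = c + 2`. If the fixed points
of `J` form a cyclic group `⟨Q⟩ ≠ 0`, then `T_ℓ A` is generated by `e` and `J e`, where the
first entry `P` of `e` satisfies `P - J P = Q`. -/
theorem symSqDet_tateModule (c : ℕ) (hc : ℓ = c + 2) (act : G → A →+ A)
    (ρ : G →* Module.End ℤ_[ℓ] (TateModule ℓ A)) (hρ : ∀ σ, ρ σ = TateModule.map (act σ))
    (I : Subgroup G) [I.Normal] {φ σ₀ : G} (p : ℕ) (hσ₀ : σ₀ ∈ I)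
    (hdiv : ∀ P : A, ∃ R, ℓ • R = P)
    (hI : ∀ σ ∈ I, ∃ k : ℕ, ∀ P, IsPowTorsion ℓ P → act σ P = (act σ₀)^[k] P)
    (hJ : ∀ P, IsPowTorsion ℓ P → act σ₀ (act σ₀ P) + c • act σ₀ P + P = 0)
    (hφJ : ∀ P, IsPowTorsion ℓ P → act σ₀ (act φ (act σ₀ P)) = act φ P)
    (hφ : ∀ P, IsPowTorsion ℓ P → act φ (act φ P) = -(p • P))
    {Q : A} (hQ0 : Q ≠ 0) (hQt : IsPowTorsion ℓ Q) (hJQ : act σ₀ Q = Q)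
    (hker : ∀ P, IsPowTorsion ℓ P → act σ₀ P = P → ∃ k : ℤ, P = k • Q) (t : ℚ_[ℓ]) :
    symSqDet ℚ_[ℓ] ρ I φ t = 1 + p * t := by
  set J := act σ₀ with hJdef
  have hℓ : ∀ P : A, ℓ • P = c • P + P + P := fun P => by
    rw [hc, add_smul, two_smul, add_assoc]
  have hQℓ : ℓ • Q = 0 := by
    have h := hJ Q hQt
    rw [hJQ, hJQ] at h
    rw [hℓ, ← h]
    abel
  obtain ⟨R, hR⟩ := hdiv Q
  have hRt : IsPowTorsion ℓ R := IsPowTorsion.of_smul (hR ▸ hQt)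
  -- `P = (c + 1 + J) R`, since `(1 - J) (c + 1 + J) = c + 2 = ℓ` by the equation of `J`
  set P := c • R + R + J R with hP
  have hPQ : P - J P = Q := by
    have h := hJ R hRt
    rw [hP, ← hR, hℓ]
    simp only [map_add, map_nsmul]
    rw [← sub_eq_zero, ← neg_eq_zero, ← h]
    abel
  have hPℓ : ℓ • P = 0 := by
    rw [hP, smul_add, smul_add, smul_comm, ← map_nsmul, hR, hJQ, ← hℓ, hQℓ]
  -- the `ℓ`-torsion is generated by `P` and `J P`
  have htors : ∀ X : A, ℓ • X = 0 → ∃ a b : ℤ, X = a • P + b • J P := fun X hX => by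
    have hXt : IsPowTorsion ℓ X := ⟨1, by rwa [pow_one]⟩
    have hfix : J (X - J X) = X - J X := by
      have h := hJ X hXt
      have h1 : ℓ • J X = 0 := by rw [← map_nsmul, hX, map_zero]
      rw [hℓ] at h1
      rw [map_sub]
      linear_combination (norm := module) h1 - h
    have hsubt : IsPowTorsion ℓ (X - J X) := sub_eq_add_neg X (J X) ▸ hXt.add (hXt.map J).neg
    obtain ⟨k, hk⟩ := hker _ hsubt hfix
    have hZ : J (X - k • P) = X - k • P := by
      have h1 : X - J X = k • (P - J P) := by rw [hPQ, hk]
      rw [map_sub, map_zsmul, ← sub_eq_zero, ← neg_eq_zero, ← sub_eq_zero.2 h1, smul_sub]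
      abel
    have hZt : IsPowTorsion ℓ (X - k • P) := ⟨1, by
      rw [pow_one, smul_sub, hX, smul_comm, hPℓ, smul_zero, sub_zero]⟩
    obtain ⟨m, hm⟩ := hker _ hZt hZ
    refine ⟨k + m, -m, ?_⟩
    rw [sub_eq_iff_eq_add.1 hm, ← hPQ, smul_sub, add_smul, neg_smul]
    abel
  have hP0 : P ≠ 0 := by
    intro h
    rw [h, map_zero, sub_zero] at hPQ
    exact hQ0 hPQ.symm
  obtain ⟨e, he⟩ := TateModule.exists_apply_one_eq hdiv hPℓ
  have he0 : e ≠ 0 := by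
    rintro rfl
    exact hP0 he.symm
  have happ : ∀ (σ : G) (x : TateModule ℓ A) (n : ℕ), (ρ σ x).1 n = act σ (x.1 n) := fun σ x n => by
    rw [hρ]
    rfl
  have htor : ∀ (x : TateModule ℓ A) (n : ℕ), IsPowTorsion ℓ (x.1 n) :=
    TateModule.isPowTorsion_apply
  refine symSqDet_of_rotation c hc (fun a x h => TateModule.smul_eq_zero_or h) ρ I p hσ₀
    (fun σ hσ => ?_) (fun x => Subtype.ext (funext fun n => ?_))
    (fun x => Subtype.ext (funext fun n => ?_)) (fun x => Subtype.ext (funext fun n => ?_)) he0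
    (exists_eq_smul_add_smul (fun x hx => ?_) (fun x => ?_)) t
  · obtain ⟨k, hk⟩ := hI σ hσ
    refine ⟨k, LinearMap.ext fun x => Subtype.ext (funext fun n => ?_)⟩
    rw [happ, hk _ (htor x n)]
    clear hk
    induction k with
    | zero => rfl
    | succ k ih => rw [Function.iterate_succ_apply', ih, pow_succ', Module.End.mul_apply, happ]
  · rw [Nat.cast_smul_eq_nsmul]
    change (ρ σ₀ (ρ σ₀ x)).1 n + c • (ρ σ₀ x).1 n + x.1 n = 0
    rw [happ, happ]
    exact hJ _ (htor x n)
  · rw [happ, happ, happ, happ]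
    exact hφJ _ (htor x n)
  · rw [Nat.cast_smul_eq_nsmul]
    change (ρ φ (ρ φ x)).1 n = -(p • x.1 n)
    rw [happ, happ]
    exact hφ _ (htor x n)
  · refine TateModule.eq_zero_of_forall_pow_smul fun n => ?_
    obtain ⟨y, hy⟩ := hx n
    refine ⟨y, hy.trans ?_⟩
    rw [← Nat.cast_smul_eq_nsmul ℤ_[ℓ]]
    push_cast
    rfl
  · obtain ⟨a, b, hab⟩ := htors (x.1 1) (by simpa using TateModule.pow_smul_apply x 1)
    have h1 : (x - (a • e + b • ρ σ₀ e)).1 1 = 0 := by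
      change x.1 1 - (a • e.1 1 + b • (ρ σ₀ e).1 1) = 0
      rw [happ, he, hab, sub_self]
    obtain ⟨y, hy⟩ := TateModule.exists_smul_eq h1
    refine ⟨a, b, y, ?_⟩
    rw [Int.cast_smul_eq_zsmul, Int.cast_smul_eq_zsmul, Nat.cast_smul_eq_nsmul, ← hy]
    abel

end TateModules

/-! ### Residue fields and Frobenius elements -/

theorem norm_le_one_of_norm_pow_le_one {K : Type*} [NormedField K] {x : K} {n : ℕ} (hn : n ≠ 0)
    (h : ‖x ^ n‖ ≤ 1) : ‖x‖ ≤ 1 := by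
  rw [norm_pow] at h
  exact (pow_le_one_iff_of_nonneg (norm_nonneg _) hn).1 h

section ResidueField

variable (K : Type*) [NormedField K] [IsUltrametricDist K]

/-- The valuation ring `{x | ‖x‖ ≤ 1}` of an ultrametric normed field. -/
def unitBall : Subring K where
  carrier := {x | ‖x‖ ≤ 1}
  mul_mem' {x y} hx hy := by
    rw [Set.mem_ofPred_eq] at *
    rw [norm_mul]
    exact mul_le_one₀ hx (norm_nonneg _) hy
  one_mem' := by simp
  add_mem' {x y} hx hy := (IsUltrametricDist.norm_add_le_max x y).trans (max_le hx hy)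
  zero_mem' := by simp
  neg_mem' {x} hx := by
    rw [Set.mem_ofPred_eq] at *
    rwa [norm_neg]

@[simp, norm_cast]
theorem unitBall_coe_ofNat (n : ℕ) [n.AtLeastTwo] :
    ((ofNat(n) : unitBall K) : K) = ofNat(n) := rfl

/-- The maximal ideal `{x | ‖x‖ < 1}` of the valuation ring. -/
def openUnitBall : Ideal (unitBall K) where
  carrier := {x | ‖(x : K)‖ < 1}
  add_mem' {x y} hx hy := (IsUltrametricDist.norm_add_le_max (x : K) y).trans_lt (max_lt hx hy)
  zero_mem' := by simp
  smul_mem' c x hx := by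
    rw [Set.mem_ofPred_eq] at *
    change ‖(c : K) * x‖ < 1
    rw [norm_mul]
    exact (mul_le_of_le_one_left (norm_nonneg _) c.2).trans_lt hx

variable {K}

theorem mem_openUnitBall {x : unitBall K} : x ∈ openUnitBall K ↔ ‖(x : K)‖ < 1 := Iff.rfl

instance : (openUnitBall K).IsMaximal := by
  refine Ideal.isMaximal_iff.2 ⟨by simp [mem_openUnitBall], fun J x _ hx hxJ => ?_⟩
  have hx1 : ‖(x : K)‖ = 1 := le_antisymm x.2 (not_lt.1 hx)
  have hx0 : (x : K) ≠ 0 := norm_ne_zero_iff.1 (by rw [hx1]; exact one_ne_zero)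
  have h : x * ⟨(x : K)⁻¹, show ‖(x : K)⁻¹‖ ≤ 1 by rw [norm_inv, hx1, inv_one]⟩ = 1 :=
    Subtype.ext (mul_inv_cancel₀ hx0)
  rw [← h]
  exact J.mul_mem_right _ hxJ

variable (K) in
/-- The residue field of an ultrametric normed field. -/
abbrev NormResidueField : Type _ := unitBall K ⧸ openUnitBall K

instance : Field (NormResidueField K) := Ideal.Quotient.field _

variable (K) in
/-- Reduction modulo the maximal ideal. -/
def normReduce : unitBall K →+* NormResidueField K := Ideal.Quotient.mk _

theorem normReduce_eq_zero_iff {x : unitBall K} : normReduce K x = 0 ↔ ‖(x : K)‖ < 1 :=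
  Ideal.Quotient.eq_zero_iff_mem

theorem normReduce_eq_iff {x y : unitBall K} :
    normReduce K x = normReduce K y ↔ ‖(x : K) - y‖ < 1 := by
  rw [← sub_eq_zero, ← map_sub, normReduce_eq_zero_iff]
  rfl

theorem normReduce_surjective : Function.Surjective (normReduce K) := Ideal.Quotient.mk_surjective

end ResidueField

section Frobenius

variable {F K : Type*} [Field F] [NormedField K] [IsUltrametricDist K] [IsAlgClosed K]
  [Algebra F K] [IsGalois F K]

/-- If `x ↦ x ^ p` is the identity on the residue field of `F`, then it lifts to an automorphism of
`K` over `F`, because the Galois group maps onto the automorphism group of the residue field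
extension. -/
theorem exists_frobenius_of_residueField (hnorm : ∀ (σ : K ≃ₐ[F] K) (x : K), ‖σ x‖ = ‖x‖)
    (p : ℕ) [hp : Fact p.Prime] (hpK : ‖(p : K)‖ < 1)
    (hF : ∀ a : F, ‖algebraMap F K a‖ ≤ 1 → ‖algebraMap F K a ^ p - algebraMap F K a‖ < 1) :
    ∃ φ : K ≃ₐ[F] K, ∀ x : K, ‖x‖ ≤ 1 → ‖φ x - x ^ p‖ < 1 := by
  let A : Subring F := (unitBall K).comap (algebraMap F K)
  let : Algebra A (unitBall K) := RingHom.toAlgebra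
    (((algebraMap F K).comp A.subtype).codRestrict (unitBall K) fun a => a.2)
  let : MulSemiringAction (K ≃ₐ[F] K) (unitBall K) :=
    { smul := fun σ x => ⟨σ x, (hnorm σ x).trans_le x.2⟩
      one_smul := fun x => rfl
      mul_smul := fun σ τ x => rfl
      smul_zero := fun σ => Subtype.ext (map_zero σ)
      smul_add := fun σ x y => Subtype.ext (map_add σ _ _)
      smul_one := fun σ => Subtype.ext (map_one σ)
      smul_mul := fun σ x y => Subtype.ext (map_mul σ _ _) }
  have hsmul : ∀ (σ : K ≃ₐ[F] K) (x : unitBall K), ((σ • x : unitBall K) : K) = σ x :=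
    fun _ _ => rfl
  have : SMulCommClass (K ≃ₐ[F] K) A (unitBall K) := ⟨fun σ a x => Subtype.ext (by
    rw [hsmul, Algebra.smul_def, Algebra.smul_def]
    change σ (algebraMap F K a * x) = algebraMap F K a * σ x
    rw [map_mul, AlgEquiv.commutes])⟩
  let : TopologicalSpace (unitBall K) := ⊥
  have : DiscreteTopology (unitBall K) := ⟨rfl⟩
  have : ContinuousSMul (K ≃ₐ[F] K) (unitBall K) :=
    continuousSMul_iff_stabilizer_isOpen.2 fun x => by
      have h := stabilizer_isOpen_of_isIntegral (K := F) (x : K)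
      convert h using 1
      ext σ
      exact Subtype.ext_iff
  have : Algebra.IsInvariant A (unitBall K) (K ≃ₐ[F] K) := ⟨fun x hx => by
    have h := (InfiniteGalois.mem_bot_iff_fixed (k := F) (x : K)).2 fun σ =>
      congrArg Subtype.val (hx σ)
    obtain ⟨a, ha⟩ := IntermediateField.mem_bot.1 h
    exact ⟨⟨a, show ‖algebraMap F K a‖ ≤ 1 from ha ▸ x.2⟩, Subtype.ext ha⟩⟩
  have : CharP (NormResidueField K) p := by
    refine (CharP.charP_iff_prime_eq_zero hp.out).2 ?_
    have h := normReduce_eq_zero_iff (K := K) (x := (p : unitBall K))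
    rw [map_natCast] at h
    exact h.2 (by simpa using hpK)
  set Q := openUnitBall K
  set P := Q.under A
  have hbij : Function.Bijective (frobenius (unitBall K ⧸ Q) p) := by
    refine ⟨frobenius_inj _ _, fun z => ?_⟩
    obtain ⟨x, rfl⟩ := normReduce_surjective z
    obtain ⟨y, hy⟩ := IsAlgClosed.exists_pow_nat_eq (x : K) hp.out.pos
    refine ⟨normReduce K ⟨y, norm_le_one_of_norm_pow_le_one hp.out.ne_zero (hy ▸ x.2)⟩, ?_⟩
    rw [frobenius_def, ← map_pow]
    exact congrArg _ (Subtype.ext hy)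
  let f : (unitBall K ⧸ Q) →ₐ[A ⧸ P] (unitBall K ⧸ Q) :=
    { frobenius (unitBall K ⧸ Q) p with
      commutes' := fun a => by
        obtain ⟨a, rfl⟩ := Ideal.Quotient.mk_surjective a
        change (normReduce K (algebraMap A (unitBall K) a)) ^ p =
          normReduce K (algebraMap A (unitBall K) a)
        rw [← map_pow, normReduce_eq_iff]
        exact hF a a.2 }
  obtain ⟨φ, hφ⟩ := Ideal.Quotient.stabilizerHom_surjective_of_profinite (G := K ≃ₐ[F] K) P Q
    (AlgEquiv.ofBijective f hbij)
  refine ⟨φ, fun x hx => ?_⟩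
  have h := congrArg (fun g => g (normReduce K ⟨x, hx⟩)) hφ
  have h' : normReduce K (φ.1 • (⟨x, hx⟩ : unitBall K)) = normReduce K ⟨x, hx⟩ ^ p := h
  rw [← map_pow, normReduce_eq_iff] at h'
  exact h'

end Frobenius

/-! ### Elements of inertia at `2` and `3` -/

section RootsOfUnity

variable {K : Type*} [NormedField K] [IsUltrametricDist K]

/-- Roots of unity of order prime to the residue characteristic are determined by their
reductions. -/
theorem eq_of_pow_eq_one_of_norm_sub_lt_one {n : ℕ} (hn : ‖(n : K)‖ = 1) {a b : K}
    (ha : a ^ n = 1) (hb : b ^ n = 1) (hab : ‖a - b‖ < 1) : a = b := by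
  have hn0 : n ≠ 0 := by
    rintro rfl
    simp at hn
  have hb1 : ‖b‖ = 1 := by
    have h := congrArg norm hb
    rw [norm_pow, norm_one] at h
    exact (pow_eq_one_iff_of_nonneg (norm_nonneg _) hn0).1 h
  have hb0 : b ≠ 0 := norm_ne_zero_iff.1 (by rw [hb1]; exact one_ne_zero)
  set c := a / b with hc
  have hcn : c ^ n = 1 := by rw [hc, div_pow, ha, hb, div_one]
  have hc1 : ‖c - 1‖ < 1 := by
    rw [hc, div_sub_one hb0, norm_div, hb1, div_one]
    exact hab
  have hcle : ‖c‖ ≤ 1 := norm_le_one_of_norm_pow_le_one hn0 (by rw [hcn, norm_one])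
  by_contra hne
  have hcne : c - 1 ≠ 0 := by
    rw [hc, div_sub_one hb0]
    exact div_ne_zero (sub_ne_zero.2 hne) hb0
  have hsum : ∑ i ∈ Finset.range n, c ^ i = 0 := by
    refine (mul_eq_zero.1 ?_).resolve_right hcne
    rw [geom_sum_mul, hcn, sub_self]
  have hred : normReduce K ⟨c, hcle⟩ = 1 := by
    rw [← map_one (normReduce K), normReduce_eq_iff]
    exact hc1
  have h0 : normReduce K (∑ i ∈ Finset.range n, (⟨c, hcle⟩ : unitBall K) ^ i) = n := by
    rw [map_sum]
    simp [hred]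
  have h1 : ∑ i ∈ Finset.range n, (⟨c, hcle⟩ : unitBall K) ^ i = 0 := by
    refine Subtype.ext ?_
    push_cast
    exact hsum
  rw [h1, map_zero, ← map_natCast (normReduce K), eq_comm, normReduce_eq_zero_iff] at h0
  push_cast at h0
  exact absurd hn h0.ne

end RootsOfUnity

section PadicGalois

variable {p : ℕ} [Fact p.Prime]

theorem PadicAlgCl.norm_natCast_of_coprime {n : ℕ} (h : p.Coprime n) :
    ‖(n : PadicAlgCl p)‖ = 1 := by
  have h1 := PadicAlgCl.norm_extends p (n : ℚ_[p])
  rw [map_natCast] at h1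
  rw [h1]
  exact Padic.norm_natCast_eq_one_iff.2 h

theorem PadicAlgCl.norm_prime : ‖(p : PadicAlgCl p)‖ = (p : ℝ)⁻¹ := by
  have h1 := PadicAlgCl.norm_extends p (p : ℚ_[p])
  rw [map_natCast] at h1
  rw [h1, Padic.norm_p]

theorem PadicAlgCl.norm_prime_lt_one : ‖(p : PadicAlgCl p)‖ < 1 := by
  rw [PadicAlgCl.norm_prime]
  exact inv_lt_one_of_one_lt₀ (by exact_mod_cast (Fact.out : p.Prime).one_lt)

theorem Padic.norm_pow_prime_sub_lt_one {a : ℚ_[p]} (ha : ‖a‖ ≤ 1) : ‖a ^ p - a‖ < 1 := by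
  obtain ⟨z, rfl⟩ : ∃ z : ℤ_[p], (z : ℚ_[p]) = a := ⟨⟨a, ha⟩, rfl⟩
  have h : PadicInt.toZMod (z ^ p - z) = 0 := by
    rw [map_sub, map_pow, ZMod.pow_card, sub_self]
  rw [← RingHom.mem_ker, PadicInt.ker_toZMod] at h
  have h' := PadicInt.mem_nonunits.1 ((IsLocalRing.mem_maximalIdeal _).1 h)
  rwa [PadicInt.norm_def, PadicInt.coe_sub, PadicInt.coe_pow] at h'

theorem IsFrobenius.conj {φ : PadicGal p} (hφ : IsFrobenius φ) (τ : PadicGal p) :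
    IsFrobenius (τ * φ * τ⁻¹) := by
  intro x hx
  have h : (τ * φ * τ⁻¹) x - x ^ p = τ (φ (τ⁻¹ x) - (τ⁻¹ x) ^ p) := by
    rw [map_sub, map_pow, show τ (τ⁻¹ x) = x from AlgEquiv.apply_symm_apply τ x]
    rfl
  rw [h, PadicGal.norm_apply]
  exact hφ _ (by rwa [PadicGal.norm_apply])

variable (p) in
theorem exists_isFrobenius : ∃ φ : PadicGal p, IsFrobenius φ :=
  exists_frobenius_of_residueField (F := ℚ_[p]) PadicGal.norm_apply p
    PadicAlgCl.norm_prime_lt_one fun a ha => by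
      rw [← map_pow, ← map_sub, PadicAlgCl.norm_extends]
      rw [PadicAlgCl.norm_extends] at ha
      exact Padic.norm_pow_prime_sub_lt_one ha

/-- The extension generated by a square root `s` consists of the elements `a + b s`. -/
theorem exists_add_mul_of_mem_adjoin_sqrt {s : PadicAlgCl p} {c : ℚ_[p]}
    (hs : s ^ 2 = algebraMap _ _ c) {x : PadicAlgCl p}
    (hx : x ∈ IntermediateField.adjoin ℚ_[p] {s}) :
    ∃ a b : ℚ_[p], x = algebraMap _ _ a + algebraMap _ _ b * s := by
  rw [← IntermediateField.mem_toSubalgebra,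
    IntermediateField.adjoin_toSubalgebra] at hx
  induction hx using Algebra.adjoin_induction with
  | mem x hx =>
    rw [Set.mem_singleton_iff.1 hx]
    exact ⟨0, 1, by simp⟩
  | algebraMap r => exact ⟨r, 0, by simp⟩
  | add x y _ _ hx hy =>
    obtain ⟨a, b, rfl⟩ := hx
    obtain ⟨a', b', rfl⟩ := hy
    exact ⟨a + a', b + b', by rw [map_add, map_add]; ring⟩
  | mul x y _ _ hx hy =>
    obtain ⟨a, b, rfl⟩ := hx
    obtain ⟨a', b', rfl⟩ := hy
    refine ⟨a * a' + b * b' * c, a * b' + a' * b, ?_⟩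
    simp only [map_add, map_mul]
    linear_combination algebraMap _ _ b * algebraMap _ _ b' * hs

/-- There is a Frobenius element that fixes a given square root `s` of an element of valuation `1`,
because the extension generated by `s` is totally ramified, so that its residue field is `𝔽_p`. -/
theorem exists_isFrobenius_apply_sqrt {s : PadicAlgCl p} {c : ℚ_[p]}
    (hs : s ^ 2 = algebraMap _ _ c) (hc : ‖c‖ = (p : ℝ)⁻¹) :
    ∃ φ : PadicGal p, IsFrobenius φ ∧ φ s = s := by
  have hp1 : (1 : ℝ) < p := by exact_mod_cast (Fact.out : p.Prime).one_lt
  set E := IntermediateField.adjoin ℚ_[p] {s} with hE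
  have hs2 : ‖s‖ ^ 2 = (p : ℝ)⁻¹ := by
    rw [← norm_pow, hs, PadicAlgCl.norm_extends, hc]
  -- `‖a‖²` is an even power of `p` and `‖b s‖²` is an odd one
  have hne : ∀ a b : ℚ_[p], b ≠ 0 → ‖a‖ ≠ ‖b‖ * ‖s‖ := by
    intro a b hb hab
    have h2 : ‖a‖ ^ 2 = ‖b‖ ^ 2 * (p : ℝ)⁻¹ := by rw [hab, mul_pow, hs2]
    have ha : a ≠ 0 := by
      rintro rfl
      have : ‖b‖ ^ 2 * (p : ℝ)⁻¹ > 0 := by positivity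
      simp at h2
      rcases h2 with h2 | h2
      · exact hb h2
      · rw [h2] at hp1
        simp at hp1
        linarith
    rw [Padic.norm_eq_zpow_neg_valuation ha, Padic.norm_eq_zpow_neg_valuation hb,
      ← zpow_natCast, ← zpow_natCast, ← zpow_mul, ← zpow_mul, ← zpow_neg_one,
      ← zpow_add₀ (by positivity)] at h2
    have := zpow_right_injective₀ (by positivity) hp1.ne' h2
    push_cast at this
    omega
  obtain ⟨φ, hφ⟩ := exists_frobenius_of_residueField (F := E) (K := PadicAlgCl p)
    (fun σ x => PadicGal.norm_apply (σ.restrictScalars ℚ_[p]) x) p PadicAlgCl.norm_prime_lt_one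
    fun x hx => by
      obtain ⟨a, b, hab⟩ := exists_add_mul_of_mem_adjoin_sqrt hs x.2
      change ‖(x : PadicAlgCl p)‖ ≤ 1 at hx
      change ‖(x : PadicAlgCl p) ^ p - x‖ < 1
      rw [hab] at hx ⊢
      have hbs : ‖algebraMap ℚ_[p] (PadicAlgCl p) b * s‖ < 1 ∧ ‖a‖ ≤ 1 := by
        by_cases hb : b = 0
        · subst hb
          rw [map_zero, zero_mul, add_zero, PadicAlgCl.norm_extends] at hx
          simpa using hx
        have h1 : ‖algebraMap ℚ_[p] (PadicAlgCl p) a‖ ≠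
            ‖algebraMap ℚ_[p] (PadicAlgCl p) b * s‖ := by
          rw [norm_mul, PadicAlgCl.norm_extends, PadicAlgCl.norm_extends]
          exact hne a b hb
        rw [IsUltrametricDist.norm_add_eq_max_of_norm_ne_norm h1, max_le_iff,
          PadicAlgCl.norm_extends] at hx
        refine ⟨lt_of_le_of_ne hx.2 fun h => hne 1 b hb ?_, hx.1⟩
        rw [norm_one, ← h, norm_mul, PadicAlgCl.norm_extends]
      obtain ⟨hbs, ha⟩ := hbs
      have ha' : ‖algebraMap ℚ_[p] (PadicAlgCl p) a‖ ≤ 1 := by rwa [PadicAlgCl.norm_extends]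
      have hred : normReduce (PadicAlgCl p) ⟨_, hx⟩ = normReduce _ ⟨_, ha'⟩ :=
        normReduce_eq_iff.2 (by simpa using hbs)
      have h := Padic.norm_pow_prime_sub_lt_one ha
      rw [← PadicAlgCl.norm_extends, map_sub, map_pow] at h
      have h2 : normReduce (PadicAlgCl p) (⟨_, ha'⟩ ^ p) = normReduce _ ⟨_, ha'⟩ :=
        normReduce_eq_iff.2 h
      rw [map_pow, ← hred, ← map_pow, normReduce_eq_iff] at h2
      exact h2
  exact ⟨φ.restrictScalars ℚ_[p], hφ,
    φ.commutes ⟨s, IntermediateField.mem_adjoin_simple_self ℚ_[p] s⟩⟩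

theorem IsFrobenius.apply_of_pow_eq_one {φ : PadicGal p} (hφ : IsFrobenius φ) {n : ℕ}
    (hn : p.Coprime n) {ζ : PadicAlgCl p} (hζ : ζ ^ n = 1) : φ ζ = ζ ^ p := by
  have hn0 : n ≠ 0 := by
    rintro rfl
    simp only [Nat.coprime_zero_right] at hn
    exact (Fact.out : p.Prime).one_lt.ne' hn
  refine eq_of_pow_eq_one_of_norm_sub_lt_one (PadicAlgCl.norm_natCast_of_coprime hn)
    (by rw [← map_pow, hζ, map_one]) (by rw [pow_right_comm, hζ, one_pow]) (hφ ζ ?_)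
  exact norm_le_one_of_norm_pow_le_one hn0 (by rw [hζ, norm_one])

/-- For `p = 2` inertia acts nontrivially on the cube roots of `2`. The element of inertia is a
commutator of a Frobenius element `φ` which fixes a cube root `v` of `2` and of an automorphism that
moves `v`. -/
theorem exists_inertia_two : ∃ φ σ : PadicGal 2, IsFrobenius φ ∧ σ ∈ inertiaGroup 2 ∧
    ∃ v ω : PadicAlgCl 2, v ^ 3 = 2 ∧ ω ^ 2 + ω + 1 = 0 ∧ σ v = ω * v := by
  obtain ⟨φ, hφ⟩ := exists_isFrobenius 2
  obtain ⟨v₀, hv₀⟩ := IsAlgClosed.exists_pow_nat_eq (2 : PadicAlgCl 2) (n := 3) (by norm_num)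
  have hv₀0 : v₀ ≠ 0 := by
    rintro rfl
    norm_num at hv₀
  obtain ⟨ω, hω⟩ : ∃ ω : PadicAlgCl 2, ω ^ 2 + ω + 1 = 0 := by
    obtain ⟨d, hd⟩ := IsAlgClosed.exists_pow_nat_eq (-3 : PadicAlgCl 2) (n := 2) (by norm_num)
    exact ⟨(d - 1) / 2, by linear_combination hd / 4⟩
  have hω3 : ω ^ 3 = 1 := by linear_combination (ω - 1) * hω
  set ζ := φ v₀ / v₀ with hζ
  have hζ3 : ζ ^ 3 = 1 := by
    rw [hζ, div_pow, ← map_pow, hv₀, map_ofNat, div_self (two_ne_zero)]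
  have hφv₀ : φ v₀ = ζ * v₀ := by rw [hζ, div_mul_cancel₀ _ hv₀0]
  -- one of the cube roots of `2` is fixed by `φ`, because `φ ζ = ζ²`
  set v := ζ ^ 2 * v₀ with hv
  have hv3 : v ^ 3 = 2 := by
    rw [hv, mul_pow, hv₀, pow_right_comm, hζ3]
    norm_num
  have hφv : φ v = v := by
    rw [hv, map_mul, map_pow, hφ.apply_of_pow_eq_one (n := 3) (by norm_num) hζ3, hφv₀]
    linear_combination ζ ^ 2 * v₀ * hζ3
  have hirr : Irreducible (X ^ 3 - C (2 : ℚ_[2])) := by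
    refine (X_pow_sub_C_irreducible_iff_of_prime Nat.prime_three).2 fun b hb => ?_
    have hb0 : b ≠ 0 := by
      rintro rfl
      norm_num at hb
    have h := congrArg norm hb
    have h2 := Padic.norm_p (p := 2)
    rw [norm_pow, show (2 : ℚ_[2]) = ((2 : ℕ) : ℚ_[2]) by norm_num, h2,
      Padic.norm_eq_zpow_neg_valuation hb0, ← zpow_natCast, ← zpow_mul, ← zpow_neg_one] at h
    have := zpow_right_injective₀ (by norm_num) (by norm_num) h
    push_cast at this
    omega
  have hroot : ∀ z : PadicAlgCl 2, z ^ 3 = 2 → X ^ 3 - C (2 : ℚ_[2]) = minpoly ℚ_[2] z :=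
    fun z hz => minpoly.eq_of_irreducible_of_monic hirr (by simp [hz, map_ofNat])
      (monic_X_pow_sub_C _ (by norm_num))
  obtain ⟨τ, hτ⟩ : ∃ τ : PadicGal 2, τ v = ω * v := by
    have h : minpoly ℚ_[2] (ω * v) = minpoly ℚ_[2] v := by
      rw [← hroot v hv3, ← hroot (ω * v) (by rw [mul_pow, hω3, hv3, one_mul])]
    exact (Normal.minpoly_eq_iff_mem_orbit (PadicAlgCl 2)).1 h
  refine ⟨φ, φ⁻¹ * (τ * φ * τ⁻¹), hφ, hφ.inv_mul_mem (hφ.conj τ), ω * v, ω,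
    by rw [mul_pow, hω3, hv3, one_mul], hω, ?_⟩
  have h1 : τ⁻¹ (ω * v) = v := by
    rw [← hτ]
    exact AlgEquiv.symm_apply_apply τ v
  change φ⁻¹ (τ (φ (τ⁻¹ (ω * v)))) = ω * (ω * v)
  rw [h1, hφv, hτ, eq_comm]
  have h2 : φ (ω * (ω * v)) = ω * v := by
    rw [map_mul, map_mul, hφv, hφ.apply_of_pow_eq_one (n := 3) (by norm_num) hω3]
    linear_combination ω * v * hω3
  rw [show ω * (ω * v) = φ⁻¹ (φ (ω * (ω * v))) from (AlgEquiv.symm_apply_apply φ _).symm, h2]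

/-- For `p = 3` inertia acts nontrivially on `√3` and `√-3`. The element of inertia is the quotient
of a Frobenius element that fixes `√3` and one that fixes `√-3`. -/
theorem exists_inertia_three : ∃ φ σ : PadicGal 3, IsFrobenius φ ∧ σ ∈ inertiaGroup 3 ∧
    ∀ u : PadicAlgCl 3, u ^ 4 = 3 ∨ u ^ 4 = -3 → σ u ^ 2 = -u ^ 2 := by
  obtain ⟨s, hs⟩ := IsAlgClosed.exists_pow_nat_eq (3 : PadicAlgCl 3) (n := 2) (by norm_num)
  obtain ⟨i, hi⟩ := IsAlgClosed.exists_pow_nat_eq (-1 : PadicAlgCl 3) (n := 2) (by norm_num)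
  have hi4 : i ^ 4 = 1 := by linear_combination (i ^ 2 - 1) * hi
  have hi0 : i ≠ 0 := by
    rintro rfl
    norm_num at hi
  have h3 : ‖(3 : ℚ_[3])‖ = ((3 : ℕ) : ℝ)⁻¹ := by
    have := Padic.norm_p (p := 3)
    simpa using this
  obtain ⟨φ, hφ, hφs⟩ := exists_isFrobenius_apply_sqrt (p := 3) (c := 3)
    (hs.trans (map_ofNat _ 3).symm) h3
  obtain ⟨ψ, hψ, hψs⟩ := exists_isFrobenius_apply_sqrt (p := 3) (c := -3) (s := i * s)
    (by rw [map_neg, map_ofNat]; linear_combination s ^ 2 * hi - hs) (by rw [norm_neg, h3])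
  have hI : ∀ χ : PadicGal 3, IsFrobenius χ → χ i = -i := fun χ hχ => by
    rw [hχ.apply_of_pow_eq_one (n := 4) (by norm_num) hi4]
    linear_combination i * hi
  have hψ' : ψ s = -s := by
    rw [map_mul, hI ψ hψ] at hψs
    refine mul_left_cancel₀ hi0 ?_
    linear_combination -hψs
  have h1 : (φ⁻¹ * ψ) s = -s := by
    change φ⁻¹ (ψ s) = -s
    rw [hψ', show -s = φ (-s) by rw [map_neg, hφs]]
    exact (AlgEquiv.symm_apply_apply φ (-s)).trans (by rw [map_neg, hφs])
  have h2 : (φ⁻¹ * ψ) i = i := by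
    change φ⁻¹ (ψ i) = i
    rw [hI ψ hψ, ← hI φ hφ]
    exact AlgEquiv.symm_apply_apply φ i
  refine ⟨φ, φ⁻¹ * ψ, hφ, hφ.inv_mul_mem hψ, fun u hu => ?_⟩
  rw [← map_pow]
  rcases hu with hu | hu
  · have h : (u ^ 2 - s) * (u ^ 2 + s) = 0 := by linear_combination hu - hs
    rcases mul_eq_zero.1 h with h | h
    · rw [sub_eq_zero.1 h, h1]
    · rw [eq_neg_of_add_eq_zero_left h, map_neg, h1]
  · have h : (u ^ 2 - i * s) * (u ^ 2 + i * s) = 0 := by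
      linear_combination hu + hs - s ^ 2 * hi
    rcases mul_eq_zero.1 h with h | h
    · rw [sub_eq_zero.1 h, map_mul, h1, h2]
      ring
    · rw [eq_neg_of_add_eq_zero_left h, map_neg, map_mul, h1, h2]
      ring

end PadicGalois

/-! ### The Galois action on a model with supersingular reduction -/

section Congruence

variable {K : Type*} [NormedField K]

/-- `x` and `y` are integral and have the same reduction. -/
structure NormCong (x y : K) : Prop where
  left : ‖x‖ ≤ 1
  right : ‖y‖ ≤ 1
  lt_one : ‖x - y‖ < 1

namespace NormCong

variable {x y z x' y' : K}

theorem refl (hx : ‖x‖ ≤ 1) : NormCong x x := ⟨hx, hx, by simp⟩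

theorem symm (h : NormCong x y) : NormCong y x := ⟨h.right, h.left, norm_sub_rev x y ▸ h.lt_one⟩

variable [IsUltrametricDist K]

theorem iff_normReduce (hx : ‖x‖ ≤ 1) (hy : ‖y‖ ≤ 1) :
    NormCong x y ↔ normReduce K ⟨x, hx⟩ = normReduce K ⟨y, hy⟩ :=
  ⟨fun h => normReduce_eq_iff.2 h.lt_one, fun h => ⟨hx, hy, normReduce_eq_iff.1 h⟩⟩

theorem trans (h : NormCong x y) (h' : NormCong y z) : NormCong x z :=
  (iff_normReduce h.left h'.right).2 (((iff_normReduce h.left h.right).1 h).trans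
    ((iff_normReduce h'.left h'.right).1 h'))

theorem mul (h : NormCong x x') (h' : NormCong y y') : NormCong (x * y) (x' * y') := by
  have e := (iff_normReduce h.left h.right).1 h
  have e' := (iff_normReduce h'.left h'.right).1 h'
  refine (iff_normReduce ((unitBall K).mul_mem h.left h'.left)
    ((unitBall K).mul_mem h.right h'.right)).2 ?_
  have h1 := map_mul (normReduce K) ⟨x, h.left⟩ ⟨y, h'.left⟩
  have h2 := map_mul (normReduce K) ⟨x', h.right⟩ ⟨y', h'.right⟩
  rw [e, e', ← h2] at h1
  exact h1

theorem pow (h : NormCong x y) (n : ℕ) : NormCong (x ^ n) (y ^ n) := by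
  induction n with
  | zero => simpa using refl (x := (1 : K)) (by simp)
  | succ n ih =>
    rw [pow_succ, pow_succ]
    exact ih.mul h

end NormCong

end Congruence

section Inertia

variable {p : ℕ} [Fact p.Prime]

/-- Inertia fixes the roots of unity of order prime to `p`. -/
theorem apply_eq_of_mem_inertiaGroup {σ : PadicGal p} (hσ : σ ∈ inertiaGroup p) {n : ℕ}
    (hn : p.Coprime n) {ζ : PadicAlgCl p} (hζ : ζ ^ n = 1) : σ ζ = ζ := by
  have hn0 : n ≠ 0 := by
    rintro rfl
    simp only [Nat.coprime_zero_right] at hn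
    exact (Fact.out : p.Prime).one_lt.ne' hn
  exact eq_of_pow_eq_one_of_norm_sub_lt_one (PadicAlgCl.norm_natCast_of_coprime hn)
    (by rw [← map_pow, hζ, map_one]) hζ
    (hσ ζ (norm_le_one_of_norm_pow_le_one hn0 (by rw [hζ, norm_one])))

end Inertia

section Twist

open WeierstrassCurve

variable {p : ℕ} [Fact p.Prime] (W : WeierstrassCurve ℚ) (v : VariableChange (PadicAlgCl p))

/-- The curve `W` over the algebraic closure of `ℚ_p` after the change of variables `v`. -/
abbrev localModel : WeierstrassCurve (PadicAlgCl p) :=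
  v • (W.baseChange ℚ_[p]).baseChange (PadicAlgCl p)

/-- The isomorphism between the points of the two models of a curve. -/
def localModelEquiv : (localModel W v).toAffine.Point ≃+ LocalPoints W p :=
  AddEquiv.ofBijective (pointOfVariableChange _ v)
    ⟨pointOfVariableChange_injective _ v, pointOfVariableChange_surjective _ v⟩

/-- The Galois action on the points of `W`, in terms of the model given by `v`. -/
def twistedMap (σ : PadicGal p) :
    (localModel W v).toAffine.Point →+ (localModel W v).toAffine.Point :=
  ((localModelEquiv W v).symm.toAddMonoidHom.comp
    (Affine.Point.map (W' := W.baseChange ℚ_[p])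
      (σ : PadicAlgCl p →ₐ[ℚ_[p]] PadicAlgCl p))).comp (localModelEquiv W v).toAddMonoidHom

variable {W v}

theorem localModelEquiv_twistedMap (σ : PadicGal p) (P : (localModel W v).toAffine.Point) :
    localModelEquiv W v (twistedMap W v σ P) = Affine.Point.map (W' := W.baseChange ℚ_[p])
      (σ : PadicAlgCl p →ₐ[ℚ_[p]] PadicAlgCl p) (localModelEquiv W v P) :=
  (localModelEquiv W v).apply_symm_apply _

theorem twistedMap_one (P : (localModel W v).toAffine.Point) : twistedMap W v 1 P = P := by
  apply (localModelEquiv W v).injective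
  rw [localModelEquiv_twistedMap]
  exact Affine.Point.map_id (W' := W.baseChange ℚ_[p]) _

theorem twistedMap_mul (σ τ : PadicGal p) (P : (localModel W v).toAffine.Point) :
    twistedMap W v (σ * τ) P = twistedMap W v σ (twistedMap W v τ P) := by
  apply (localModelEquiv W v).injective
  rw [localModelEquiv_twistedMap, localModelEquiv_twistedMap, localModelEquiv_twistedMap]
  exact (Affine.Point.map_map (W' := W.baseChange ℚ_[p])
      (τ : PadicAlgCl p →ₐ[ℚ_[p]] PadicAlgCl p) (σ : PadicAlgCl p →ₐ[ℚ_[p]] PadicAlgCl p) _).symm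

theorem twistedMap_pow (σ : PadicGal p) (k : ℕ) (P : (localModel W v).toAffine.Point) :
    twistedMap W v (σ ^ k) P = (twistedMap W v σ)^[k] P := by
  induction k with
  | zero => exact twistedMap_one P
  | succ k ih => rw [pow_succ', twistedMap_mul, ih, Function.iterate_succ_apply']

variable (v) in
/-- The cocycle `σ ↦ σ(u) / u`. -/
def scaleRatio (σ : PadicGal p) : PadicAlgCl p := σ (v.u : PadicAlgCl p) / v.u

theorem scaleRatio_mul (σ τ : PadicGal p) :
    scaleRatio v (σ * τ) = scaleRatio v σ * σ (scaleRatio v τ) := by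
  have hu : (v.u : PadicAlgCl p) ≠ 0 := v.u.ne_zero
  have hσ : σ (v.u : PadicAlgCl p) ≠ 0 := (map_ne_zero σ).2 hu
  rw [scaleRatio, scaleRatio, scaleRatio, map_div₀, AlgEquiv.mul_apply]
  field_simp

theorem apply_u (σ : PadicGal p) : σ (v.u : PadicAlgCl p) = scaleRatio v σ * v.u := by
  rw [scaleRatio, div_mul_cancel₀ _ v.u.ne_zero]

/-- If `r`, `s`, `t` are rational, then the Galois group acts on the coordinates of the model
through `σ` and the scaling by powers of `σ(u) / u`. -/
theorem exists_twistedMap_some {σ : PadicGal p} (hr : σ v.r = v.r) (hs : σ v.s = v.s)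
    (ht : σ v.t = v.t) {x y : PadicAlgCl p} (h : (localModel W v).toAffine.Nonsingular x y) :
    ∃ h', twistedMap W v σ (.some x y h) =
      .some (scaleRatio v σ ^ 2 * σ x) (scaleRatio v σ ^ 3 * σ y) h' := by
  have hu : (v.u : PadicAlgCl p) ≠ 0 := v.u.ne_zero
  have h1 := localModelEquiv_twistedMap σ (.some x y h)
  rcases hP : twistedMap W v σ (.some x y h) with _ | ⟨x', y', h'⟩
  · rw [hP] at h1
    exact absurd h1.symm (Affine.Point.some_ne_zero _)
  · rw [hP] at h1
    have h2 := (Affine.Point.some.injEq ..).mp h1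
    have hx : x' = scaleRatio v σ ^ 2 * σ x := by
      have := h2.1
      change v.u ^ 2 * x' + v.r = σ (v.u ^ 2 * x + v.r) at this
      rw [map_add, map_mul, map_pow, hr, apply_u] at this
      refine mul_left_cancel₀ (pow_ne_zero 2 hu) ?_
      linear_combination this
    have hy : y' = scaleRatio v σ ^ 3 * σ y := by
      have := h2.2
      change v.u ^ 3 * y' + v.u ^ 2 * v.s * x' + v.t =
        σ (v.u ^ 3 * y + v.u ^ 2 * v.s * x + v.t) at this
      rw [map_add, map_add, map_mul, map_mul, map_mul, map_pow, map_pow, hs, ht, apply_u, hx]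
        at this
      refine mul_left_cancel₀ (pow_ne_zero 3 hu) ?_
      linear_combination this
    subst hx hy
    exact ⟨h', rfl⟩

end Twist

section Model

open WeierstrassCurve

variable {K : Type*} [NormedField K] [IsUltrametricDist K] [DecidableEq K]

/-- The reduction map is defined and injective on the `ℓ`-power torsion points other than `0`. -/
structure IsRigid (ℓ : ℕ) (E : WeierstrassCurve K) : Prop where
  integral : ∀ {x y : K} {h : E.toAffine.Nonsingular x y},
    IsPowTorsion ℓ (Affine.Point.some x y h) → ‖x‖ ≤ 1 ∧ ‖y‖ ≤ 1
  injective : ∀ {x y x' y' : K} {h : E.toAffine.Nonsingular x y} {h' : E.toAffine.Nonsingular x' y'},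
    IsPowTorsion ℓ (Affine.Point.some x y h) → IsPowTorsion ℓ (Affine.Point.some x' y' h') →
    NormCong x x' → NormCong y y' → Affine.Point.some x y h = Affine.Point.some x' y' h'

/-- On the `ℓ`-power torsion, `J` reduces to `(x, y) ↦ (ζ² x, ζ³ y)`. -/
def IsRotation (ℓ : ℕ) {E : WeierstrassCurve K} (ζ : K)
    (J : E.toAffine.Point →+ E.toAffine.Point) : Prop :=
  ∀ (x y : K) (h : E.toAffine.Nonsingular x y), IsPowTorsion ℓ (Affine.Point.some x y h) →
    ∃ x' y' h', J (.some x y h) = .some x' y' h' ∧ NormCong x' (ζ ^ 2 * x) ∧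
      NormCong y' (ζ ^ 3 * y)

/-- What is needed of a model of a curve with supersingular reduction in characteristic `p`: the
points are `ℓ`-divisible, torsion reduces injectively, multiplication by `-p` reduces to the
Frobenius endomorphism over the field of `p²` elements, and an endomorphism `J` of the group of
points that reduces to an automorphism of order `p + 1` satisfies `J² + c J + 1 = 0` on the torsion
and fixes exactly the multiples of a torsion point `Q ≠ 0`. -/
structure IsSupersingularModel (p ℓ c : ℕ) (E : WeierstrassCurve K) : Prop
    extends IsRigid ℓ E where
  divisible : ∀ P : E.toAffine.Point, ∃ R, ℓ • R = P
  neg_prime_smul : ∀ {x y : K} {h : E.toAffine.Nonsingular x y},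
    IsPowTorsion ℓ (Affine.Point.some x y h) → ∃ x' y' h',
      -(p • Affine.Point.some x y h) = Affine.Point.some x' y' h' ∧
      NormCong x' (x ^ p ^ 2) ∧ NormCong y' (y ^ p ^ 2)
  rotation : ∀ {ζ : K} {J : E.toAffine.Point →+ E.toAffine.Point}, IsPrimitiveRoot ζ (p + 1) →
    IsRotation ℓ ζ J → (∀ P, IsPowTorsion ℓ P → J (J P) + c • J P + P = 0) ∧
    ∃ Q, Q ≠ 0 ∧ IsPowTorsion ℓ Q ∧ J Q = Q ∧
      ∀ P, IsPowTorsion ℓ P → J P = P → ∃ k : ℤ, P = k • Q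

end Model

section Main

open WeierstrassCurve

variable {p : ℕ} [Fact p.Prime] {W : WeierstrassCurve ℚ} {v : VariableChange (PadicAlgCl p)}

/-- On torsion, the action of a Galois element depends only on its action on the residue field and
on its value of the cocycle. -/
theorem twistedMap_eq_of_scaleRatio_eq {ℓ : ℕ} (hE : IsRigid ℓ (localModel W v))
    (hr : ∀ σ : PadicGal p, σ v.r = v.r) (hs : ∀ σ : PadicGal p, σ v.s = v.s)
    (ht : ∀ σ : PadicGal p, σ v.t = v.t) {σ τ : PadicGal p}
    (hστ : ∀ z : PadicAlgCl p, ‖z‖ ≤ 1 → ‖σ z - τ z‖ < 1)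
    (hc : scaleRatio v σ = scaleRatio v τ) {P : (localModel W v).toAffine.Point}
    (hP : IsPowTorsion ℓ P) : twistedMap W v σ P = twistedMap W v τ P := by
  rcases P with _ | ⟨x, y, h⟩
  · exact (map_zero (twistedMap W v σ)).trans (map_zero (twistedMap W v τ)).symm
  obtain ⟨hx, hy⟩ := hE.integral hP
  have hσP := hP.map (twistedMap W v σ)
  have hτP := hP.map (twistedMap W v τ)
  obtain ⟨h₁, e₁⟩ := exists_twistedMap_some (hr σ) (hs σ) (ht σ) h
  obtain ⟨h₂, e₂⟩ := exists_twistedMap_some (hr τ) (hs τ) (ht τ) h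
  have hn : ‖scaleRatio v τ‖ = 1 := by
    rw [scaleRatio, norm_div, PadicGal.norm_apply, div_self (norm_ne_zero_iff.2 v.u.ne_zero)]
  have hcong : ∀ z : PadicAlgCl p, ‖z‖ ≤ 1 → NormCong (σ z) (τ z) := fun z hz =>
    ⟨(PadicGal.norm_apply σ z).trans_le hz, (PadicGal.norm_apply τ z).trans_le hz, hστ z hz⟩
  have hcr : NormCong (scaleRatio v σ) (scaleRatio v τ) := hc ▸ NormCong.refl (hc ▸ hn.le)
  rw [e₁] at hσP ⊢
  rw [e₂] at hτP ⊢
  refine hE.injective hσP hτP ?_ ?_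
  · exact (hcr.pow 2).mul (hcong x hx)
  · exact (hcr.pow 3).mul (hcong y hy)

/-- The Euler factor at a prime where `W` acquires supersingular reduction over an extension with
ramification index `p + 1`, generated by a `(p + 1)`-th root `u`. On torsion, inertia acts through
`J = σ₀`. The ratios `σ(u) / u` are `(p + 1)`-th roots of unity, which inertia fixes and on which
Frobenius acts as `ζ ↦ ζ^p = ζ⁻¹`. Hence `J φ J` and `φ` have the same cocycle value, and `φ²` has
the trivial one, so that it reduces to the Frobenius endomorphism over the field of `p²` elements,
which is `-p`. -/
theorem symSqDet_of_isSupersingularModel (c : ℕ) (hc : auxPrime p = c + 2)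
    (hE : IsSupersingularModel p (auxPrime p) c (localModel W v))
    (hr : ∀ σ : PadicGal p, σ v.r = v.r) (hs : ∀ σ : PadicGal p, σ v.s = v.s)
    (ht : ∀ σ : PadicGal p, σ v.t = v.t)
    (hu : ∀ σ : PadicGal p, σ ((v.u : PadicAlgCl p) ^ (p + 1)) = (v.u : PadicAlgCl p) ^ (p + 1))
    {φ σ₀ : PadicGal p} (hφ : IsFrobenius φ) (hσ₀ : σ₀ ∈ inertiaGroup p)
    (hζ : IsPrimitiveRoot (scaleRatio v σ₀) (p + 1)) (t : ℚ_[auxPrime p]) :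
    symSqDet ℚ_[auxPrime p] (tateRep W p) (inertiaGroup p) φ t = 1 + p * t := by
  set ℓ := auxPrime p
  set e := localModelEquiv W v
  set T := twistedMap W v
  have hcop : p.Coprime (p + 1) := by simp
  have hratio : ∀ σ : PadicGal p, scaleRatio v σ ^ (p + 1) = 1 := fun σ => by
    rw [scaleRatio, div_pow, ← map_pow, hu, div_self (pow_ne_zero _ v.u.ne_zero)]
  have hIζ : ∀ σ ∈ inertiaGroup p, ∀ τ, σ (scaleRatio v τ) = scaleRatio v τ := fun σ hσ τ =>
    apply_eq_of_mem_inertiaGroup hσ hcop (hratio τ)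
  have hφζ : ∀ τ, φ (scaleRatio v τ) = scaleRatio v τ ^ p := fun τ =>
    hφ.apply_of_pow_eq_one hcop (hratio τ)
  have hcongr : ∀ {σ τ : PadicGal p}, (∀ z : PadicAlgCl p, ‖z‖ ≤ 1 → ‖σ z - τ z‖ < 1) →
      scaleRatio v σ = scaleRatio v τ → ∀ P, IsPowTorsion ℓ P → T σ P = T τ P :=
    fun h h' P hP => twistedMap_eq_of_scaleRatio_eq hE.toIsRigid hr hs ht h h' hP
  -- all statements are transported from the model to `W`
  have hT : ∀ (σ : PadicGal p) P, Affine.Point.map (W' := W.baseChange ℚ_[p])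
      (σ : PadicAlgCl p →ₐ[ℚ_[p]] PadicAlgCl p) (e P) = e (T σ P) := fun σ P =>
    (localModelEquiv_twistedMap σ P).symm
  have htor : ∀ {P}, IsPowTorsion ℓ (e P) → IsPowTorsion ℓ P := fun {P} hP => by
    have := hP.map e.symm.toAddMonoidHom
    rwa [AddEquiv.toAddMonoidHom_eq_coe, AddMonoidHom.coe_coe, e.symm_apply_apply] at this
  have hrot : IsRotation ℓ (scaleRatio v σ₀) (T σ₀) := fun x y h hP => by
    obtain ⟨hx, hy⟩ := hE.integral hP
    obtain ⟨h', e'⟩ := exists_twistedMap_some (hr σ₀) (hs σ₀) (ht σ₀) h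
    have hn : ‖scaleRatio v σ₀‖ ≤ 1 :=
      norm_le_one_of_norm_pow_le_one (Nat.succ_ne_zero p) (by rw [hratio, norm_one])
    have hcong : ∀ z : PadicAlgCl p, ‖z‖ ≤ 1 → NormCong (σ₀ z) z := fun z hz =>
      ⟨(PadicGal.norm_apply σ₀ z).trans_le hz, hz, hσ₀ z hz⟩
    exact ⟨_, _, h', e', ((NormCong.refl hn).pow 2).mul (hcong x hx),
      ((NormCong.refl hn).pow 3).mul (hcong y hy)⟩
  obtain ⟨hJ, Q, hQ0, hQt, hJQ, hker⟩ := hE.rotation hζ hrot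
  refine symSqDet_tateModule c hc (fun σ : PadicGal p => Affine.Point.map (W' := W.baseChange ℚ_[p])
      (σ : PadicAlgCl p →ₐ[ℚ_[p]] PadicAlgCl p)) (tateRep W p) (fun σ => rfl) (inertiaGroup p) p
      hσ₀ (fun P => ?_) (fun σ hσ => ?_) (fun P hP => ?_) (fun P hP => ?_) (fun P hP => ?_)
      (Q := e Q) ((map_ne_zero_iff e e.injective).2 hQ0) (hQt.map e.toAddMonoidHom) ?_
      (fun P hP hJP => ?_) t
  · obtain ⟨R, hR⟩ := hE.divisible (e.symm P)
    exact ⟨e R, by rw [← map_nsmul, hR, e.apply_symm_apply]⟩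
  · obtain ⟨k, -, hk⟩ := hζ.eq_pow_of_pow_eq_one (hratio σ)
    have hpow : ∀ n : ℕ, scaleRatio v (σ₀ ^ n) = scaleRatio v σ₀ ^ n := fun n => by
      induction n with
      | zero =>
        rw [pow_zero, pow_zero, scaleRatio, AlgEquiv.one_apply, div_self v.u.ne_zero]
      | succ n ih => rw [pow_succ', scaleRatio_mul, hIζ _ hσ₀, ih, pow_succ']
    refine ⟨k, fun P hP => ?_⟩
    obtain ⟨P, rfl⟩ := e.surjective P
    have hiter : ∀ n : ℕ, (Affine.Point.map (W' := W.baseChange ℚ_[p])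
        (σ₀ : PadicAlgCl p →ₐ[ℚ_[p]] PadicAlgCl p))^[n] (e P) = e ((T σ₀)^[n] P) := fun n => by
      induction n with
      | zero => rfl
      | succ n ih => rw [Function.iterate_succ_apply', ih, hT, Function.iterate_succ_apply']
    rw [hiter, hT, ← twistedMap_pow]
    congr 1
    refine hcongr (fun z hz => ?_) (by rw [hpow, hk]) P (htor hP)
    have h1 := hσ z hz
    have h2 := (inertiaGroup p).pow_mem hσ₀ k z hz
    rw [← sub_add_sub_cancel (σ z) z]
    exact (IsUltrametricDist.norm_add_le_max _ _).trans_lt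
      (max_lt h1 (norm_sub_rev ((σ₀ ^ k) z) z ▸ h2))
  · obtain ⟨P, rfl⟩ := e.surjective P
    rw [hT, hT, ← map_nsmul, ← map_add, ← map_add, hJ P (htor hP), map_zero]
  · obtain ⟨P, rfl⟩ := e.surjective P
    rw [hT, hT, hT, hT, ← twistedMap_mul, ← twistedMap_mul]
    congr 1
    refine hcongr (fun z hz => ?_) ?_ P (htor hP)
    · have h1 := hσ₀ (φ (σ₀ z)) (by rwa [PadicGal.norm_apply, PadicGal.norm_apply])
      have h2 := hσ₀ z hz
      rw [← PadicGal.norm_apply φ, map_sub] at h2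
      have h3 : (σ₀ * φ * σ₀) z - φ z = (σ₀ (φ (σ₀ z)) - φ (σ₀ z)) + (φ (σ₀ z) - φ z) := by
        rw [sub_add_sub_cancel]
        rfl
      rw [h3]
      exact (IsUltrametricDist.norm_add_le_max _ _).trans_lt (max_lt h1 h2)
    · rw [scaleRatio_mul, scaleRatio_mul, AlgEquiv.mul_apply, hφζ, hIζ _ hσ₀, map_pow,
        hIζ _ hσ₀, mul_right_comm, ← pow_succ', hratio, one_mul]
  · obtain ⟨P, rfl⟩ := e.surjective P
    have hPt := htor hP
    rw [hT, hT, ← map_nsmul, ← map_neg, ← twistedMap_mul]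
    congr 1
    have hφφ : scaleRatio v (φ * φ) = 1 := by
      rw [scaleRatio_mul, hφζ, ← pow_succ', hratio]
    rcases P with _ | ⟨x, y, h⟩
    · rw [← Affine.Point.zero_def]
      simp
    obtain ⟨hx, hy⟩ := hE.integral hPt
    obtain ⟨x', y', h', e', hx', hy'⟩ := hE.neg_prime_smul hPt
    obtain ⟨h'', e''⟩ := exists_twistedMap_some (hr (φ * φ)) (hs (φ * φ)) (ht (φ * φ)) h
    have h1 := hPt.map (T (φ * φ))
    have h2 := (hPt.nsmul p).neg
    rw [e''] at h1 ⊢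
    rw [e'] at h2 ⊢
    have hcong : ∀ z : PadicAlgCl p, ‖z‖ ≤ 1 → NormCong ((φ * φ) z) (z ^ p ^ 2) := fun z hz => by
      have h3 : ∀ z : PadicAlgCl p, ‖z‖ ≤ 1 → NormCong (φ z) (z ^ p) := fun z hz =>
        ⟨(PadicGal.norm_apply φ z).trans_le hz, by
          rw [norm_pow]; exact pow_le_one₀ (norm_nonneg _) hz, hφ z hz⟩
      have h4 := (h3 (φ z) (h3 z hz).left).trans ((h3 z hz).pow p)
      rwa [← pow_mul, ← sq] at h4
    refine hE.injective h1 h2 ?_ ?_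
    · rw [hφφ, one_pow, one_mul]
      exact (hcong x hx).trans hx'.symm
    · rw [hφφ, one_pow, one_mul]
      exact (hcong y hy).trans hy'.symm
  · rw [hT, hJQ]
  · obtain ⟨P, rfl⟩ := e.surjective P
    rw [hT] at hJP
    obtain ⟨k, hk⟩ := hker P (htor hP) (e.injective hJP)
    exact ⟨k, by rw [hk, map_zsmul]⟩

end Main

/-! ### Injectivity of reduction on torsion -/

section PointFormulas

open WeierstrassCurve

variable {K : Type*} [Field K] [DecidableEq K] {E : WeierstrassCurve K}

/-- Addition of two points that are not inverse to each other. The two equations for the slope `l`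
hold for distinct points and for equal ones. -/
theorem exists_add_some {x₁ y₁ x₂ y₂ : K} (h₁ : E.toAffine.Nonsingular x₁ y₁)
    (h₂ : E.toAffine.Nonsingular x₂ y₂) (h : ¬ (x₁ = x₂ ∧ y₁ = E.toAffine.negY x₂ y₂)) :
    ∃ (l x y : K) (h' : E.toAffine.Nonsingular x y),
      Affine.Point.some x₁ y₁ h₁ + Affine.Point.some x₂ y₂ h₂ = Affine.Point.some x y h' ∧
      x = l ^ 2 + E.a₁ * l - E.a₂ - x₁ - x₂ ∧ y = -(l * (x - x₁) + y₁) - E.a₁ * x - E.a₃ ∧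
      l * (x₁ - x₂) = y₁ - y₂ ∧
      l * (y₁ + y₂ + E.a₁ * x₂ + E.a₃) =
        x₁ ^ 2 + x₁ * x₂ + x₂ ^ 2 + E.a₂ * (x₁ + x₂) + E.a₄ - E.a₁ * y₁ := by
  refine ⟨E.toAffine.slope x₁ x₂ y₁ y₂, _, _, _, Affine.Point.add_some h, rfl, rfl, ?_⟩
  have e₁ := (Affine.equation_iff _ _).1 h₁.1
  have e₂ := (Affine.equation_iff _ _).1 h₂.1
  by_cases hx : x₁ = x₂
  · have hy : y₁ ≠ E.toAffine.negY x₂ y₂ := fun e => h ⟨hx, e⟩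
    have hyy := Affine.Y_eq_of_Y_ne h₁.1 h₂.1 hx hy
    subst hx hyy
    rw [Affine.slope_of_Y_ne rfl hy]
    have hD : y₁ - E.toAffine.negY x₁ y₁ ≠ 0 := sub_ne_zero.2 hy
    refine ⟨by simp, ?_⟩
    rw [show y₁ + y₁ + E.a₁ * x₁ + E.a₃ = y₁ - E.toAffine.negY x₁ y₁ by
      rw [Affine.negY]; ring, div_mul_cancel₀ _ hD]
    ring
  · have hx' := sub_ne_zero.2 hx
    rw [Affine.slope_of_X_ne hx]
    refine ⟨div_mul_cancel₀ _ hx', mul_right_cancel₀ hx' ?_⟩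
    rw [div_mul_eq_mul_div, div_mul_cancel₀ _ hx']
    linear_combination e₁ - e₂

theorem exists_two_smul_some {x y : K} (h : E.toAffine.Nonsingular x y)
    (hD : 2 * y + E.a₁ * x + E.a₃ ≠ 0) :
    ∃ (l x' y' : K) (h' : E.toAffine.Nonsingular x' y'),
      2 • Affine.Point.some x y h = Affine.Point.some x' y' h' ∧
      x' = l ^ 2 + E.a₁ * l - E.a₂ - 2 * x ∧ y' = -(l * (x' - x) + y) - E.a₁ * x' - E.a₃ ∧
      l * (2 * y + E.a₁ * x + E.a₃) = 3 * x ^ 2 + 2 * E.a₂ * x + E.a₄ - E.a₁ * y := by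
  obtain ⟨l, x', y', h', e, hx', hy', -, hl⟩ := exists_add_some h h fun e => hD (by
    have := e.2
    rw [Affine.negY] at this
    linear_combination this)
  exact ⟨l, x', y', h', by rw [two_smul, e], by rw [hx']; ring, hy', by linear_combination hl⟩

theorem two_smul_some_eq_zero {x y : K} (h : E.toAffine.Nonsingular x y)
    (hD : 2 * y + E.a₁ * x + E.a₃ = 0) : 2 • Affine.Point.some x y h = 0 := by
  rw [two_smul]
  refine Affine.Point.add_of_Y_eq rfl ?_
  rw [Affine.negY]
  linear_combination hD

/-- A point is divisible by `n` as soon as its `x`-coordinate is that of a multiple of `n`. -/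
theorem exists_nsmul_eq_of_X_eq {n : ℕ} {x y y' : K} {h : E.toAffine.Nonsingular x y}
    {h' : E.toAffine.Nonsingular x y'} {R : E.toAffine.Point}
    (hR : n • R = Affine.Point.some x y' h') : ∃ R, n • R = Affine.Point.some x y h := by
  rcases Affine.Y_eq_of_X_eq h'.1 h.1 rfl with e | e
  · subst e
    exact ⟨R, hR⟩
  · subst e
    exact ⟨-R, by
      rw [smul_neg, hR, Affine.Point.neg_some]
      exact (Affine.Point.some.injEq ..).mpr ⟨rfl, Affine.negY_negY ..⟩⟩

end PointFormulas

section Rigidity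

open WeierstrassCurve

/-- A set that does not contain `0` and is stable under multiplication by `ℓ` contains no `ℓ`-power
torsion. -/
theorem not_isPowTorsion_of_forall_smul {A : Type*} [AddCommGroup A] {ℓ : ℕ} {S : A → Prop}
    (h0 : ¬ S 0) (hS : ∀ P, S P → S (ℓ • P)) {P : A} (hP : S P) : ¬ IsPowTorsion ℓ P := by
  rintro ⟨n, hn⟩
  have h : ∀ n : ℕ, S (ℓ ^ n • P) := fun n => by
    induction n with
    | zero => simpa using hP
    | succ n ih =>
      rw [pow_succ', mul_smul]
      exact hS _ ih
  exact h0 (hn ▸ h n)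

variable {K : Type*} [NormedField K] [IsUltrametricDist K]

theorem norm_le_one_of_norm_quadratic_le_one {x b : K} (hb : ‖b‖ ≤ 1) (h : ‖x ^ 2 + b * x‖ ≤ 1) :
    ‖x‖ ≤ 1 := by
  by_contra! hx
  have h1 : ‖b * x‖ < ‖x ^ 2‖ := by
    rw [norm_mul, norm_pow]
    nlinarith [norm_nonneg b]
  rw [IsUltrametricDist.norm_add_eq_max_of_norm_ne_norm h1.ne', max_eq_left h1.le, norm_pow] at h
  nlinarith

variable [DecidableEq K]

/-- An integral Weierstrass equation with nonsingular reduction is rigid if multiplication by `ℓ`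
preserves the set of points with nonintegral `x`-coordinate: if `P` and `P'` have the same
reduction and `P - P'` is integral, then the slope of the line through `P` and `-P'` is integral,
and its two equations show that the reduction is singular at `P`. -/
theorem isRigid_of_norm {ℓ : ℕ} {E : WeierstrassCurve K} (h₁ : ‖E.a₁‖ ≤ 1) (h₂ : ‖E.a₂‖ ≤ 1)
    (h₃ : ‖E.a₃‖ ≤ 1) (h₄ : ‖E.a₄‖ ≤ 1) (h₆ : ‖E.a₆‖ ≤ 1)
    (hns : ∀ x y : K, ‖x‖ ≤ 1 → ‖y‖ ≤ 1 → ‖2 * y + E.a₁ * x + E.a₃‖ < 1 →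
      ¬ ‖3 * x ^ 2 + 2 * E.a₂ * x + E.a₄ - E.a₁ * y‖ < 1)
    (hbig : ∀ (x y : K) (h : E.toAffine.Nonsingular x y), 1 < ‖x‖ →
      ∃ x' y' h', ℓ • Affine.Point.some x y h = Affine.Point.some x' y' h' ∧ 1 < ‖x'‖) :
    IsRigid ℓ E := by
  have hint : ∀ {x y : K} {h : E.toAffine.Nonsingular x y},
      IsPowTorsion ℓ (Affine.Point.some x y h) → ‖x‖ ≤ 1 ∧ ‖y‖ ≤ 1 := by
    intro x y h hP
    have hx : ‖x‖ ≤ 1 := by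
      by_contra! hx
      refine not_isPowTorsion_of_forall_smul (ℓ := ℓ) (S := fun P : E.toAffine.Point =>
        ∃ x y h, P = .some x y h ∧ 1 < ‖x‖) ?_ ?_ ⟨x, y, h, rfl, hx⟩ hP
      · rintro ⟨x, y, h, e, -⟩
        exact Affine.Point.some_ne_zero h e.symm
      · rintro _ ⟨x, y, h, rfl, hx⟩
        exact hbig x y h hx
    refine ⟨hx, norm_le_one_of_norm_quadratic_le_one (b := E.a₁ * x + E.a₃)
      ((unitBall K).add_mem ((unitBall K).mul_mem h₁ hx) h₃) ?_⟩
    have e := (Affine.equation_iff _ _).1 h.1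
    rw [show y ^ 2 + (E.a₁ * x + E.a₃) * y = x ^ 3 + E.a₂ * x ^ 2 + E.a₄ * x + E.a₆ by
      linear_combination e]
    lift x to unitBall K using hx
    exact ((⟨x, x.2⟩ : unitBall K) ^ 3 + ⟨E.a₂, h₂⟩ * ⟨x, x.2⟩ ^ 2 + ⟨E.a₄, h₄⟩ * ⟨x, x.2⟩ +
      ⟨E.a₆, h₆⟩ : unitBall K).2
  refine ⟨hint, fun {x y x' y' h h'} hP hP' hxx hyy => ?_⟩
  by_contra hne
  have hneg : -Affine.Point.some x' y' h' = Affine.Point.some x' (E.toAffine.negY x' y')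
    ((Affine.nonsingular_neg x' y').2 h') := rfl
  have hsub : Affine.Point.some x y h + -Affine.Point.some x' y' h' ≠ 0 := by
    rw [← sub_eq_add_neg, sub_ne_zero]
    exact hne
  have ht := hP.add hP'.neg
  rw [hneg] at hsub ht
  have hnot : ¬ (x = x' ∧ y = E.toAffine.negY x' (E.toAffine.negY x' y')) := by
    rintro ⟨hx, hy⟩
    exact hsub (Affine.Point.add_of_Y_eq hx hy)
  obtain ⟨l, X, Y, hXY, e, hX, -, hl₁, hl₂⟩ := exists_add_some h
    ((Affine.nonsingular_neg x' y').2 h') hnot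
  rw [e] at ht
  have hXint := (hint ht).1
  obtain ⟨x, rfl⟩ : ∃ z : unitBall K, (z : K) = x := ⟨⟨x, hxx.left⟩, rfl⟩
  obtain ⟨x', rfl⟩ : ∃ z : unitBall K, (z : K) = x' := ⟨⟨x', hxx.right⟩, rfl⟩
  obtain ⟨y, rfl⟩ : ∃ z : unitBall K, (z : K) = y := ⟨⟨y, hyy.left⟩, rfl⟩
  obtain ⟨y', rfl⟩ : ∃ z : unitBall K, (z : K) = y' := ⟨⟨y', hyy.right⟩, rfl⟩
  obtain ⟨X, rfl⟩ : ∃ z : unitBall K, (z : K) = X := ⟨⟨X, hXint⟩, rfl⟩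
  obtain ⟨a₁, ha₁⟩ : ∃ z : unitBall K, (z : K) = E.a₁ := ⟨⟨_, h₁⟩, rfl⟩
  obtain ⟨a₂, ha₂⟩ : ∃ z : unitBall K, (z : K) = E.a₂ := ⟨⟨_, h₂⟩, rfl⟩
  obtain ⟨a₃, ha₃⟩ : ∃ z : unitBall K, (z : K) = E.a₃ := ⟨⟨_, h₃⟩, rfl⟩
  obtain ⟨a₄, ha₄⟩ : ∃ z : unitBall K, (z : K) = E.a₄ := ⟨⟨_, h₄⟩, rfl⟩
  have hx' : normReduce K x = normReduce K x' := normReduce_eq_iff.2 hxx.lt_one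
  have hy' : normReduce K y = normReduce K y' := normReduce_eq_iff.2 hyy.lt_one
  simp only [Affine.negY, ← ha₁, ← ha₂, ← ha₃, ← ha₄] at hX hl₁ hl₂ hns
  have hlint : ‖l‖ ≤ 1 := by
    refine norm_le_one_of_norm_quadratic_le_one (b := a₁) a₁.2 ?_
    rw [show l ^ 2 + a₁ * l = X + a₂ + x + x' by linear_combination -hX]
    exact (X + a₂ + x + x').2
  obtain ⟨l, rfl⟩ : ∃ z : unitBall K, (z : K) = l := ⟨⟨l, hlint⟩, rfl⟩
  have r₁ : l * (x - x') = y + y' + a₁ * x' + a₃ := Subtype.ext (by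
    push_cast
    linear_combination hl₁)
  have r₂ : l * (y - y') = x ^ 2 + x * x' + x' ^ 2 + a₂ * (x + x') + a₄ - a₁ * y :=
    Subtype.ext (by
      push_cast
      linear_combination hl₂)
  replace r₁ := congrArg (normReduce K) r₁
  replace r₂ := congrArg (normReduce K) r₂
  simp only [map_mul, map_sub, map_add, map_pow, ← hx', ← hy', sub_self, mul_zero] at r₁ r₂
  have s₁ : normReduce K (2 * y + a₁ * x + a₃) = 0 := by
    simp only [map_mul, map_add, map_ofNat]
    linear_combination -r₁
  have s₂ : normReduce K (3 * x ^ 2 + 2 * a₂ * x + a₄ - a₁ * y) = 0 := by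
    simp only [map_mul, map_sub, map_add, map_pow, map_ofNat]
    linear_combination -r₂
  exact hns x y x.2 y.2 (normReduce_eq_zero_iff.1 s₁) (normReduce_eq_zero_iff.1 s₂)

end Rigidity

/-! ### Supersingular reduction in characteristic `3` -/

section SupersingularThree

open WeierstrassCurve

variable {K : Type*} [NormedField K]

/-- The curve `y² = x³ + a x² - x`. For `‖a‖ < 1` its reduction in characteristic `3` is the
supersingular curve `y² = x³ - x`. -/
def supersingularThree (a : K) : WeierstrassCurve K := ⟨0, a, 0, -1, 0⟩

variable {a : K}

theorem equation_supersingularThree {x y : K} :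
    (supersingularThree a).toAffine.Equation x y ↔ y ^ 2 = x ^ 3 + a * x ^ 2 - x := by
  rw [Affine.equation_iff]
  simp only [supersingularThree, zero_mul, add_zero, neg_one_mul, sub_eq_add_neg]

section

variable [DecidableEq K]

/-- The duplication formula. -/
theorem two_smul_supersingularThree (h2 : (2 : K) ≠ 0) {x y : K}
    (h : (supersingularThree a).toAffine.Nonsingular x y) (hy : y ≠ 0) :
    ∃ x' y' h', 2 • Affine.Point.some x y h = Affine.Point.some x' y' h' ∧
      4 * y ^ 2 * x' = (x ^ 2 + 1) ^ 2 := by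
  obtain ⟨l, x', y', h', e, hx', -, hl⟩ := exists_two_smul_some h (by
    simpa [supersingularThree, h2] using hy)
  refine ⟨x', y', h', e, ?_⟩
  have e₁ := equation_supersingularThree.1 h.1
  simp only [supersingularThree] at hl hx'
  rw [hx']
  linear_combination (2 * y * l + (3 * x ^ 2 + 2 * a * x - 1)) * hl - (4 * a + 8 * x) * e₁

end

variable [IsUltrametricDist K]

theorem norm_two_of_norm_three_lt_one (h3 : ‖(3 : K)‖ < 1) : ‖(2 : K)‖ = 1 := by
  rw [show (2 : K) = -1 + 3 by norm_num, IsUltrametricDist.norm_add_eq_max_of_norm_ne_norm,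
    max_eq_left] <;> rw [norm_neg, norm_one]
  exacts [h3.le, h3.ne']

theorem nonsingular_supersingularThree (h3 : ‖(3 : K)‖ < 1) (ha : ‖a‖ < 1) {x y : K}
    (h : y ^ 2 = x ^ 3 + a * x ^ 2 - x) : (supersingularThree a).toAffine.Nonsingular x y := by
  refine (Affine.equation_iff_nonsingular_of_Δ_ne_zero ?_).1 (equation_supersingularThree.2 h)
  have h2 : ‖(2 : K)‖ = 1 := norm_two_of_norm_three_lt_one h3
  have hΔ : (supersingularThree a).Δ = 2 ^ 4 * (a ^ 2 + 2 ^ 2) := by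
    simp only [WeierstrassCurve.Δ, WeierstrassCurve.b₂, WeierstrassCurve.b₄,
      WeierstrassCurve.b₆, WeierstrassCurve.b₈, supersingularThree]
    ring
  change (supersingularThree a).Δ ≠ 0
  have ha2 : ‖a ^ 2‖ < 1 := by
    rw [norm_pow]
    exact pow_lt_one₀ (norm_nonneg _) ha two_ne_zero
  rw [hΔ, ← norm_ne_zero_iff, norm_mul, norm_pow, h2, one_pow, one_mul,
    IsUltrametricDist.norm_add_eq_max_of_norm_ne_norm] <;> rw [norm_pow 2, h2, one_pow]
  · exact (lt_max_of_lt_right one_pos).ne'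
  · exact ha2.ne

variable [DecidableEq K]

/-- The duplication formula preserves `‖x‖` if `‖x‖ > 1`. -/
theorem isRigid_supersingularThree (h3 : ‖(3 : K)‖ < 1) (ha : ‖a‖ < 1) :
    IsRigid 2 (supersingularThree a) := by
  have h2 : ‖(2 : K)‖ = 1 := norm_two_of_norm_three_lt_one h3
  refine isRigid_of_norm (by simp [supersingularThree]) ha.le (by simp [supersingularThree])
    (by simp [supersingularThree]) (by simp [supersingularThree]) (fun x y hx hy _ h => ?_)
    (fun x y h hx => ?_)
  · -- the derivative `3 x² + 2 a x - 1` reduces to `-1`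
    simp only [supersingularThree] at h
    obtain ⟨x, rfl⟩ : ∃ z : unitBall K, (z : K) = x := ⟨⟨x, hx⟩, rfl⟩
    obtain ⟨a, rfl⟩ : ∃ z : unitBall K, (z : K) = a := ⟨⟨a, ha.le⟩, rfl⟩
    have h0 : normReduce K (3 * x ^ 2 + 2 * a * x - 1) = 0 := normReduce_eq_zero_iff.2 (by
      push_cast
      convert h using 2
      ring)
    have h3' : normReduce K 3 = 0 := normReduce_eq_zero_iff.2 h3
    simp only [map_mul, map_sub, map_add, map_pow, map_one, h3',
      normReduce_eq_zero_iff.2 ha] at h0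
    simp at h0
  · -- for `‖x‖ > 1` one has `‖y‖² = ‖x‖³`
    have e₁ := equation_supersingularThree.1 h.1
    have hy : ‖y‖ ^ 2 = ‖x‖ ^ 3 := by
      have h1 : ‖a * x ^ 2 - x‖ < ‖x ^ 3‖ := by
        rw [sub_eq_add_neg]
        refine (IsUltrametricDist.norm_add_le_max _ _).trans_lt (max_lt ?_ ?_)
        · rw [norm_mul, norm_pow, norm_pow]
          nlinarith [norm_nonneg a, sq_nonneg ‖x‖, mul_pos (zero_lt_one.trans hx) (zero_lt_one.trans hx)]
        · rw [norm_neg, norm_pow]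
          nlinarith [mul_pos (zero_lt_one.trans hx) (zero_lt_one.trans hx)]
      rw [← norm_pow, e₁, add_sub_assoc, IsUltrametricDist.norm_add_eq_max_of_norm_ne_norm h1.ne',
        max_eq_left h1.le, norm_pow]
    have hx0 : 0 < ‖x‖ := zero_lt_one.trans hx
    have hy0 : y ≠ 0 := by
      rintro rfl
      rw [norm_zero, zero_pow two_ne_zero] at hy
      exact (pow_pos hx0 3).ne hy
    obtain ⟨x', y', h', e, hx'⟩ := two_smul_supersingularThree (norm_ne_zero_iff.1 (by
      rw [h2]; exact one_ne_zero)) h hy0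
    refine ⟨x', y', h', e, ?_⟩
    have h1 : ‖x ^ 2 + 1‖ = ‖x‖ ^ 2 := by
      rw [IsUltrametricDist.norm_add_eq_max_of_norm_ne_norm] <;> rw [norm_pow, norm_one]
      · exact max_eq_left (one_le_pow₀ hx.le)
      · exact (one_lt_pow₀ hx two_ne_zero).ne'
    have h4 := congrArg norm hx'
    rw [show (4 : K) = 2 ^ 2 by norm_num, norm_mul, norm_mul, norm_pow, norm_pow, norm_pow, h1, h2,
      hy, one_pow, one_mul] at h4
    have h5 : ‖x'‖ = ‖x‖ := mul_left_cancel₀ (pow_pos hx0 3).ne' (by rw [h4]; ring)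
    rwa [h5]

/-- The identity `-3 (x, y) = (x⁹, y⁹)` on the curve `y² = x³ - x` in characteristic `3`, where the
tangent at `(x, y)` has slope `1 / y` and the chord through `(x, y)` and its double has slope
`y³ - 1 / y`. If `y` reduces to `0`, then the point has order `2`. -/
theorem neg_three_smul_supersingularThree (h3 : ‖(3 : K)‖ < 1) (ha : ‖a‖ < 1) {x y : K}
    {h : (supersingularThree a).toAffine.Nonsingular x y}
    (hP : IsPowTorsion 2 (Affine.Point.some x y h)) : ∃ x' y' h',
      -(3 • Affine.Point.some x y h) = Affine.Point.some x' y' h' ∧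
      NormCong x' (x ^ 3 ^ 2) ∧ NormCong y' (y ^ 3 ^ 2) := by
  have hE := isRigid_supersingularThree h3 ha
  have h2 : ‖(2 : K)‖ = 1 := norm_two_of_norm_three_lt_one h3
  obtain ⟨hx, hy⟩ := hE.integral hP
  have e₁ := equation_supersingularThree.1 h.1
  have h3' : (3 : NormResidueField K) = 0 := by
    rw [← map_ofNat (normReduce K) 3]
    exact normReduce_eq_zero_iff.2 h3
  obtain ⟨A, hA⟩ : ∃ z : unitBall K, (z : K) = a := ⟨⟨a, ha.le⟩, rfl⟩
  have hA' : normReduce K A = 0 := normReduce_eq_zero_iff.2 (hA ▸ ha)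
  obtain ⟨X, hX⟩ : ∃ z : unitBall K, (z : K) = x := ⟨⟨x, hx⟩, rfl⟩
  obtain ⟨Y, hY⟩ : ∃ z : unitBall K, (z : K) = y := ⟨⟨y, hy⟩, rfl⟩
  have r₁ : Y ^ 2 = X ^ 3 + A * X ^ 2 - X := Subtype.ext (by
    push_cast
    rw [hX, hY, hA, e₁])
  replace r₁ := congrArg (normReduce K) r₁
  simp only [map_mul, map_sub, map_add, map_pow, hA', zero_mul, add_zero] at r₁
  have hneg : -Affine.Point.some x y h = Affine.Point.some x ((supersingularThree a).toAffine.negY x y)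
    ((Affine.nonsingular_neg x y).2 h) := rfl
  have hnegY : (supersingularThree a).toAffine.negY x y = -y := by
    simp [Affine.negY, supersingularThree]
  by_cases hy1 : ‖y‖ < 1
  · -- `P` and `-P` have the same reduction
    have hY0 : normReduce K Y = 0 := normReduce_eq_zero_iff.2 (hY ▸ hy1)
    have hPP : Affine.Point.some x y h = -Affine.Point.some x y h := by
      have ht := hP.neg
      rw [hneg] at ht ⊢
      refine hE.injective hP ht (NormCong.refl hx) ⟨hy, by rwa [hnegY, norm_neg], ?_⟩
      rw [hnegY, sub_neg_eq_add]
      exact (IsUltrametricDist.norm_add_le_max _ _).trans_lt (max_lt hy1 hy1)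
    have h3P : -(3 • Affine.Point.some x y h) = Affine.Point.some x y h := by
      have h0 : 2 • Affine.Point.some x y h = 0 := by
        rw [two_smul]
        nth_rw 2 [hPP]
        exact add_neg_cancel _
      rw [show (3 : ℕ) = 2 + 1 from rfl, add_smul, h0, one_smul, zero_add, ← hPP]
    refine ⟨x, y, h, h3P, ?_, ?_⟩
    · rw [← hX]
      refine (NormCong.iff_normReduce X.2 (X ^ 3 ^ 2).2).2 ?_
      change normReduce K X = normReduce K (X ^ 3 ^ 2)
      rw [hY0] at r₁
      rw [map_pow]
      generalize normReduce K X = X at *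
      linear_combination (X ^ 2 + 1) * (X ^ 4 + 1) * r₁
    · rw [← hY]
      refine (NormCong.iff_normReduce Y.2 (Y ^ 3 ^ 2).2).2 ?_
      change normReduce K Y = normReduce K (Y ^ 3 ^ 2)
      rw [map_pow, hY0, zero_pow (by norm_num)]
  · have hy1 : ‖y‖ = 1 := le_antisymm hy (not_lt.1 hy1)
    have hy0 : y ≠ 0 := norm_ne_zero_iff.1 (by rw [hy1]; exact one_ne_zero)
    have h20 : (2 : K) ≠ 0 := norm_ne_zero_iff.1 (by rw [h2]; exact one_ne_zero)
    obtain ⟨l, x₂, y₂, h₂, e₂, hx₂, hy₂, hl⟩ := exists_two_smul_some h (by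
      simpa [supersingularThree, h20] using hy0)
    simp only [supersingularThree] at hx₂ hy₂ hl
    have hYr : normReduce K Y ≠ 0 := fun h0 =>
      (normReduce_eq_zero_iff.1 h0).ne (by rw [hY, hy1])
    have hlint : ‖l‖ ≤ 1 := by
      have h5 := congrArg norm hl
      rw [zero_mul, add_zero, add_zero, norm_mul, norm_mul, h2, hy1, one_mul, mul_one] at h5
      rw [h5, ← hX, ← hA, zero_mul, sub_zero]
      exact (3 * X ^ 2 + 2 * A * X + -1 : unitBall K).2
    obtain ⟨L, hL⟩ : ∃ z : unitBall K, (z : K) = l := ⟨⟨l, hlint⟩, rfl⟩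
    obtain ⟨X₂, hX₂⟩ : ∃ z : unitBall K, (z : K) = x₂ := ⟨L ^ 2 - A - 2 * X, by
      push_cast
      rw [hx₂, hL, hA, hX]
      ring⟩
    obtain ⟨Y₂, hY₂⟩ : ∃ z : unitBall K, (z : K) = y₂ := ⟨-(L * (X₂ - X) + Y), by
      push_cast
      rw [hy₂, hL, hX₂, hX, hY]
      ring⟩
    have r₂ : L * (2 * Y) = 3 * X ^ 2 + 2 * A * X - 1 := Subtype.ext (by
      push_cast
      rw [hL, hY, hX, hA]
      linear_combination hl)
    have r₃ : X₂ = L ^ 2 - A - 2 * X := Subtype.ext (by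
      push_cast
      rw [hX₂, hL, hA, hX, hx₂]
      ring)
    have r₄ : Y₂ = -(L * (X₂ - X) + Y) := Subtype.ext (by
      push_cast
      rw [hY₂, hL, hX₂, hX, hY, hy₂]
      ring)
    replace r₂ := congrArg (normReduce K) r₂
    replace r₃ := congrArg (normReduce K) r₃
    replace r₄ := congrArg (normReduce K) r₄
    simp only [map_mul, map_sub, map_add, map_pow, map_neg, map_one, map_ofNat, hA', zero_mul,
      add_zero, mul_zero, sub_zero] at r₂ r₃ r₄
    have hLY : normReduce K L * normReduce K Y = 1 := by
      linear_combination -r₂ + (normReduce K L * normReduce K Y - normReduce K X ^ 2) * h3'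
    have hL0 : normReduce K L ≠ 0 := left_ne_zero_of_mul_eq_one hLY
    have hne : ¬ (x₂ = x ∧ y₂ = (supersingularThree a).toAffine.negY x y) := by
      rintro ⟨h0, -⟩
      have h0' : X₂ = X := Subtype.ext (by rw [hX₂, hX, h0])
      rw [h0'] at r₃
      exact pow_ne_zero 2 hL0 (by linear_combination -r₃ + normReduce K X * h3')
    obtain ⟨m, x₃, y₃, h₃, e₃, hx₃, hy₃, hm, -⟩ := exists_add_some h₂ h hne
    have hmint : ‖m‖ ≤ 1 := by
      have h5 := congrArg norm hm
      have h6 : ‖x₂ - x‖ = 1 := by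
        refine le_antisymm ?_ (not_lt.1 fun h0 => ?_)
        · rw [← hX₂, ← hX]
          exact (X₂ - X).2
        · rw [← hX₂, ← hX] at h0
          have h7 := normReduce_eq_iff.2 h0
          exact pow_ne_zero 2 hL0 (by linear_combination -r₃ + h7 + normReduce K X * h3')
      rw [norm_mul, h6, mul_one] at h5
      rw [h5, ← hY₂, ← hY]
      exact (Y₂ - Y).2
    simp only [supersingularThree] at hx₃ hy₃
    obtain ⟨M, hM⟩ : ∃ z : unitBall K, (z : K) = m := ⟨⟨m, hmint⟩, rfl⟩
    obtain ⟨X₃, hX₃⟩ : ∃ z : unitBall K, (z : K) = x₃ := ⟨M ^ 2 - A - X₂ - X, by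
      push_cast
      rw [hx₃, hM, hA, hX, hX₂]
      ring⟩
    obtain ⟨Y₃, hY₃⟩ : ∃ z : unitBall K, (z : K) = y₃ := ⟨-(M * (X₃ - X₂) + Y₂), by
      push_cast
      rw [hy₃, hM, hX₃, hX₂, hY₂]
      ring⟩
    have r₅ : M * (X₂ - X) = Y₂ - Y := Subtype.ext (by
      push_cast
      rw [hM, hX₂, hX, hY₂, hY, hm])
    have r₆ : X₃ = M ^ 2 - A - X₂ - X := Subtype.ext (by
      push_cast
      rw [hX₃, hM, hA, hX₂, hX, hx₃]
      ring)
    have r₇ : Y₃ = -(M * (X₃ - X₂) + Y₂) := Subtype.ext (by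
      push_cast
      rw [hY₃, hM, hX₃, hX₂, hY₂, hy₃]
      ring)
    replace r₅ := congrArg (normReduce K) r₅
    replace r₆ := congrArg (normReduce K) r₆
    replace r₇ := congrArg (normReduce K) r₇
    simp only [map_mul, map_sub, map_add, map_pow, map_neg, hA', sub_zero] at r₅ r₆ r₇
    have h3P : -(3 • Affine.Point.some x y h) = Affine.Point.some x₃
        ((supersingularThree a).toAffine.negY x₃ y₃) ((Affine.nonsingular_neg x₃ y₃).2 h₃) := by
      rw [show (3 : ℕ) = 2 + 1 from rfl, add_smul, one_smul, e₂, e₃]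
      rfl
    have hnegY₃ : (supersingularThree a).toAffine.negY x₃ y₃ = -y₃ := by
      simp [Affine.negY, supersingularThree]
    have key : normReduce K X₃ = normReduce K X ^ 9 ∧ -normReduce K Y₃ = normReduce K Y ^ 9 := by
      generalize normReduce K X = x at *
      generalize normReduce K Y = y at *
      generalize normReduce K L = l at *
      generalize normReduce K X₂ = x₂ at *
      generalize normReduce K Y₂ = y₂ at *
      generalize normReduce K M = m at *
      generalize normReduce K X₃ = x₃ at *
      generalize normReduce K Y₃ = y₃ at *
      have t₁ : x₂ = l ^ 2 + x := by linear_combination r₃ - x * h3'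
      have t₂ : y₂ = -(l ^ 3 + y) := by rw [r₄, t₁]; ring
      have t₃ : m = y ^ 3 - l := by
        rw [t₁, t₂] at r₅
        linear_combination y ^ 2 * r₅ - m * (l * y + 1) * hLY - l * (l * y + 1) * hLY -
          y ^ 3 * h3'
      have t₄ : x₃ = y ^ 6 + y ^ 2 + x := by
        rw [r₆, t₁, t₃]
        linear_combination -2 * y ^ 2 * hLY - (y ^ 2 + x) * h3'
      refine ⟨?_, ?_⟩
      · rw [t₄]
        linear_combination (y ^ 4 + y ^ 2 * (x ^ 3 - x) + (x ^ 3 - x) ^ 2 + 1) * r₁ +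
          (x ^ 5 - x ^ 7) * h3'
      · rw [r₇, t₄, t₁, t₂, t₃]
        linear_combination (-(l * y + 1) * y - y ^ 5 - y) * hLY + (-y) * h3'
    refine ⟨x₃, _, _, h3P, ?_, ?_⟩
    · rw [← hX₃, ← hX]
      refine (NormCong.iff_normReduce X₃.2 (X ^ 3 ^ 2).2).2 (key.1.trans ?_)
      exact (map_pow _ _ _).symm
    · rw [hnegY₃, ← hY₃, ← hY]
      refine (NormCong.iff_normReduce (-Y₃).2 (Y ^ 3 ^ 2).2).2 ?_
      exact (map_neg _ _).trans (key.2.trans (map_pow _ _ _).symm)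

theorem exists_two_smul_eq_supersingularThree [IsAlgClosed K] (h3 : ‖(3 : K)‖ < 1) (ha : ‖a‖ < 1)
    (P : (supersingularThree a).toAffine.Point) : ∃ R, 2 • R = P := by
  rcases P with _ | ⟨x, y, h⟩
  · exact ⟨0, smul_zero _⟩
  have h2 : ‖(2 : K)‖ = 1 := norm_two_of_norm_three_lt_one h3
  have h20 : (2 : K) ≠ 0 := norm_ne_zero_iff.1 (by rw [h2]; exact one_ne_zero)
  -- the `x`-coordinate of a half of `P` is a root of a quartic polynomial
  obtain ⟨z, hz⟩ : ∃ z : K, z ^ 4 - 4 * x * z ^ 3 + (2 - 4 * a * x) * z ^ 2 + 4 * x * z + 1 = 0 := by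
    have hdeg : (X ^ 4 - C (4 * x) * X ^ 3 + C (2 - 4 * a * x) * X ^ 2 + C (4 * x) * X + C 1 :
        K[X]).degree = 4 := by
      compute_degree!
    obtain ⟨z, hz⟩ := IsAlgClosed.exists_root _ (hdeg.trans_ne (by norm_num))
    refine ⟨z, ?_⟩
    simpa [IsRoot] using hz
  obtain ⟨w, hw⟩ := IsAlgClosed.exists_pow_nat_eq (z ^ 3 + a * z ^ 2 - z) (n := 2) (by norm_num)
  have hzx : (z ^ 2 + 1) ^ 2 = 4 * w ^ 2 * x := by
    rw [hw]
    linear_combination hz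
  have hw0 : w ≠ 0 := by
    rintro rfl
    have h1 : z ^ 2 = -1 := by
      have : (z ^ 2 + 1) ^ 2 = 0 := by rw [hzx]; ring
      linear_combination pow_eq_zero_iff two_ne_zero |>.1 this
    have h4 : a * z = 2 := by
      linear_combination z * hw + (a * z + z ^ 2 - 2) * h1
    have hz1 : ‖z‖ ≤ 1 := norm_le_one_of_norm_pow_le_one two_ne_zero (by rw [h1]; simp)
    have := congrArg norm h4
    rw [norm_mul, h2] at this
    nlinarith [norm_nonneg a, norm_nonneg z]
  obtain ⟨x', y', h', e, hx'⟩ := two_smul_supersingularThree h20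
    (nonsingular_supersingularThree h3 ha hw) hw0
  have hxx : x' = x := by
    rw [hzx] at hx'
    refine mul_left_cancel₀ (mul_ne_zero ?_ (pow_ne_zero 2 hw0)) hx'
    rw [show (4 : K) = 2 * 2 by norm_num]
    exact mul_ne_zero h20 h20
  subst hxx
  exact exists_nsmul_eq_of_X_eq e

/-- On the reduction `y² = x³ - x`, the automorphism `J` is `(x, y) ↦ (-x, ζ³ y)`, so that
`J² = -1`. Its fixed points are `0` and `Q = (0, 0)`. -/
theorem isSupersingularModel_supersingularThree [IsAlgClosed K] (h3 : ‖(3 : K)‖ < 1)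
    (ha : ‖a‖ < 1) : IsSupersingularModel 3 2 0 (supersingularThree a) where
  toIsRigid := isRigid_supersingularThree h3 ha
  divisible := exists_two_smul_eq_supersingularThree h3 ha
  neg_prime_smul := neg_three_smul_supersingularThree h3 ha
  rotation := by
    intro ζ J hζ hJ
    have hE := isRigid_supersingularThree h3 ha
    have h2 : ‖(2 : K)‖ = 1 := norm_two_of_norm_three_lt_one h3
    have hζ2 : ζ ^ 2 = -1 := by
      have h1 : (ζ ^ 2 - 1) * (ζ ^ 2 + 1) = 0 := by linear_combination hζ.pow_eq_one
      refine eq_neg_of_add_eq_zero_left ((mul_eq_zero.1 h1).resolve_left fun h => ?_)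
      exact hζ.pow_ne_one_of_pos_of_lt two_ne_zero (by norm_num) (sub_eq_zero.1 h)
    have hζn : ‖ζ‖ ≤ 1 := norm_le_one_of_norm_pow_le_one two_ne_zero (by rw [hζ2]; simp)
    have hζc : NormCong ζ ζ := .refl hζn
    have h00 : (supersingularThree a).toAffine.Nonsingular 0 0 :=
      nonsingular_supersingularThree h3 ha (by ring)
    have hQt : IsPowTorsion 2 (Affine.Point.some 0 0 h00) := ⟨1, by
      rw [pow_one]
      exact two_smul_some_eq_zero h00 (by simp [supersingularThree])⟩
    refine ⟨fun P hP => ?_, .some 0 0 h00, Affine.Point.some_ne_zero _, hQt, ?_, fun P hP hJP => ?_⟩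
    · rcases P with _ | ⟨x, y, h⟩
      · rw [← Affine.Point.zero_def]
        simp
      obtain ⟨x', y', h', e', hx', hy'⟩ := hJ x y h hP
      have hP' := hP.map J
      rw [e'] at hP'
      obtain ⟨x'', y'', h'', e'', hx'', hy''⟩ := hJ x' y' h' hP'
      have hP'' := hP'.map J
      rw [e', zero_smul, add_zero, e'', add_eq_zero_iff_eq_neg]
      rw [e''] at hP''
      refine hE.injective hP'' hP.neg ?_ ?_
      · have := hx''.trans ((hζc.pow 2).mul hx')
        rw [hζ2] at this
        simpa using this
      · have := hy''.trans ((hζc.pow 3).mul hy')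
        rw [show ζ ^ 3 * (ζ ^ 3 * y) = (ζ ^ 2) ^ 3 * y by ring, hζ2] at this
        simpa [Affine.negY, supersingularThree, pow_succ] using this
    · obtain ⟨x', y', h', e', hx', hy'⟩ := hJ 0 0 h00 hQt
      have hQ' := hQt.map J
      rw [e'] at hQ' ⊢
      exact hE.injective hQ' hQt (by simpa using hx') (by simpa using hy')
    · rcases P with _ | ⟨x, y, h⟩
      · exact ⟨0, by rw [zero_smul]; rfl⟩
      obtain ⟨hx, hy⟩ := hE.integral hP
      obtain ⟨x', y', h', e', hx', hy'⟩ := hJ x y h hP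
      rw [e'] at hJP
      obtain ⟨rfl, rfl⟩ := (Affine.Point.some.injEq ..).mp hJP
      have hx1 : ‖x'‖ < 1 := by
        have := hx'.lt_one
        rwa [hζ2, show x' - -1 * x' = 2 * x' by ring, norm_mul, h2, one_mul] at this
      have hy1 : ‖y'‖ < 1 := by
        have e₁ := congrArg norm (equation_supersingularThree.1 h.1)
        rw [show x' ^ 3 + a * x' ^ 2 - x' = x' * (x' ^ 2 + a * x' - 1) by ring, norm_mul,
          norm_pow] at e₁
        have h1 : ‖x' ^ 2 + a * x' - 1‖ ≤ 1 :=
          (unitBall K).sub_mem ((unitBall K).add_mem ((unitBall K).pow_mem hx 2)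
            ((unitBall K).mul_mem ha.le hx)) (unitBall K).one_mem
        have h4 : ‖y'‖ ^ 2 < 1 := by
          rw [e₁]
          exact (mul_le_of_le_one_right (norm_nonneg _) h1).trans_lt hx1
        exact (pow_lt_one_iff_of_nonneg (norm_nonneg _) two_ne_zero).1 h4
      refine ⟨1, ?_⟩
      rw [one_smul]
      exact hE.injective hP hQt ⟨hx, by simp, by simpa using hx1⟩ ⟨hy, by simp, by simpa using hy1⟩

end SupersingularThree

/-! ### Supersingular reduction in characteristic `2` -/

section SupersingularTwo

open WeierstrassCurve

variable {K : Type*} [NormedField K]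

/-- The curve `y² + a x y + y = x³`. For `‖a‖ < 1` its reduction in characteristic `2` is the
supersingular curve `y² + y = x³`. -/
def supersingularTwo (a : K) : WeierstrassCurve K := ⟨a, 0, 1, 0, 0⟩

variable {a : K}

theorem equation_supersingularTwo {x y : K} :
    (supersingularTwo a).toAffine.Equation x y ↔ y ^ 2 + a * x * y + y = x ^ 3 := by
  rw [Affine.equation_iff]
  simp only [supersingularTwo, zero_mul, add_zero, one_mul]

section

variable [DecidableEq K]

/-- The triplication formula, where `x (3 x³ + a² x² + 3 a x + 3)` is the `3`-division
polynomial. -/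
theorem three_smul_supersingularTwo {x y D ψ : K} (hD : D = 2 * y + a * x + 1)
    (hψ : ψ = x * (3 * x ^ 3 + a ^ 2 * x ^ 2 + 3 * a * x + 3))
    (h : (supersingularTwo a).toAffine.Nonsingular x y) (hψ0 : ψ ≠ 0) :
    ∃ x' y' h', 3 • Affine.Point.some x y h = Affine.Point.some x' y' h' ∧
      ψ ^ 2 * x' = x * ψ ^ 2 - (6 * x ^ 2 + a ^ 2 * x + a) * D ^ 2 * ψ + D ^ 6 := by
  by_cases hD0 : D = 0
  · refine ⟨x, y, h, ?_, by rw [hD0]; ring⟩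
    rw [show (3 : ℕ) = 2 + 1 from rfl, add_smul, two_smul_some_eq_zero h (by
      rw [← hD0, hD]; simp [supersingularTwo]), one_smul, zero_add]
  have e₁ := equation_supersingularTwo.1 h.1
  obtain ⟨l, x₂, y₂, h₂, e₂, hx₂, hy₂, hl⟩ := exists_two_smul_some h (by
    simpa [supersingularTwo, hD] using hD0)
  simp only [supersingularTwo] at hx₂ hy₂ hl
  have hlD : l * D = 3 * x ^ 2 - a * y := by
    rw [hD]
    linear_combination hl
  have hψx : D ^ 2 * (x₂ - x) = -ψ := by
    have h1 : D ^ 2 * (x₂ - x) = (l * D) ^ 2 + a * (l * D) * D - 3 * x * D ^ 2 := by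
      rw [hx₂]
      ring
    rw [h1, hlD, hψ, hD]
    linear_combination (-a ^ 2 - 12 * x) * e₁
  have hx₂x : x₂ - x ≠ 0 := fun h0 => hψ0 (by rw [← neg_eq_zero, ← hψx, h0, mul_zero])
  obtain ⟨m, x₃, y₃, h₃, e₃, hx₃, -, hm, -⟩ := exists_add_some h₂ h fun e => hx₂x (sub_eq_zero.2 e.1)
  refine ⟨x₃, y₃, h₃, by rw [show (3 : ℕ) = 2 + 1 from rfl, add_smul, one_smul, e₂, e₃], ?_⟩
  simp only [supersingularTwo] at hx₃
  -- the slope of the line through `P` and `2 P`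
  have hmψ : (m + l + a) * ψ = D ^ 3 := by
    have h1 : (m + l + a) * (x₂ - x) = -D := by
      rw [hD]
      linear_combination hm + hy₂
    linear_combination (m + l + a) * hψx - D ^ 2 * h1
  have hx₃' : x₃ = (m + l + a) ^ 2 - (2 * l + a) * (m + l + a) + x := by
    rw [hx₃, hx₂]
    ring
  have hlD' : (2 * l + a) * D = 6 * x ^ 2 + a ^ 2 * x + a := by
    rw [add_mul, mul_assoc, hlD, hD]
    ring
  rw [hx₃', ← hlD']
  generalize m + l + a = δ at *
  linear_combination (δ * ψ + D ^ 3 - (2 * l + a) * ψ) * hmψ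

end

variable [IsUltrametricDist K]

theorem norm_add_lt {x y : K} {r : ℝ} (hx : ‖x‖ < r) (hy : ‖y‖ < r) : ‖x + y‖ < r :=
  (IsUltrametricDist.norm_add_le_max _ _).trans_lt (max_lt hx hy)

theorem norm_three_of_norm_two_lt_one (h2 : ‖(2 : K)‖ < 1) : ‖(3 : K)‖ = 1 := by
  rw [show (3 : K) = 1 + 2 by norm_num, IsUltrametricDist.norm_add_eq_max_of_norm_ne_norm,
    max_eq_left] <;> rw [norm_one]
  exacts [h2.le, h2.ne']

theorem nonsingular_supersingularTwo (h2 : ‖(2 : K)‖ < 1) (ha : ‖a‖ < 1) {x y : K}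
    (h : y ^ 2 + a * x * y + y = x ^ 3) : (supersingularTwo a).toAffine.Nonsingular x y := by
  refine (Affine.equation_iff_nonsingular_of_Δ_ne_zero ?_).1 (equation_supersingularTwo.2 h)
  have h3 : ‖(3 : K)‖ = 1 := norm_three_of_norm_two_lt_one h2
  have hΔ : (supersingularTwo a).Δ = a ^ 3 + -3 ^ 3 := by
    simp only [WeierstrassCurve.Δ, WeierstrassCurve.b₂, WeierstrassCurve.b₄,
      WeierstrassCurve.b₆, WeierstrassCurve.b₈, supersingularTwo]
    ring
  change (supersingularTwo a).Δ ≠ 0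
  have ha3 : ‖a ^ 3‖ < 1 := by
    rw [norm_pow]
    exact pow_lt_one₀ (norm_nonneg _) ha three_ne_zero
  rw [hΔ, ← norm_ne_zero_iff, IsUltrametricDist.norm_add_eq_max_of_norm_ne_norm] <;>
    rw [norm_neg, norm_pow 3, h3, one_pow]
  · exact (lt_max_of_lt_right one_pos).ne'
  · exact ha3.ne

variable [DecidableEq K]

/-- The triplication formula preserves `‖x‖` if `‖x‖ > 1`: every other term of its numerator is
smaller than `x ψ²`. -/
theorem isRigid_supersingularTwo (h2 : ‖(2 : K)‖ < 1) (ha : ‖a‖ < 1) :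
    IsRigid 3 (supersingularTwo a) := by
  have h3 : ‖(3 : K)‖ = 1 := norm_three_of_norm_two_lt_one h2
  refine isRigid_of_norm ha.le (by simp [supersingularTwo]) (by simp [supersingularTwo])
    (by simp [supersingularTwo]) (by simp [supersingularTwo]) (fun x y hx hy h _ => ?_)
    (fun x y h hx => ?_)
  · -- the derivative `2 y + a x + 1` reduces to `1`
    simp only [supersingularTwo] at h
    refine absurd h (not_lt.2 ?_)
    have h1 : ‖2 * y + a * x‖ < 1 := norm_add_lt
      (by rw [norm_mul]; exact (mul_le_of_le_one_right (norm_nonneg _) hy).trans_lt h2)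
      (by rw [norm_mul]; exact (mul_le_of_le_one_right (norm_nonneg _) hx).trans_lt ha)
    rw [IsUltrametricDist.norm_add_eq_max_of_norm_ne_norm] <;> rw [norm_one]
    · exact le_max_right _ _
    · exact h1.ne
  · have e₁ := equation_supersingularTwo.1 h.1
    have hx0 : 0 < ‖x‖ := zero_lt_one.trans hx
    set D := 2 * y + a * x + 1 with hD
    set ψ := x * (3 * x ^ 3 + a ^ 2 * x ^ 2 + 3 * a * x + 3) with hψ
    have h6 : ‖(6 : K)‖ < 1 := by
      rw [show (6 : K) = 2 * 3 by norm_num, norm_mul, h3, mul_one]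
      exact h2
    have h4 : ‖(4 : K)‖ < 1 := by
      rw [show (4 : K) = 2 * 2 by norm_num, norm_mul]
      nlinarith [norm_nonneg (2 : K)]
    have hx1 : ‖x‖ < ‖x‖ ^ 2 := by nlinarith
    have hx2 : ‖x‖ ^ 2 < ‖x‖ ^ 3 := by nlinarith
    have hmul : ∀ {b c : K}, ‖b‖ < 1 → c ≠ 0 → ‖b * c‖ < ‖c‖ := fun {b c} hb hc => by
      rw [norm_mul]
      exact mul_lt_of_lt_one_left (norm_pos_iff.2 hc) hb
    have hxne : x ≠ 0 := norm_pos_iff.1 hx0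
    have hax : ‖a * x‖ < ‖x‖ := hmul ha hxne
    have hnψ : ‖ψ‖ = ‖x‖ ^ 4 := by
      have h33 : ‖3 * x ^ 3‖ = ‖x‖ ^ 3 := by rw [norm_mul, h3, one_mul, norm_pow]
      have h1 : ‖a ^ 2 * x ^ 2 + 3 * a * x + 3‖ < ‖x‖ ^ 3 := by
        refine norm_add_lt (norm_add_lt ?_ ?_) (by rw [h3]; exact one_lt_pow₀ hx three_ne_zero)
        · rw [← mul_pow, norm_pow]
          nlinarith [norm_nonneg (a * x)]
        · rw [mul_assoc, norm_mul, h3, one_mul]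
          linarith
      rw [hψ, norm_mul, add_assoc, add_assoc, ← add_assoc (a ^ 2 * x ^ 2),
        IsUltrametricDist.norm_add_eq_max_of_norm_ne_norm (by rw [h33]; exact h1.ne'), h33,
        max_eq_left h1.le]
      ring
    have hψ0 : ψ ≠ 0 := norm_pos_iff.1 (by rw [hnψ]; positivity)
    have hnD : ‖D ^ 2‖ < ‖x‖ ^ 3 := by
      have h1 : D ^ 2 = 4 * x ^ 3 + (a * x + 1) ^ 2 := by
        rw [hD]
        linear_combination 4 * e₁
      have h5 : ‖a * x + 1‖ < ‖x‖ := norm_add_lt hax (by rwa [norm_one])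
      rw [h1]
      refine norm_add_lt ?_ ?_
      · rw [← norm_pow]
        exact hmul h4 (pow_ne_zero 3 hxne)
      · rw [norm_pow]
        nlinarith [norm_nonneg (a * x + 1)]
    obtain ⟨x', y', h', e, hx'⟩ := three_smul_supersingularTwo hD hψ h hψ0
    refine ⟨x', y', h', e, ?_⟩
    have hN : ‖6 * x ^ 2 + a ^ 2 * x + a‖ < ‖x‖ ^ 2 := by
      refine norm_add_lt (norm_add_lt ?_ ?_) (by linarith)
      · rw [← norm_pow]
        exact hmul h6 (pow_ne_zero 2 hxne)
      · rw [sq, mul_assoc, norm_mul]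
        nlinarith [norm_nonneg a, norm_nonneg (a * x)]
    have hnx : ‖ψ ^ 2 * x'‖ = ‖x‖ ^ 9 := by
      have h1 : ‖x * ψ ^ 2‖ = ‖x‖ ^ 9 := by
        rw [norm_mul, norm_pow, hnψ]
        ring
      have h5 : ‖-((6 * x ^ 2 + a ^ 2 * x + a) * D ^ 2 * ψ) + D ^ 6‖ < ‖x‖ ^ 9 := by
        refine norm_add_lt ?_ ?_
        · rw [norm_neg, norm_mul, norm_mul, hnψ, show ‖x‖ ^ 9 = ‖x‖ ^ 2 * ‖x‖ ^ 3 * ‖x‖ ^ 4 by ring]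
          exact mul_lt_mul_of_pos_right (mul_lt_mul'' hN hnD (norm_nonneg _) (norm_nonneg _))
            (by positivity)
        · rw [show D ^ 6 = (D ^ 2) ^ 3 by ring, norm_pow, show ‖x‖ ^ 9 = (‖x‖ ^ 3) ^ 3 by ring]
          exact pow_lt_pow_left₀ hnD (norm_nonneg _) three_ne_zero
      rw [hx', sub_eq_add_neg, add_assoc,
        IsUltrametricDist.norm_add_eq_max_of_norm_ne_norm (by rw [h1]; exact h5.ne'), h1,
        max_eq_left h5.le]
    rw [norm_mul, norm_pow, hnψ] at hnx
    have h5 : ‖x'‖ = ‖x‖ := mul_left_cancel₀ (pow_pos hx0 8).ne' (by rw [← pow_succ, ← hnx]; ring)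
    rwa [h5]

/-- The identity `-2 (x, y) = (x⁴, y⁴)` on the curve `y² + y = x³` in characteristic `2`, where the
tangent at `(x, y)` has slope `x²`. -/
theorem neg_two_smul_supersingularTwo (h2 : ‖(2 : K)‖ < 1) (ha : ‖a‖ < 1) {x y : K}
    {h : (supersingularTwo a).toAffine.Nonsingular x y}
    (hP : IsPowTorsion 3 (Affine.Point.some x y h)) : ∃ x' y' h',
      -(2 • Affine.Point.some x y h) = Affine.Point.some x' y' h' ∧
      NormCong x' (x ^ 2 ^ 2) ∧ NormCong y' (y ^ 2 ^ 2) := by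
  have hE := isRigid_supersingularTwo h2 ha
  obtain ⟨hx, hy⟩ := hE.integral hP
  have e₁ := equation_supersingularTwo.1 h.1
  have h2' : (2 : NormResidueField K) = 0 := by
    rw [← map_ofNat (normReduce K) 2]
    exact normReduce_eq_zero_iff.2 h2
  obtain ⟨A, hA⟩ : ∃ z : unitBall K, (z : K) = a := ⟨⟨a, ha.le⟩, rfl⟩
  have hA' : normReduce K A = 0 := normReduce_eq_zero_iff.2 (hA ▸ ha)
  obtain ⟨X, hX⟩ : ∃ z : unitBall K, (z : K) = x := ⟨⟨x, hx⟩, rfl⟩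
  obtain ⟨Y, hY⟩ : ∃ z : unitBall K, (z : K) = y := ⟨⟨y, hy⟩, rfl⟩
  have r₁ : Y ^ 2 + A * X * Y + Y = X ^ 3 := Subtype.ext (by
    push_cast
    rw [hX, hY, hA, e₁])
  replace r₁ := congrArg (normReduce K) r₁
  simp only [map_mul, map_add, map_pow, hA', zero_mul, add_zero] at r₁
  have hD : ‖2 * y + a * x + 1‖ = 1 := by
    refine le_antisymm ?_ (not_lt.1 fun h0 => ?_)
    · rw [← hY, ← hA, ← hX]
      exact (2 * Y + A * X + 1).2
    · have h0' : normReduce K (2 * Y + A * X + 1) = 0 := normReduce_eq_zero_iff.2 (by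
        push_cast
        rwa [hY, hA, hX])
      simp only [map_mul, map_add, map_ofNat, map_one, hA', h2', zero_mul, zero_add] at h0'
      exact one_ne_zero h0'
  obtain ⟨l, x₂, y₂, h₂, e₂, hx₂, hy₂, hl⟩ := exists_two_smul_some h (by
    rw [← norm_ne_zero_iff]
    simp only [supersingularTwo]
    rw [hD]
    exact one_ne_zero)
  simp only [supersingularTwo] at hx₂ hy₂ hl
  have hlint : ‖l‖ ≤ 1 := by
    have h5 := congrArg norm hl
    rw [norm_mul, hD, mul_one] at h5
    rw [h5, show 3 * x ^ 2 + 2 * 0 * x + 0 - a * y = 3 * x ^ 2 - a * y by ring, ← hX, ← hA, ← hY]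
    exact (3 * X ^ 2 - A * Y).2
  obtain ⟨L, hL⟩ : ∃ z : unitBall K, (z : K) = l := ⟨⟨l, hlint⟩, rfl⟩
  have r₂ : L * (2 * Y + A * X + 1) = 3 * X ^ 2 - A * Y := Subtype.ext (by
    push_cast
    rw [hL, hY, hX, hA]
    linear_combination hl)
  replace r₂ := congrArg (normReduce K) r₂
  have hx₂' : x₂ = (L ^ 2 + A * L - 2 * X : unitBall K) := by
    push_cast
    rw [hx₂, hL, hA, hX]
    ring
  have hneg : -(2 • Affine.Point.some x y h) = Affine.Point.some x₂
      ((supersingularTwo a).toAffine.negY x₂ y₂) ((Affine.nonsingular_neg x₂ y₂).2 h₂) := by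
    rw [e₂]
    rfl
  have hnegY : (supersingularTwo a).toAffine.negY x₂ y₂ =
      (L * (L ^ 2 + A * L - 2 * X - X) + Y : unitBall K) := by
    simp only [Affine.negY, supersingularTwo]
    push_cast
    rw [hL, hA, hX, hY, hy₂, hx₂]
    ring
  have key : normReduce K (L ^ 2 + A * L - 2 * X) = normReduce K (X ^ 4) ∧
      normReduce K (L * (L ^ 2 + A * L - 2 * X - X) + Y) = normReduce K (Y ^ 4) := by
    simp only [map_mul, map_add, map_sub, map_pow, map_ofNat, map_one, hA', zero_mul, add_zero,
      sub_zero] at r₂ ⊢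
    generalize normReduce K X = x at *
    generalize normReduce K Y = y at *
    generalize normReduce K L = l at *
    have hl : l = x ^ 2 := by linear_combination r₂ + (x ^ 2 - l * y) * h2'
    subst hl
    refine ⟨by linear_combination -x * h2', ?_⟩
    linear_combination (-x ^ 3 + y - y ^ 2 + 1) * r₁ + (-x ^ 3 + y * x ^ 3 - y ^ 2) * h2'
  refine ⟨x₂, _, _, hneg, ?_, ?_⟩
  · rw [hx₂', ← hX]
    exact (NormCong.iff_normReduce (L ^ 2 + A * L - 2 * X).2 (X ^ 4).2).2 key.1
  · rw [hnegY, ← hY]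
    exact (NormCong.iff_normReduce (L * (L ^ 2 + A * L - 2 * X - X) + Y).2 (Y ^ 4).2).2 key.2

theorem exists_three_smul_eq_supersingularTwo [IsAlgClosed K] (h2 : ‖(2 : K)‖ < 1) (ha : ‖a‖ < 1)
    (P : (supersingularTwo a).toAffine.Point) : ∃ R, 3 • R = P := by
  rcases P with _ | ⟨x, y, h⟩
  · exact ⟨0, smul_zero _⟩
  -- the `x`-coordinate of a third of `P` is a root of a polynomial of degree `9`
  obtain ⟨z, hz⟩ : ∃ z : K, z * (z * (3 * z ^ 3 + a ^ 2 * z ^ 2 + 3 * a * z + 3)) ^ 2 -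
      (6 * z ^ 2 + a ^ 2 * z + a) * (4 * z ^ 3 + (a * z + 1) ^ 2) *
        (z * (3 * z ^ 3 + a ^ 2 * z ^ 2 + 3 * a * z + 3)) + (4 * z ^ 3 + (a * z + 1) ^ 2) ^ 3 =
      (z * (3 * z ^ 3 + a ^ 2 * z ^ 2 + 3 * a * z + 3)) ^ 2 * x := by
    have hdeg : (X * (X * (C 3 * X ^ 3 + C (a ^ 2) * X ^ 2 + C (3 * a) * X + C 3)) ^ 2 -
        (C 6 * X ^ 2 + C (a ^ 2) * X + C a) * (C 4 * X ^ 3 + (C a * X + 1) ^ 2) *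
          (X * (C 3 * X ^ 3 + C (a ^ 2) * X ^ 2 + C (3 * a) * X + C 3)) +
        (C 4 * X ^ 3 + (C a * X + 1) ^ 2) ^ 3 -
        (X * (C 3 * X ^ 3 + C (a ^ 2) * X ^ 2 + C (3 * a) * X + C 3)) ^ 2 * C x : K[X]).natDegree =
        9 := by
      compute_degree!
    obtain ⟨z, hz⟩ := IsAlgClosed.exists_root _ fun h0 => absurd
      (natDegree_eq_of_degree_eq_some h0) (hdeg.trans_ne (by norm_num))
    refine ⟨z, sub_eq_zero.1 ?_⟩
    simpa [IsRoot] using hz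
  obtain ⟨w, hw⟩ : ∃ w : K, w ^ 2 + (a * z + 1) * w - z ^ 3 = 0 := by
    have hdeg : (X ^ 2 + C (a * z + 1) * X - C (z ^ 3) : K[X]).degree = 2 := by compute_degree!
    obtain ⟨w, hw⟩ := IsAlgClosed.exists_root _ (hdeg.trans_ne (by norm_num))
    refine ⟨w, ?_⟩
    simpa [IsRoot] using hw
  have hw' : w ^ 2 + a * z * w + w = z ^ 3 := by linear_combination hw
  have hns := nonsingular_supersingularTwo h2 ha hw'
  obtain ⟨D, hD⟩ : ∃ D, D = 2 * w + a * z + 1 := ⟨_, rfl⟩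
  obtain ⟨ψ, hψ⟩ : ∃ ψ, ψ = z * (3 * z ^ 3 + a ^ 2 * z ^ 2 + 3 * a * z + 3) := ⟨_, rfl⟩
  have hD2 : 4 * z ^ 3 + (a * z + 1) ^ 2 = D ^ 2 := by
    rw [hD]
    linear_combination -4 * hw'
  rw [hD2, ← hψ] at hz
  -- if `ψ` vanishes, then so does `D`, and the point is singular
  have hψ0 : ψ ≠ 0 := by
    intro hψ0
    have hD0 : D = 0 := by
      rw [hψ0] at hz
      exact (pow_eq_zero_iff (n := 6) (by norm_num)).1 (by linear_combination hz)
    have hN0 : 3 * z ^ 2 - a * w = 0 := by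
      refine (pow_eq_zero_iff (n := 2) two_ne_zero).1 ?_
      rw [hD] at hD0
      rw [hψ] at hψ0
      linear_combination -hψ0 + (3 * z * (2 * w + a * z + 1) - a * (3 * z ^ 2 - a * w)) * hD0 +
        (-a ^ 2 - 12 * z) * hw'
    rcases ((Affine.nonsingular_iff' _ _).1 hns).2 with h' | h'
    · refine h' ?_
      simp only [supersingularTwo]
      linear_combination -hN0
    · refine h' ?_
      simp only [supersingularTwo]
      rw [← hD0, hD]
  obtain ⟨x', y', h', e, hx'⟩ := three_smul_supersingularTwo hD hψ hns hψ0
  have hxx : x' = x := by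
    refine mul_left_cancel₀ (pow_ne_zero 2 hψ0) ?_
    rw [hx', ← hz]
    ring
  subst hxx
  exact exists_nsmul_eq_of_X_eq e

/-- On the reduction `y² + y = x³`, the automorphism `J` is `(x, y) ↦ (ζ² x, y)`. Its fixed points
are `0`, `Q = (0, 0)` and `-Q = (0, -1)`. -/
theorem isSupersingularModel_supersingularTwo [IsAlgClosed K] (h2 : ‖(2 : K)‖ < 1)
    (ha : ‖a‖ < 1) : IsSupersingularModel 2 3 1 (supersingularTwo a) where
  toIsRigid := isRigid_supersingularTwo h2 ha
  divisible := exists_three_smul_eq_supersingularTwo h2 ha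
  neg_prime_smul := neg_two_smul_supersingularTwo h2 ha
  rotation := by
    intro ζ J hζ hJ
    have hE := isRigid_supersingularTwo h2 ha
    have hζ3 : ζ ^ 3 = 1 := hζ.pow_eq_one
    have hζn : ‖ζ‖ = 1 := by
      have h := congrArg norm hζ3
      rw [norm_pow, norm_one] at h
      exact (pow_eq_one_iff_of_nonneg (norm_nonneg _) three_ne_zero).1 h
    have hζc : NormCong ζ ζ := .refl hζn.le
    have h00 : (supersingularTwo a).toAffine.Nonsingular 0 0 :=
      nonsingular_supersingularTwo h2 ha (by ring)
    have h01 : (supersingularTwo a).toAffine.Nonsingular 0 (-1) :=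
      nonsingular_supersingularTwo h2 ha (by ring)
    have hnegQ : -Affine.Point.some 0 0 h00 = Affine.Point.some 0 (-1) h01 :=
      (Affine.Point.some.injEq ..).mpr ⟨rfl, by simp [Affine.negY, supersingularTwo]⟩
    have hQ3 : 3 • Affine.Point.some 0 0 h00 = 0 := by
      obtain ⟨l, x', y', h', e, hx', hy', hl⟩ := exists_two_smul_some h00
        (by simp [supersingularTwo])
      simp only [supersingularTwo] at hx' hy' hl
      have hl0 : l = 0 := by linear_combination hl
      have hx0 : x' = 0 := by rw [hx', hl0]; ring
      have hy0 : y' = -1 := by rw [hy', hl0, hx0]; ring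
      subst hx0 hy0
      rw [show (3 : ℕ) = 2 + 1 from rfl, add_smul, e, one_smul, ← hnegQ, neg_add_cancel]
    have hQt : IsPowTorsion 3 (Affine.Point.some 0 0 h00) := ⟨1, by rwa [pow_one]⟩
    -- the fixed points reduce to points with `x = 0`
    have hfix : ∀ P, IsPowTorsion 3 P → J P = P →
        ∃ k : ℤ, P = k • Affine.Point.some 0 0 h00 := by
      intro P hP hJP
      rcases P with _ | ⟨x, y, h⟩
      · exact ⟨0, by rw [zero_smul]; rfl⟩
      obtain ⟨hx, hy⟩ := hE.integral hP
      obtain ⟨x', y', h', e', hx', -⟩ := hJ x y h hP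
      rw [e'] at hJP
      obtain ⟨rfl, rfl⟩ := (Affine.Point.some.injEq ..).mp hJP
      have hx1 : ‖x'‖ < 1 := by
        have h3 : ‖(1 - ζ ^ 2) * x'‖ < 1 := by
          rw [sub_mul, one_mul]
          exact hx'.lt_one
        have h4 : ‖1 - ζ ^ 2‖ = 1 := by
          refine le_antisymm ((unitBall K).sub_mem (unitBall K).one_mem
            ((unitBall K).pow_mem hζn.le 2)) (not_lt.1 fun h4 => ?_)
          have := eq_of_pow_eq_one_of_norm_sub_lt_one (n := 3)
            (by exact_mod_cast norm_three_of_norm_two_lt_one h2) (one_pow 3)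
            (by rw [pow_right_comm, hζ3, one_pow]) h4
          exact hζ.pow_ne_one_of_pos_of_lt two_ne_zero (by norm_num) this.symm
        rwa [norm_mul, h4, one_mul] at h3
      have e₁ := congrArg norm (equation_supersingularTwo.1 h.1)
      have h5 : ‖y' * (y' + 1)‖ < 1 := by
        have h6 : y' * (y' + 1) = x' * (x' ^ 2 - a * y') := by
          linear_combination equation_supersingularTwo.1 h.1
        rw [h6, norm_mul]
        exact (mul_le_of_le_one_right (norm_nonneg _) ((unitBall K).sub_mem
          ((unitBall K).pow_mem hx 2) ((unitBall K).mul_mem ha.le hy))).trans_lt hx1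
      have hcx : NormCong x' 0 := ⟨hx, by simp, by simpa using hx1⟩
      rcases lt_or_ge ‖y'‖ 1 with hy1 | hy1
      · refine ⟨1, ?_⟩
        rw [one_smul]
        exact hE.injective hP hQt hcx ⟨hy, by simp, by simpa using hy1⟩
      · refine ⟨-1, ?_⟩
        have hQn := hQt.neg
        rw [neg_smul, one_smul, hnegQ]
        rw [hnegQ] at hQn
        refine hE.injective hP hQn hcx ⟨hy, by simp, ?_⟩
        rw [norm_mul, le_antisymm hy hy1, one_mul] at h5
        simpa using h5
    have hJ3 : ∀ P, IsPowTorsion 3 P → J (J (J P)) = P := by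
      intro P hP
      rcases P with _ | ⟨x, y, h⟩
      · rw [← Affine.Point.zero_def]
        simp
      obtain ⟨x₁, y₁, h₁, e₁, hx₁, hy₁⟩ := hJ x y h hP
      have hP₁ := hP.map J
      rw [e₁] at hP₁
      obtain ⟨x₂, y₂, h₂, e₂, hx₂, hy₂⟩ := hJ x₁ y₁ h₁ hP₁
      have hP₂ := hP₁.map J
      rw [e₂] at hP₂
      obtain ⟨x₃, y₃, h₃, e₃, hx₃, hy₃⟩ := hJ x₂ y₂ h₂ hP₂
      have hP₃ := hP₂.map J
      rw [e₃] at hP₃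
      rw [e₁, e₂, e₃]
      refine hE.injective hP₃ hP ?_ ?_
      · have := hx₃.trans ((hζc.pow 2).mul (hx₂.trans ((hζc.pow 2).mul hx₁)))
        rwa [show ζ ^ 2 * (ζ ^ 2 * (ζ ^ 2 * x)) = (ζ ^ 3) ^ 2 * x by ring, hζ3, one_pow,
          one_mul] at this
      · simp only [hζ3, one_mul] at hy₁ hy₂ hy₃
        exact hy₃.trans (hy₂.trans hy₁)
    refine ⟨fun P hP => ?_, .some 0 0 h00, Affine.Point.some_ne_zero _, hQt, ?_, hfix⟩
    · -- `J² + J + 1` maps `P = 3 R` to a multiple of `3 Q = 0`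
      obtain ⟨R, rfl⟩ := exists_three_smul_eq_supersingularTwo h2 ha P
      have hR := IsPowTorsion.of_smul hP
      obtain ⟨k, hk⟩ := hfix (J (J R) + J R + R) ((((hR.map J).map J).add (hR.map J)).add hR) (by
        rw [map_add, map_add, hJ3 R hR]
        abel)
      have h := congrArg (fun P => 3 • P) hk
      simp only [smul_add] at h
      rw [one_smul, map_nsmul, map_nsmul, h, smul_comm, hQ3, smul_zero]
    · obtain ⟨x', y', h', e', hx', hy'⟩ := hJ 0 0 h00 hQt
      have hQ' := hQt.map J
      rw [e'] at hQ' ⊢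
      exact hE.injective hQ' hQt (by simpa using hx') (by simpa using hy')

end SupersingularTwo

/-! ### The Euler factors at `2` and `3` -/

section BadPrimes

open WeierstrassCurve

/-- The transformation laws of the coefficients with denominators cleared. -/
theorem variableChange_eq_of_coeff {F : Type*} [Field F] {W W' : WeierstrassCurve F}
    {v : VariableChange F} (h₁ : W.a₁ + 2 * v.s = v.u * W'.a₁)
    (h₂ : W.a₂ - v.s * W.a₁ + 3 * v.r - v.s ^ 2 = (v.u : F) ^ 2 * W'.a₂)
    (h₃ : W.a₃ + v.r * W.a₁ + 2 * v.t = (v.u : F) ^ 3 * W'.a₃)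
    (h₄ : W.a₄ - v.s * W.a₃ + 2 * v.r * W.a₂ - (v.t + v.r * v.s) * W.a₁ + 3 * v.r ^ 2 -
      2 * v.s * v.t = (v.u : F) ^ 4 * W'.a₄)
    (h₆ : W.a₆ + v.r * W.a₄ + v.r ^ 2 * W.a₂ + v.r ^ 3 - v.t * W.a₃ - v.t ^ 2 -
      v.r * v.t * W.a₁ = (v.u : F) ^ 6 * W'.a₆) : v • W = W' := by
  have hu : (v.u : F) ≠ 0 := v.u.ne_zero
  ext
  · simp only [variableChange_def, h₁, Units.inv_mul_cancel_left]
  all_goals simp only [variableChange_def, h₂, h₃, h₄, h₆, Units.val_inv_eq_inv_val, ← mul_assoc,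
    inv_pow]
  all_goals rw [inv_mul_cancel₀ (pow_ne_zero _ hu), one_mul]

theorem localModel_curveE_one_third {p : ℕ} [Fact p.Prime]
    (v : VariableChange (PadicAlgCl p)) :
    localModel (curveE (1 / 3)) v = v • curveOneThird (PadicAlgCl p) := by
  rw [localModel, curveE_one_third, baseChange, baseChange, curveOneThird_map, curveOneThird_map]

theorem localModel_curveE_neg_one_third {p : ℕ} [Fact p.Prime]
    (v : VariableChange (PadicAlgCl p)) :
    localModel (curveE (-1 / 3)) v = v • curveNegOneThird (PadicAlgCl p) := by
  rw [localModel, curveE_neg_one_third, baseChange, baseChange, curveNegOneThird_map,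
    curveNegOneThird_map]

/-- The Euler factor for a change of variables with integers `r`, `s`, `t` and a scaling factor `u`
that is a `(p + 1)`-th root of an integer. -/
theorem isGaloisSymSqFactor_of_isSupersingularModel {p : ℕ} [Fact p.Prime] {W : WeierstrassCurve ℚ}
    {v : VariableChange (PadicAlgCl p)} {c : ℕ} (hc : auxPrime p = c + 2)
    (hE : IsSupersingularModel p (auxPrime p) c (localModel W v)) {r s t m : ℤ}
    (hr : v.r = r) (hs : v.s = s) (ht : v.t = t) (hu : (v.u : PadicAlgCl p) ^ (p + 1) = m)
    {φ σ₀ : PadicGal p} (hφ : IsFrobenius φ) (hσ₀ : σ₀ ∈ inertiaGroup p)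
    (hζ : IsPrimitiveRoot (scaleRatio v σ₀) (p + 1)) :
    IsGaloisSymSqFactor W p (1 + C (p : ℤ) * X) := by
  refine ⟨φ, hφ, fun x => ?_⟩
  rw [symSqDet_of_isSupersingularModel c hc hE (fun σ => by rw [hr, map_intCast])
    (fun σ => by rw [hs, map_intCast]) (fun σ => by rw [ht, map_intCast])
    (fun σ => by rw [hu, map_intCast]) hφ hσ₀ hζ]
  simp

theorem isPrimitiveRoot_three {K : Type*} [Field K] (h3 : (3 : K) ≠ 0) {ω : K}
    (hω : ω ^ 2 + ω + 1 = 0) : IsPrimitiveRoot ω 3 := by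
  have : Fact (Nat.Prime 3) := ⟨Nat.prime_three⟩
  rw [IsPrimitiveRoot.iff_orderOf]
  refine orderOf_eq_prime (by linear_combination (ω - 1) * hω) ?_
  rintro rfl
  exact h3 (by linear_combination hω)

theorem isPrimitiveRoot_four {K : Type*} [Field K] (h2 : (2 : K) ≠ 0) {ζ : K}
    (hζ : ζ ^ 2 = -1) : IsPrimitiveRoot ζ 4 := by
  have : Fact (Nat.Prime 2) := ⟨Nat.prime_two⟩
  rw [IsPrimitiveRoot.iff_orderOf]
  refine orderOf_eq_prime_pow (p := 2) (n := 1) (fun h => h2 ?_) ?_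
  · rw [pow_one] at h
    linear_combination hζ - h
  · linear_combination (ζ ^ 2 - 1) * hζ

/-- The scaling factor is `u` for `E_{1/3}` and `u²` for `E_{-1/3}`, where `u³ = 2`. The models are
`y² + y = x³` and `y² + 3 u x y + y = x³`. -/
theorem isGaloisSymSqFactor_curveE_two :
    IsGaloisSymSqFactor (curveE (1 / 3)) 2 (1 + C ((2 : ℕ) : ℤ) * X) ∧
    IsGaloisSymSqFactor (curveE (-1 / 3)) 2 (1 + C ((2 : ℕ) : ℤ) * X) := by
  obtain ⟨φ, σ, hφ, hσ, u, ω, hu, hω, hσu⟩ := exists_inertia_two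
  have hu0 : u ≠ 0 := by
    rintro rfl
    norm_num at hu
  have h2 : ‖(2 : PadicAlgCl 2)‖ = 2⁻¹ := by simpa using PadicAlgCl.norm_prime (p := 2)
  have h2' : ‖(2 : PadicAlgCl 2)‖ < 1 := by rw [h2]; norm_num
  have h3 : ‖(3 : PadicAlgCl 2)‖ = 1 := norm_three_of_norm_two_lt_one h2'
  have hnu : ‖u‖ ^ 3 = 2⁻¹ := by rw [← norm_pow, hu, h2]
  refine ⟨?_, ?_⟩
  · let v : VariableChange (PadicAlgCl 2) := ⟨Units.mk0 u hu0, -2, 1, 2⟩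
    have hmodel : localModel (curveE (1 / 3)) v = supersingularTwo 0 := by
      rw [localModel_curveE_one_third]
      apply variableChange_eq_of_coeff <;> simp only [v, curveOneThird, supersingularTwo, Units.val_mk0]
      · ring
      · ring
      · linear_combination -hu
      · ring
      · ring
    refine isGaloisSymSqFactor_of_isSupersingularModel (v := v) (c := 1) (r := -2) (s := 1) (t := 2)
      (m := 2) rfl (by
        rw [hmodel]
        exact isSupersingularModel_supersingularTwo h2' (by simp)) (by simp [v]) (by simp [v])
      (by simp [v]) (by simpa [v] using hu) hφ hσ ?_
    rw [scaleRatio]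
    change IsPrimitiveRoot (σ u / u) 3
    rw [hσu, mul_div_cancel_right₀ _ hu0]
    exact isPrimitiveRoot_three three_ne_zero hω
  · have hu4 : (u ^ 2) ^ 3 = 4 := by
      rw [pow_right_comm, hu]
      norm_num
    let v : VariableChange (PadicAlgCl 2) := ⟨Units.mk0 (u ^ 2) (pow_ne_zero 2 hu0), 4, 1, 0⟩
    have hmodel : localModel (curveE (-1 / 3)) v = supersingularTwo (3 * u) := by
      rw [localModel_curveE_neg_one_third]
      apply variableChange_eq_of_coeff <;> simp only [v, curveNegOneThird, supersingularTwo, Units.val_mk0]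
      · linear_combination -3 * hu
      · ring
      · linear_combination -hu4
      · ring
      · ring
    refine isGaloisSymSqFactor_of_isSupersingularModel (v := v) (c := 1) (r := 4) (s := 1) (t := 0)
      (m := 4) rfl (by
        rw [hmodel]
        refine isSupersingularModel_supersingularTwo h2' ?_
        rw [norm_mul, h3, one_mul]
        refine (pow_lt_one_iff_of_nonneg (norm_nonneg _) three_ne_zero).1 ?_
        rw [hnu]
        norm_num) (by simp [v]) (by simp [v])
      (by simp [v]) (by simpa [v] using hu4) hφ hσ ?_
    rw [scaleRatio]
    change IsPrimitiveRoot (σ (u ^ 2) / u ^ 2) 3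
    rw [map_pow, hσu, mul_pow, mul_div_cancel_right₀ _ (pow_ne_zero 2 hu0)]
    refine isPrimitiveRoot_three three_ne_zero ?_
    linear_combination (ω ^ 2 - ω + 1) * hω

/-- The scaling factor satisfies `u⁴ = -3` for `E_{1/3}` and `u⁴ = 3` for `E_{-1/3}`. The models are
`y² = x³ + u² x² - x` and `y² = x³ + 2 u² x² - x`. -/
theorem isGaloisSymSqFactor_curveE_three :
    IsGaloisSymSqFactor (curveE (1 / 3)) 3 (1 + C ((3 : ℕ) : ℤ) * X) ∧
    IsGaloisSymSqFactor (curveE (-1 / 3)) 3 (1 + C ((3 : ℕ) : ℤ) * X) := by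
  obtain ⟨φ, σ, hφ, hσ, hσu⟩ := exists_inertia_three
  have h3 : ‖(3 : PadicAlgCl 3)‖ < 1 := by
    simpa using PadicAlgCl.norm_prime_lt_one (p := 3)
  have h2 : ‖(2 : PadicAlgCl 3)‖ = 1 := norm_two_of_norm_three_lt_one h3
  have hlt : ∀ u : PadicAlgCl 3, ‖u ^ 4‖ < 1 → ‖u ^ 2‖ < 1 := fun u hu => by
    rw [show u ^ 4 = (u ^ 2) ^ 2 by ring, norm_pow] at hu
    exact (pow_lt_one_iff_of_nonneg (norm_nonneg _) two_ne_zero).1 hu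
  have hprim : ∀ u : PadicAlgCl 3, u ≠ 0 → u ^ 4 = 3 ∨ u ^ 4 = -3 →
      IsPrimitiveRoot (σ u / u) 4 := fun u hu0 hu => by
    refine isPrimitiveRoot_four two_ne_zero ?_
    rw [div_pow, hσu u hu, neg_div, div_self (pow_ne_zero 2 hu0)]
  refine ⟨?_, ?_⟩
  · obtain ⟨u, hu⟩ := IsAlgClosed.exists_pow_nat_eq (-3 : PadicAlgCl 3) (n := 4) (by norm_num)
    have hu0 : u ≠ 0 := by
      rintro rfl
      norm_num at hu
    let v : VariableChange (PadicAlgCl 3) := ⟨Units.mk0 u hu0, -3, 1, 0⟩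
    have hmodel : localModel (curveE (1 / 3)) v = supersingularThree (u ^ 2) := by
      rw [localModel_curveE_one_third]
      apply variableChange_eq_of_coeff <;> simp only [v, curveOneThird, supersingularThree, Units.val_mk0]
      · ring
      · linear_combination -hu
      · ring
      · linear_combination hu
      · ring
    exact isGaloisSymSqFactor_of_isSupersingularModel (v := v) (c := 0) (r := -3) (s := 1) (t := 0)
      (m := -3) rfl (by
        rw [hmodel]
        exact isSupersingularModel_supersingularThree h3 (hlt u (by rwa [hu, norm_neg])))
      (by simp [v]) (by simp [v]) (by simp [v]) (by simpa [v] using hu) hφ hσ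
      (hprim u hu0 (Or.inr hu))
  · obtain ⟨u, hu⟩ := IsAlgClosed.exists_pow_nat_eq (3 : PadicAlgCl 3) (n := 4) (by norm_num)
    have hu0 : u ≠ 0 := by
      rintro rfl
      norm_num at hu
    let v : VariableChange (PadicAlgCl 3) := ⟨Units.mk0 u hu0, 3, -2, 0⟩
    have hmodel : localModel (curveE (-1 / 3)) v = supersingularThree (2 * u ^ 2) := by
      rw [localModel_curveE_neg_one_third]
      apply variableChange_eq_of_coeff <;> simp only [v, curveNegOneThird, supersingularThree, Units.val_mk0]
      · ring
      · linear_combination -2 * hu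
      · ring
      · linear_combination hu
      · ring
    exact isGaloisSymSqFactor_of_isSupersingularModel (v := v) (c := 0) (r := 3) (s := -2) (t := 0)
      (m := 3) rfl (by
        rw [hmodel]
        refine isSupersingularModel_supersingularThree h3 ?_
        rw [norm_mul, h2, one_mul]
        exact hlt u (by rwa [hu]))
      (by simp [v]) (by simp [v]) (by simp [v]) (by simpa [v] using hu) hφ hσ
      (hprim u hu0 (Or.inl hu))

theorem isGaloisSymSqFactor_curveE (p : ℕ) [Fact p.Prime] (h : p = 2 ∨ p = 3) :
    IsGaloisSymSqFactor (curveE (1 / 3)) p (1 + C (p : ℤ) * X) ∧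
    IsGaloisSymSqFactor (curveE (-1 / 3)) p (1 + C (p : ℤ) * X) := by
  rcases h with rfl | rfl
  · exact isGaloisSymSqFactor_curveE_two
  · exact isGaloisSymSqFactor_curveE_three

end BadPrimes

/-! ### The Euler product of `L(χ₋₃, s - 1) L(g, s)` -/

section EulerFactors

theorem chiNegThree_apply_of_mod_three {p : ℕ} (h : p % 3 = 1) : chiNegThree p = 1 := by
  have : (p : ZMod 3) = 1 := by
    rw [← ZMod.natCast_mod, h, Nat.cast_one]
  rw [this, map_one]

theorem chiNegThree_apply_of_mod_three' {p : ℕ} (h : p % 3 = 2) : chiNegThree p = -1 := by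
  have : (p : ZMod 3) = 2 := by
    rw [← ZMod.natCast_mod, h, Nat.cast_ofNat]
  have h2 : quadraticChar (ZMod 3) 2 = -1 := by decide
  rw [this, chiNegThree, MulChar.ringHomComp_apply, h2]
  simp

theorem chiNegThree_three : chiNegThree ((3 : ℕ) : ZMod 3) = 0 := by
  rw [ZMod.natCast_self]
  exact MulChar.map_nonunit _ (by simp)

theorem chiNegThree_ne_one : chiNegThree ≠ 1 := by
  intro h
  have h2 := chiNegThree_apply_of_mod_three' (p := 2) (by norm_num)
  have hu : IsUnit (2 : ZMod 3) := by decide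
  rw [h, Nat.cast_ofNat, MulChar.one_apply hu] at h2
  norm_num at h2

/-- The polynomial of the Euler factor at `p` of `L(χ₋₃, s - 1) L(g, s)`, in terms of the trace of
Frobenius `t`. -/
def symSqPoly (p : ℕ) (t : ℤ) : ℤ[X] :=
  if p ≤ 3 then 1 + C (p : ℤ) * X else
    (1 - C (p : ℤ) * X) * (1 - C (t ^ 2 - 2 * (p : ℤ)) * X + C ((p : ℤ) ^ 2) * X ^ 2)

/-- What is used of the traces of Frobenius `t` of `y² = x³ + 1`: a prime `p ≡ 1` modulo `3` is
the norm of `t / 2 + B√-3`, and the other primes are supersingular. -/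
def IsTraceFunction (t : ℕ → ℤ) : Prop :=
  ∀ p : ℕ, p.Prime → 3 < p → (p % 3 = 2 → t p = 0) ∧
    (p % 3 = 1 → ∃ A B : ℤ, A ^ 2 + 3 * B ^ 2 = p ∧ t p = 2 * A)

/-- The eigenvalue of the Hecke operator at `p` on `g`. -/
def heckeEigenvalue (t : ℕ → ℤ) (p : ℕ) : ℤ :=
  if p = 3 then -3 else if p % 3 = 1 then t p ^ 2 - 2 * p else 0

/-- The number `χ(p) p²`, where `χ` is the nebentypus of `g`. -/
def heckeCharacter (p : ℕ) : ℤ :=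
  if p ≤ 3 then 0 else if p % 3 = 1 then (p : ℤ) ^ 2 else -(p : ℤ) ^ 2

variable {t : ℕ → ℤ}

theorem heckeEigenvalue_of_mod_three {p : ℕ} (h : p % 3 = 1) :
    heckeEigenvalue t p = t p ^ 2 - 2 * p := by
  rw [heckeEigenvalue, if_neg (by omega), if_pos h]

theorem heckeEigenvalue_of_mod_three' {p : ℕ} (h : p % 3 = 2) : heckeEigenvalue t p = 0 := by
  rw [heckeEigenvalue, if_neg (by omega), if_neg (by omega)]

theorem heckeCharacter_of_mod_three {p : ℕ} (h3 : 3 < p) (h : p % 3 = 1) :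
    heckeCharacter p = (p : ℤ) ^ 2 := by
  rw [heckeCharacter, if_neg (by omega), if_pos h]

theorem heckeCharacter_of_mod_three' {p : ℕ} (h3 : 3 < p) (h : p % 3 = 2) :
    heckeCharacter p = -(p : ℤ) ^ 2 := by
  rw [heckeCharacter, if_neg (by omega), if_neg (by omega)]

theorem Nat.Prime.eq_two_or_three_or {p : ℕ} (hp : p.Prime) :
    p = 2 ∨ p = 3 ∨ 3 < p ∧ (p % 3 = 1 ∨ p % 3 = 2) := by
  have h2 := hp.two_le
  rcases (by omega : p = 2 ∨ p = 3 ∨ 3 < p) with h | h | h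
  · exact Or.inl h
  · exact Or.inr (Or.inl h)
  · refine Or.inr (Or.inr ⟨h, ?_⟩)
    have : ¬ 3 ∣ p := fun hd => by
      have := (Nat.prime_dvd_prime_iff_eq Nat.prime_three hp).1 hd
      omega
    omega

/-- The form `g` is a Hecke eigenform. At `p ≡ 1` modulo `3` its eigenvalue is
`2 (A² - 3 B²) = (2 A)² - 2 p`. -/
theorem hasHeckeRelation_gCoeff_of_isTraceFunction (ht : IsTraceFunction t) (p : ℕ) (hp : p.Prime) :
    HasHeckeRelation gCoeff p (heckeEigenvalue t p) (heckeCharacter p) := by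
  rcases hp.eq_two_or_three_or with rfl | rfl | ⟨h3, h1 | h2⟩
  · simpa [heckeEigenvalue, heckeCharacter] using hasHeckeRelation_gCoeff_two
  · refine hasHeckeRelation_gCoeff hp (by norm_num) fun n => ?_
    rw [thetaCoeff_three_mul]
    simp [heckeEigenvalue, heckeCharacter]
  · obtain ⟨A, B, hAB, htA⟩ := (ht p hp h3).2 h1
    refine hasHeckeRelation_gCoeff hp (by omega) fun n => ?_
    rw [thetaCoeff_mul_of_norm hp (by omega) hAB (by omega),
      heckeEigenvalue_of_mod_three h1, heckeCharacter_of_mod_three h3 h1, htA]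
    congr 2
    rw [← hAB]
    ring
  · refine hasHeckeRelation_gCoeff hp (by omega) fun n => ?_
    rw [thetaCoeff_mul_of_mod_three_eq_two hp (by omega) h2,
      heckeEigenvalue_of_mod_three' h2, heckeCharacter_of_mod_three' h3 h2]
    split_ifs <;> ring

/-- The Euler factors of `L(χ₋₃, s - 1)` and `L(g, s)` multiply to that of the symmetric square. -/
theorem aeval_symSqPoly (ht : IsTraceFunction t) {p : ℕ} (hp : p.Prime) (x : ℂ) :
    aeval x (symSqPoly p (t p)) = (1 - chiNegThree p * (p * x)) *
      (1 - heckeEigenvalue t p * x + heckeCharacter p * x ^ 2) := by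
  rcases hp.eq_two_or_three_or with rfl | rfl | ⟨h3, h1 | h2⟩
  · rw [chiNegThree_apply_of_mod_three' (by norm_num)]
    simp [symSqPoly, heckeEigenvalue, heckeCharacter, map_ofNat]
  · rw [chiNegThree_three]
    simp [symSqPoly, heckeEigenvalue, heckeCharacter, map_ofNat]
  · rw [chiNegThree_apply_of_mod_three h1, symSqPoly, if_neg (by omega),
      heckeEigenvalue_of_mod_three h1, heckeCharacter_of_mod_three h3 h1]
    simp [map_ofNat]
  · rw [chiNegThree_apply_of_mod_three' h2, symSqPoly, if_neg (by omega),
      heckeEigenvalue_of_mod_three' h2, heckeCharacter_of_mod_three' h3 h2, (ht p hp h3).1 h2]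
    simp [map_ofNat]
    ring

/-- The function `L(χ₋₃, s - 1) L(g, s)`. -/
def symSqLFunction (s : ℂ) : ℂ := DirichletCharacter.LFunction chiNegThree (s - 1) * gLFunction s

theorem differentiable_symSqLFunction : Differentiable ℂ symSqLFunction := by
  have h := DirichletCharacter.differentiable_LFunction chiNegThree_ne_one
  exact (h.comp (differentiable_id.sub_const 1)).mul differentiable_gLFunction

theorem hasProd_symSqLFunction (ht : IsTraceFunction t) {s : ℂ} (hs : 2 < s.re) :
    HasProd (fun p : Nat.Primes => (aeval ((p : ℂ) ^ (-s)) (symSqPoly p (t p)))⁻¹)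
      (symSqLFunction s) := by
  have hs1 : 1 < (s - 1).re := by
    rw [Complex.sub_re, Complex.one_re]
    linarith
  have h1 := DirichletCharacter.LSeries_eulerProduct_hasProd chiNegThree hs1
  rw [← DirichletCharacter.LFunction_eq_LSeries chiNegThree hs1] at h1
  have h2 := hasProd_of_hasHeckeRelation gCoeff_one (hasHeckeRelation_gCoeff_of_isTraceFunction ht)
    (lseriesSummable_gCoeff hs)
  rw [(lseriesHasSum_gCoeff hs).LSeries_eq] at h2
  have h3 := h1.mul h2
  rw [symSqLFunction]
  convert h3 using 2 with p
  have hp0 : ((p : ℕ) : ℂ) ≠ 0 := by exact_mod_cast p.2.ne_zero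
  rw [aeval_symSqPoly ht p.2, mul_inv, show -(s - 1) = 1 + -s by ring, Complex.cpow_add _ _ hp0,
    Complex.cpow_one]

end EulerFactors

/-- The symmetric square `L`-function of a curve with the local data of `y² = x³ + 1`. -/
theorem isSymSqLFunction_symSqLFunction {W : WeierstrassCurve ℚ} {t : ℕ → ℤ}
    (ht : IsTraceFunction t)
    (hgood : ∀ (p : ℕ) [Fact p.Prime], 3 < p →
      (localMinimal W p).HasGoodReduction ℤ_[p] ∧ frobeniusTrace W p = t p)
    (hbad : ∀ (p : ℕ) [Fact p.Prime], p = 2 ∨ p = 3 →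
      ¬ (localMinimal W p).HasGoodReduction ℤ_[p] ∧ IsGaloisSymSqFactor W p (1 + C (p : ℤ) * X)) :
    IsSymSqLFunction W symSqLFunction where
  entire := differentiable_symSqLFunction
  eulerProduct := by
    refine ⟨fun p => symSqPoly p (t p), fun p => ?_, fun s hs => hasProd_symSqLFunction ht hs⟩
    have : Fact (p : ℕ).Prime := ⟨p.2⟩
    rcases p.2.eq_two_or_three_or with h | h | ⟨h3, -⟩
    · obtain ⟨h1, h2⟩ := hbad p (Or.inl h)
      refine ⟨fun h' => absurd h' h1, fun _ => ?_⟩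
      have e : symSqPoly p (t p) = 1 + C ((p : ℕ) : ℤ) * X := if_pos (by omega)
      rwa [← e] at h2
    · obtain ⟨h1, h2⟩ := hbad p (Or.inr h)
      refine ⟨fun h' => absurd h' h1, fun _ => ?_⟩
      have e : symSqPoly p (t p) = 1 + C ((p : ℕ) : ℤ) * X := if_pos (by omega)
      rwa [← e] at h2
    · obtain ⟨h1, h2⟩ := hgood p h3
      refine ⟨fun _ => ?_, fun h' => absurd h1 h'⟩
      rw [h2]
      exact if_neg (by omega)

/-! ### The symmetric square `L`-functions of `E_{1/3}` and `E_{-1/3}` -/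

theorem mainTheorem4 :
    (∃ v : WeierstrassCurve.VariableChange ℚ,
      v • curveE (1 / 3) = (⟨0, 0, 0, 0, 1⟩ : WeierstrassCurve ℚ)) ∧
    ∃ L₁ L₂ Lg : ℂ → ℂ,
      IsSymSqLFunction (curveE (-1 / 3)) L₁ ∧
      IsSymSqLFunction (curveE (1 / 3)) L₂ ∧
      IsCuspLFunction gForm Lg ∧
      ∀ s : ℂ, L₁ s = L₂ s ∧
        L₂ s = DirichletCharacter.LFunction chiNegThree (s - 1) * Lg s := by
  classical
  set t : ℕ → ℤ := fun p => if h : p.Prime then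
    have : Fact p.Prime := ⟨h⟩
    frobeniusTrace (curveE (1 / 3)) p else 0 with ht
  have htp : ∀ (p : ℕ) [Fact p.Prime], t p = frobeniusTrace (curveE (1 / 3)) p := fun p hp => by
    rw [ht]
    exact dif_pos hp.out
  have htrace : IsTraceFunction t := fun p hp h3 => by
    have : Fact p.Prime := ⟨hp⟩
    obtain ⟨u, h1, -, h2⟩ := frobeniusTrace_curveE (p := p) h3
    rwa [htp, h1]
  refine ⟨⟨⟨1, -2, 1, 1⟩, ?_⟩, symSqLFunction, symSqLFunction, gLFunction,
    isSymSqLFunction_symSqLFunction htrace (fun p _ h3 => ?_) (fun p _ h => ?_),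
    isSymSqLFunction_symSqLFunction htrace (fun p _ h3 => ?_) (fun p _ h => ?_),
    isCuspLFunction_gLFunction, fun s => ⟨rfl, rfl⟩⟩
  · rw [curveE_one_third, variableChange_curveOneThird]
  · obtain ⟨u, h1, h2, -⟩ := frobeniusTrace_curveE (p := p) h3
    exact ⟨(hasGoodReduction_curveE h3).2, by rw [htp, h1, h2]⟩
  · exact ⟨(not_hasGoodReduction_curveE h).2, (isGaloisSymSqFactor_curveE p h).2⟩
  · exact ⟨(hasGoodReduction_curveE h3).1, (htp p).symm⟩
  · exact ⟨(not_hasGoodReduction_curveE h).1, (isGaloisSymSqFactor_curveE p h).1⟩
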